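/- Theorem (Nash--Moser--Zehnder). Let $Z$ be a compact smooth manifold, possibly with boundary, and let $V$, $W$ be smooth (real or complex, for instance Hermitian) vector bundles of finite rank over $Z$. For integers $s\ge 0$ let $|\cdot|_s$ and $\|\cdot\|_s$ be $L^2_s$-norms (Sobolev norms with $s$ derivatives in $L^2$, fixed within their equivalence class) on $\mathcal{C}^{\infty}(Z,V)$ and $\mathcal{C}^{\infty}(Z,W)$, respectively. Let $d>0$ be an integer. Then there is an integer $D$ such that for every $M\in\mathbb{R}$ there is $\eta>0$ with the following property. Let $\phi:\mathcal{C}^{\infty}(Z,V)\to\mathcal{C}^{\infty}(Z,W)$ be a map, $u_0\in\mathcal{C}^{\infty}(Z,V)$, $\delta>0$, and let $C_1,C_2,C_3$ and $(C_s)_{s\ge d}$ be real constants ($C_1,C_2,C_3$ are not members of the family $(C_s)_{s\geq d}$). Suppose that for every $u\in\mathcal{C}^{\infty}(Z,V)$ with $|u-u_0|_{3d}<\delta$: (a) $\phi$ is twice (Gateaux) differentiable at $u$ over $\mathbb{R}$ with respect to the $\mathcal{C}^\infty$ topology, with linear first derivative $\phi'(u)$ and bilinear second derivative $\phi''(u)$,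 and for all $v,w\in\mathcal{C}^{\infty}(Z,V)$ $$\|\phi(u)\|_s\le C_s(1+|u|_{s+d})\ \ \text{for all integers } s\ge d,\qquad \|\phi'(u)v\|_{2d}\le C_1|v|_{3d},\qquad \|\phi''(u)(v,w)\|_{2d}\le C_2|v|_{3d}|w|_{3d};$$ (b) there are maps $\psi(u):\mathcal{C}^{\infty}(Z,W)\to\mathcal{C}^{\infty}(Z,V)$ and $\mathcal{E}(u):\mathcal{C}^{\infty}(Z,W)\times\mathcal{C}^{\infty}(Z,W)\to\mathcal{C}^{\infty}(Z,W)$ such that for all $\varphi,\rho\in\mathcal{C}^{\infty}(Z,W)$ $$\phi'(u)\psi(u)\varphi=\varphi+\mathcal{E}(u)(\phi(u),\varphi),\qquad \|\mathcal{E}(u)(\varphi,\rho)\|_{2d}\le C_3\|\varphi\|_{3d}\|\rho\|_{3d},$$ $$|\psi(u)\varphi|_s\le C_s\big(\|\varphi\|_{s+d}+|u|_{s+d}\|\varphi\|_{2d}\big)\ \ \text{for all integers } s\ge d.$$ If $1/\delta$, $|u_0|_D$, $C_1$, $C_2$, $C_3$ and all $C_s$ with $d\le s\le D$ are at most $M$,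 and $\|\phi(u_0)\|_{2d}\le\eta$, then there exists $u\in\mathcal{C}^{\infty}(Z,V)$ with $\phi(u)=0$. -/

import Mathlib

open scoped Manifold ContDiff Bundle Topology
open Set Filter Bundle

namespace NashMoser

/-- The model with corners `I` on `ℝⁿ` is a model for manifolds with (possibly empty) boundary:
its range is all of `ℝⁿ` (as for `𝓡 n`), or `n > 0` and its range is the closed half space
`{y | 0 ≤ y₀}` (as for `𝓡∂ n`). -/
def IsBoundaryModel {n : ℕ} {H : Type*} [TopologicalSpace H]
    (I : ModelWithCorners ℝ (EuclideanSpace ℝ (Fin n)) H) : Prop :=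
  range I = univ ∨
    ∃ hn : 0 < n, range I = {y : EuclideanSpace ℝ (Fin n) | 0 ≤ y ⟨0, hn⟩}

section Sobolev

variable {n : ℕ} {H : Type*} [TopologicalSpace H]
  (I : ModelWithCorners ℝ (EuclideanSpace ℝ (Fin n)) H)
  {Z : Type*} [TopologicalSpace Z] [ChartedSpace H Z]
  (F : Type*) [NormedAddCommGroup F] [NormedSpace ℝ F]
  (V : Z → Type*) [TopologicalSpace (TotalSpace F V)]
  [∀ x, AddCommGroup (V x)] [∀ x, Module ℝ (V x)] [∀ x, TopologicalSpace (V x)]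
  [FiberBundle F V]

/-- Finitely many charts of `Z` and local trivializations of `V` around chosen points, with a
smooth partition of unity on `Z` subordinate to their common domains. -/
structure Localization where
  /-- number of charts -/
  m : ℕ
  /-- the points around which chart and trivialization are taken -/
  c : Fin m → Z
  /-- the partition of unity -/
  ρ : SmoothPartitionOfUnity (Fin m) I Z univ
  subordinate : ρ.IsSubordinate fun i =>
    (chartAt H (c i)).source ∩ (trivializationAt F V (c i)).baseSet

variable {I F V}

/-- The section `ρᵢ u`, read in the `i`-th chart and trivialization and extended by zero: a
function from `ℝⁿ` to the model fibre. Only its values on `range I` (the whole space or the closed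
half space) matter; there it is smooth with compact support. -/
noncomputable def Localization.localRep (A : Localization I F V) (u : Cₛ^∞⟮I; F, V⟯)
    (i : Fin A.m) : EuclideanSpace ℝ (Fin n) → F :=
  (extChartAt I (A.c i)).target.indicator fun x =>
    A.ρ i ((extChartAt I (A.c i)).symm x) •
      (trivializationAt F V (A.c i)
        ⟨(extChartAt I (A.c i)).symm x, u ((extChartAt I (A.c i)).symm x)⟩).2

/-- The `L²_s`-norm of a smooth section in local coordinates:
`(∑ᵢ ∑_{j ≤ s} ∫ |Dʲ(ρᵢ u)|²)^{1/2}`. -/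
noncomputable def Localization.sobolevNorm (A : Localization I F V) (s : ℕ)
    (u : Cₛ^∞⟮I; F, V⟯) : ℝ :=
  Real.sqrt (∑ i : Fin A.m, ∑ j ∈ Finset.range (s + 1),
    ∫ x in range I, ‖iteratedFDerivWithin ℝ j (A.localRep u i) (range I) x‖ ^ 2)

end Sobolev

section Norms

variable {n : ℕ} {H : Type*} [TopologicalSpace H]
  {I : ModelWithCorners ℝ (EuclideanSpace ℝ (Fin n)) H}
  {Z : Type*} [TopologicalSpace Z] [ChartedSpace H Z]
  {F : Type*} [NormedAddCommGroup F] [NormedSpace ℝ F]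
  {V : Z → Type*} [TopologicalSpace (TotalSpace F V)]
  [∀ x, AddCommGroup (V x)] [∀ x, Module ℝ (V x)] [∀ x, TopologicalSpace (V x)]
  [FiberBundle F V] [VectorBundle ℝ F V]

/-- `N s`, `s = 0, 1, 2, …`, are `L²_s`-norms on the smooth sections of `V`. On a compact manifold
the `L²_s`-norm is determined only up to equivalence (it depends on metrics, connections or
charts), so this says: for each `s`, `N s` is equivalent to the `L²_s`-norm in coordinates. -/
def IsSobolevNorms (N : ℕ → Seminorm ℝ Cₛ^∞⟮I; F, V⟯) : Prop :=
  ∃ A : Localization I F V, ∀ s : ℕ, ∃ a b : ℝ, 0 < a ∧ 0 < b ∧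
    ∀ u, a * A.sobolevNorm s u ≤ N s u ∧ N s u ≤ b * A.sobolevNorm s u

end Norms

/-- The linear map `L` is the (Gateaux) derivative at `u` of the map `f` between vector spaces
`X`, `Y`, where `Y` has the topology defined by the seminorms `N s`: for every `v`,
`(f (u + t v) - f u) / t → L v` in each of these seminorms as `t → 0`. -/
def HasDerivativeAt {X Y : Type*} [AddCommGroup X] [Module ℝ X] [AddCommGroup Y] [Module ℝ Y]
    (N : ℕ → Seminorm ℝ Y) (f : X → Y) (L : X →ₗ[ℝ] Y) (u : X) : Prop :=
  ∀ (v : X) (s : ℕ),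
    Tendsto (fun t : ℝ => N s (t⁻¹ • (f (u + t • v) - f u) - L v)) (𝓝[≠] 0) (𝓝 0)

end NashMoser

set_option linter.unusedSectionVars false

universe u

/-! The zero of `φ` is the limit of a smoothed Newton iteration, u_{j+1} = u_j - S_{θ_j} ψ(u_j)
φ(u_j). The approximate inverse ψ loses derivatives, so each correction is passed through a
smoothing operator S_θ; the lost derivatives then cost powers of θ, and the quadratic gain of
Newton's method outweighs them. The step is quadratic because Taylor's formula leaves a remainder of
size |v|² and because the defect of ψ is itself proportional to φ(u); the only further error is that
of smoothing (`IsTamelyInvertible.map_newton_le`).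

Take θ_{j+1} = θ_j^{3/2} and q = θ_j^d. Three facts are propagated together in
`exists_newtonSeq_bounds`: u_j stays near u₀ in the norm of order 4d, its norm of order 27d grows at
most like q⁶, and ‖φ(u_j)‖ of order 2d is at most q⁻¹⁰. Interpolation and the tame bounds give a
correction of size q⁻⁸ at order 3d and a smoothing error of size q⁻¹⁶ there, so that the new ‖φ‖ is
a constant times q⁻¹⁶, which is below q⁻¹⁵, the next value of q⁻¹⁰. No norm of order above 27d
enters, hence D = 27d, and the threshold depends only on M.

In the higher norms no smallness is available, but the corrections grow at most like q⁸
(`exists_newtonSeq_highNorm_le`). Interpolating this growth with the decay q⁻⁸ at order 3d makes the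
corrections geometrically small in every norm (`exists_newtonSeq_sub_le_geometric`), so the iterates
converge in the smooth topology.

The iteration needs only the properties collected in `IsTameScale`. For Sobolev norms they are
proved in charts. Mollification x ↦ ∫ k(y) f(x + εy) dy with k supported in the interior of the half
space only uses values of f in the half space, so boundary points need no extension operator. If R
denotes f minus its mollification, then R commutes with derivatives and gains one factor ε per
derivative of f; hence 1 - R^L is a smoothing operator of order L. Completeness follows from a
Sobolev inequality on cones. Cut-offs and coordinate changes carry these facts to sections
(`Localization.eq_sum_glue_localRep`, `Localization.exists_derivL2_localRep_glue_le`). -/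

namespace NashMoser

/-! ### Solid cones, `L²` norms of derivatives, and averages of translates. -/

section Euclidean

open MeasureTheory
open scoped ENNReal NNReal Convolution Pointwise

/-- A closed convex cone with nonempty interior, such as the whole space or a closed half space. -/
structure IsSolidCone {E : Type*} [NormedAddCommGroup E] [NormedSpace ℝ E] (X : Set E) : Prop where
  isClosed : IsClosed X
  convex : Convex ℝ X
  add_mem : ∀ {x y}, x ∈ X → y ∈ X → x + y ∈ X
  smul_mem : ∀ {t : ℝ} {x}, 0 ≤ t → x ∈ X → t • x ∈ X
  interior_nonempty : (interior X).Nonempty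

namespace IsSolidCone

variable {E : Type*} [NormedAddCommGroup E] [NormedSpace ℝ E] {X : Set E}

lemma uniqueDiffOn (hX : IsSolidCone X) : UniqueDiffOn ℝ X :=
  uniqueDiffOn_convex hX.convex hX.interior_nonempty

lemma subset_closure_interior (hX : IsSolidCone X) : X ⊆ closure (interior X) := by
  rw [hX.convex.closure_interior_eq_closure_of_nonempty_interior hX.interior_nonempty]
  exact subset_closure

/-- The translate of the open interior by a point of the cone is an open subset of the cone. This
moves every averaging point off the boundary, where ordinary derivatives exist. -/
lemma add_mem_interior (hX : IsSolidCone X) {x y : E} (hx : x ∈ X) (hy : y ∈ interior X) :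
    x + y ∈ interior X := by
  have h : (fun z => x + z) '' interior X ⊆ interior X := by
    apply interior_maximal
    · rintro _ ⟨z, hz, rfl⟩
      exact hX.add_mem hx (interior_subset hz)
    · exact (Homeomorph.addLeft x).isOpenMap _ isOpen_interior
  exact h ⟨y, hy, rfl⟩

lemma smul_mem_interior (hX : IsSolidCone X) {t : ℝ} (ht : 0 < t) {y : E} (hy : y ∈ interior X) :
    t • y ∈ interior X := by
  have h : (fun z => t • z) '' interior X ⊆ interior X := by
    apply interior_maximal
    · rintro _ ⟨z, hz, rfl⟩
      exact hX.smul_mem ht.le (interior_subset hz)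
    · exact (Homeomorph.smulOfNeZero t ht.ne').isOpenMap _ isOpen_interior
  exact h ⟨y, hy, rfl⟩

end IsSolidCone

variable {E : Type} [NormedAddCommGroup E] [NormedSpace ℝ E] [FiniteDimensional ℝ E]
  [MeasureSpace E] [BorelSpace E] [(volume : Measure E).IsAddHaarMeasure]
  {F F' : Type*} [NormedAddCommGroup F] [NormedSpace ℝ F] [NormedAddCommGroup F'] [NormedSpace ℝ F']
  {X : Set E}

/-- The `L²`-norm over `X` of the `j`-th derivative of `f` within `X`. -/
noncomputable def derivL2 (X : Set E) (j : ℕ) (f : E → F) : ℝ≥0∞ :=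
  eLpNorm (fun x => ‖iteratedFDerivWithin ℝ j f X x‖) 2 (volume.restrict X)

lemma _root_.ContinuousOn.aestronglyMeasurable_of_isSolidCone (hX : IsSolidCone X) {f : E → F}
    (hf : ContinuousOn f X) : AEStronglyMeasurable f (volume.restrict X) :=
  hf.aestronglyMeasurable hX.isClosed.measurableSet

lemma aestronglyMeasurable_iteratedFDerivWithin (hX : IsSolidCone X) {f : E → F}
    (hf : ContDiffOn ℝ ∞ f X) (j : ℕ) :
    AEStronglyMeasurable (fun x => ‖iteratedFDerivWithin ℝ j f X x‖) (volume.restrict X) :=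
  ((hf.continuousOn_iteratedFDerivWithin (mod_cast le_top)
    hX.uniqueDiffOn).aestronglyMeasurable_of_isSolidCone hX).norm

lemma eLpNorm_restrict_mono (hX : IsSolidCone X) {f : E → F} {g : E → F'}
    (h : ∀ x ∈ X, ‖f x‖ₑ ≤ ‖g x‖ₑ) :
    eLpNorm f 2 (volume.restrict X) ≤ eLpNorm g 2 (volume.restrict X) :=
  eLpNorm_mono_enorm_ae ((ae_restrict_iff' hX.isClosed.measurableSet).2 (ae_of_all _ h))

lemma eLpNorm_restrict_congr (hX : IsSolidCone X) {f : E → F} {g : E → F'}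
    (h : ∀ x ∈ X, ‖f x‖ = ‖g x‖) :
    eLpNorm f 2 (volume.restrict X) = eLpNorm g 2 (volume.restrict X) :=
  eLpNorm_congr_norm_ae ((ae_restrict_iff' hX.isClosed.measurableSet).2 (ae_of_all _ h))

lemma derivL2_congr (hX : IsSolidCone X) {f g : E → F} (h : EqOn f g X) (j : ℕ) :
    derivL2 X j f = derivL2 X j g :=
  eLpNorm_restrict_congr hX fun x hx => by rw [iteratedFDerivWithin_congr h hx]

lemma derivL2_succ (hX : IsSolidCone X) (f : E → F) (j : ℕ) :
    derivL2 X (j + 1) f = derivL2 X j (fderivWithin ℝ f X) :=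
  eLpNorm_restrict_congr hX fun _ hx => by
    rw [norm_iteratedFDerivWithin_fderivWithin hX.uniqueDiffOn hx]

lemma derivL2_zero (hX : IsSolidCone X) (f : E → F) :
    derivL2 X 0 f = eLpNorm f 2 (volume.restrict X) :=
  eLpNorm_restrict_congr hX fun x _ => by
    rw [norm_norm, norm_iteratedFDerivWithin_zero]

lemma _root_.ContDiffOn.fderivWithin_isSolidCone (hX : IsSolidCone X) {f : E → F}
    (hf : ContDiffOn ℝ ∞ f X) : ContDiffOn ℝ ∞ (fderivWithin ℝ f X) X :=
  hf.fderivWithin hX.uniqueDiffOn (by simp)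

lemma derivL2_add_le (hX : IsSolidCone X) {f g : E → F} (hf : ContDiffOn ℝ ∞ f X)
    (hg : ContDiffOn ℝ ∞ g X) (j : ℕ) :
    derivL2 X j (fun x => f x + g x) ≤ derivL2 X j f + derivL2 X j g := by
  refine le_trans ?_ (eLpNorm_add_le (aestronglyMeasurable_iteratedFDerivWithin hX hf j)
    (aestronglyMeasurable_iteratedFDerivWithin hX hg j) (by norm_num))
  refine eLpNorm_restrict_mono hX fun x hx => ?_
  rw [fun_iteratedFDerivWithin_add_apply ((hf x hx).of_le (mod_cast le_top))
      ((hg x hx).of_le (mod_cast le_top)) hX.uniqueDiffOn hx, enorm_norm, Pi.add_apply,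
    ← ofReal_norm, ← ofReal_norm]
  refine ENNReal.ofReal_le_ofReal ((norm_add_le _ _).trans ?_)
  exact le_abs_self _

lemma derivL2_neg (hX : IsSolidCone X) {f : E → F} (j : ℕ) :
    derivL2 X j (fun x => - f x) = derivL2 X j f :=
  eLpNorm_restrict_congr hX fun x hx => by
    rw [show (fun x => - f x) = -f from rfl,
      iteratedFDerivWithin_neg_apply hX.uniqueDiffOn hx, norm_neg]

lemma derivL2_sub_le (hX : IsSolidCone X) {f g : E → F} (hf : ContDiffOn ℝ ∞ f X)
    (hg : ContDiffOn ℝ ∞ g X) (j : ℕ) :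
    derivL2 X j (fun x => f x - g x) ≤ derivL2 X j f + derivL2 X j g := by
  simp only [sub_eq_add_neg]
  refine (derivL2_add_le hX hf hg.neg j).trans ?_
  rw [derivL2_neg hX]

/-- Averages of translates in the directions of the cone are bounded on `L²` of the cone. -/
lemma lintegral_sq_translate_avg_le (hX : IsSolidCone X) {Ω : Type*} [MeasurableSpace Ω]
    (ν : Measure Ω) [IsFiniteMeasure ν] {τ : Ω → E} (hτ : Measurable τ) (hτX : ∀ᵐ w ∂ν, τ w ∈ X)
    {h : E → ℝ≥0∞} (hh : Measurable h) :
    ∫⁻ x in X, (∫⁻ w, h (x + τ w) ∂ν) ^ 2 ≤ ν univ ^ 2 * ∫⁻ x in X, h x ^ 2 := by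
  have h1 : ∀ x, (∫⁻ w, h (x + τ w) ∂ν) ^ 2 ≤ ν univ * ∫⁻ w, h (x + τ w) ^ 2 ∂ν := by
    intro x
    have hm : Measurable fun w => h (x + τ w) := hh.comp (measurable_const.add hτ)
    have := ENNReal.lintegral_mul_le_Lp_mul_Lq ν Real.HolderConjugate.two_two
      hm.aemeasurable (aemeasurable_const (b := (1 : ℝ≥0∞)))
    simp only [Pi.mul_apply, mul_one, lintegral_const,
      ENNReal.rpow_two, one_pow, one_mul] at this
    calc _ ≤ ((∫⁻ w, h (x + τ w) ^ 2 ∂ν) ^ (1 / 2 : ℝ) * ν univ ^ (1 / 2 : ℝ)) ^ 2 := by gcongr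
      _ = _ := by
        rw [mul_pow, ← ENNReal.rpow_natCast, ← ENNReal.rpow_natCast, ← ENNReal.rpow_mul,
          ← ENNReal.rpow_mul]
        norm_num [mul_comm]
  have hm2 : Measurable (Function.uncurry fun x w => h (x + τ w) ^ 2) :=
    (hh.comp (measurable_fst.add (hτ.comp measurable_snd))).pow_const 2
  calc _ ≤ ∫⁻ x in X, ν univ * ∫⁻ w, h (x + τ w) ^ 2 ∂ν := lintegral_mono h1
    _ = ν univ * ∫⁻ x in X, ∫⁻ w, h (x + τ w) ^ 2 ∂ν := by
      rw [lintegral_const_mul']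
      exact measure_ne_top _ _
    _ = ν univ * ∫⁻ w, ∫⁻ x in X, h (x + τ w) ^ 2 ∂volume ∂ν := by
      rw [lintegral_lintegral_swap hm2.aemeasurable]
    _ ≤ ν univ * ∫⁻ w, ∫⁻ x in X, h x ^ 2 ∂volume ∂ν := by
      refine mul_le_mul_right ?_ _
      refine lintegral_mono_ae ?_
      filter_upwards [hτX] with w hw
      -- Translation by `τ w ∈ X` maps the cone into itself, so by invariance of Lebesgue measure
      -- the translated integral is at most the original one.
      rw [← lintegral_indicator hX.isClosed.measurableSet,
        ← lintegral_indicator hX.isClosed.measurableSet,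
        ← lintegral_add_right_eq_self (X.indicator fun x => h x ^ 2) (τ w)]
      refine lintegral_mono fun x => ?_
      by_cases hx : x ∈ X
      · simp [hx, hX.add_mem hx hw]
      · simp [hx]
    _ = _ := by rw [lintegral_const]; ring

lemma eLpNorm_two_eq (f : E → F) (μ : Measure E) :
    eLpNorm f 2 μ = (∫⁻ x, ‖f x‖ₑ ^ 2 ∂μ) ^ (1 / 2 : ℝ) := by
  rw [eLpNorm_eq_lintegral_rpow_enorm_toReal (by norm_num) (by norm_num)]
  simp

/-- The common source of the `L²` bounds for mollification and for its error: only a pointwise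
domination by an average of translates is needed, with an arbitrary finite parameter space. -/
lemma eLpNorm_le_of_translate_avg (hX : IsSolidCone X) {Ω : Type*} [MeasurableSpace Ω]
    (ν : Measure Ω) [IsFiniteMeasure ν] {τ : Ω → E} (hτ : Measurable τ) (hτX : ∀ᵐ w ∂ν, τ w ∈ X)
    {f : E → F} (hf : ContinuousOn f X) {G : E → F'} {C : ℝ≥0∞} (hC : C ≠ ⊤)
    (hG : ∀ x ∈ X, ‖G x‖ₑ ≤ C * ∫⁻ w, ‖f (x + τ w)‖ₑ ∂ν) :
    eLpNorm G 2 (volume.restrict X) ≤ C * ν univ * eLpNorm f 2 (volume.restrict X) := by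
  have hXm := hX.isClosed.measurableSet
  set h : E → ℝ≥0∞ := X.indicator fun x => ‖f x‖ₑ with hh
  have hmeas : Measurable h := by
    classical
    rw [hh, ← Set.piecewise_eq_indicator]
    apply ContinuousOn.measurable_piecewise _ continuousOn_const hXm
    exact (continuous_enorm).comp_continuousOn hf
  have key := lintegral_sq_translate_avg_le hX ν hτ hτX hmeas
  have e1 : ∫⁻ x in X, h x ^ 2 = ∫⁻ x in X, ‖f x‖ₑ ^ 2 :=
    setLIntegral_congr_fun hXm fun x hx => by simp [hh, hx]
  have e2 : ∫⁻ x in X, ‖G x‖ₑ ^ 2 ≤ C ^ 2 * ∫⁻ x in X, (∫⁻ w, h (x + τ w) ∂ν) ^ 2 := by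
    rw [← lintegral_const_mul' _ _ (by finiteness)]
    refine setLIntegral_mono' hXm fun x hx => ?_
    rw [← mul_pow]
    gcongr
    refine (hG x hx).trans ?_
    refine mul_le_mul_right ?_ _
    refine lintegral_mono_ae ?_
    filter_upwards [hτX] with w hw
    simp [hh, hX.add_mem hx hw]
  rw [eLpNorm_two_eq, eLpNorm_two_eq]
  calc _ ≤ (C ^ 2 * (ν univ ^ 2 * ∫⁻ x in X, ‖f x‖ₑ ^ 2)) ^ (1 / 2 : ℝ) := by
        gcongr
        exact e2.trans (by rw [← e1]; gcongr)
    _ = _ := by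
      rw [ENNReal.mul_rpow_of_nonneg _ _ (by norm_num), ENNReal.mul_rpow_of_nonneg _ _ (by norm_num),
        ← ENNReal.rpow_natCast, ← ENNReal.rpow_natCast, ← ENNReal.rpow_mul, ← ENNReal.rpow_mul]
      norm_num [mul_assoc]

end Euclidean

/-! ### Mollification by kernels supported in the cone. -/

section Euclidean

open MeasureTheory
open scoped ENNReal NNReal Convolution Pointwise

variable {E : Type} [NormedAddCommGroup E] [NormedSpace ℝ E] [FiniteDimensional ℝ E]
  [MeasureSpace E] [BorelSpace E] [(volume : Measure E).IsAddHaarMeasure]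
  {F F' : Type*} [NormedAddCommGroup F] [NormedSpace ℝ F] [NormedAddCommGroup F'] [NormedSpace ℝ F']
  {X : Set E}
lemma locallyIntegrable_indicator (hX : IsSolidCone X) {f : E → F} (hf : ContinuousOn f X) :
    LocallyIntegrable (X.indicator f) := by
  rw [locallyIntegrable_iff]
  intro K hK
  rw [integrableOn_indicator_iff hX.isClosed.measurableSet]
  exact (hf.mono inter_subset_left).integrableOn_compact (hK.inter_left hX.isClosed)

/-- Derivatives of a convolution with a kernel supported in `-X` fall on the kernel. -/
lemma derivL2_convolution_le (hX : IsSolidCone X) {S : Set E} (hS : IsCompact S)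
    (hSX : ∀ w ∈ S, -w ∈ X) {f : E → F} (hf : ContinuousOn f X) {c : ℝ} (hc : 0 ≤ c) (i : ℕ)
    {E' F' : Type*} [NormedAddCommGroup E'] [NormedSpace ℝ E'] [NormedAddCommGroup F']
    [NormedSpace ℝ F'] (L : F →L[ℝ] E' →L[ℝ] F') {g : E → E'} (hg : ContDiff ℝ ∞ g)
    (hgS : tsupport g ⊆ S) (hgc : ∀ x, ‖iteratedFDeriv ℝ i g x‖ ≤ c) :
    derivL2 X i (X.indicator f ⋆[L, volume] g) ≤
      ENNReal.ofReal (‖L‖ * c) * volume S * eLpNorm f 2 (volume.restrict X) := by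
  have hfi := locallyIntegrable_indicator hX hf
  -- The target spaces vary because differentiating replaces the kernel `g` by `fderiv ℝ g` and the
  -- pairing `L` by `L.precompR E`, whose norm is no larger.
  induction i generalizing E' F' with
  | zero =>
    have : IsFiniteMeasure (volume.restrict S) := ⟨by simpa using hS.measure_lt_top⟩
    rw [derivL2_zero hX]
    have := eLpNorm_le_of_translate_avg hX (volume.restrict S) (τ := fun w => -w)
      (G := X.indicator f ⋆[L, volume] g) measurable_neg
      ((ae_restrict_iff' hS.measurableSet).2 (ae_of_all _ hSX)) hf
      (C := ENNReal.ofReal (‖L‖ * c)) ENNReal.ofReal_ne_top ?_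
    · rwa [Measure.restrict_apply_univ] at this
    intro x hx
    rw [convolution_eq_swap, ← lintegral_const_mul' _ _ ENNReal.ofReal_ne_top,
      ← lintegral_indicator hS.measurableSet]
    refine (enorm_integral_le_lintegral_enorm _).trans (lintegral_mono fun w => ?_)
    by_cases hw : w ∈ S
    · have hxw : x - w ∈ X := by simpa [sub_eq_add_neg] using hX.add_mem hx (hSX w hw)
      simp only [hw, indicator_of_mem, hxw, ← sub_eq_add_neg]
      rw [← ofReal_norm, ← ofReal_norm, ← ENNReal.ofReal_mul (mul_nonneg (norm_nonneg L) hc)]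
      refine ENNReal.ofReal_le_ofReal ?_
      have h1 := hgc w
      rw [norm_iteratedFDeriv_zero] at h1
      calc _ ≤ ‖L‖ * ‖f (x - w)‖ * ‖g w‖ := L.le_opNorm₂ _ _
        _ ≤ ‖L‖ * ‖f (x - w)‖ * c :=
          mul_le_mul_of_nonneg_left h1 (mul_nonneg (norm_nonneg L) (norm_nonneg _))
        _ = _ := by ring
    · have : g w = 0 := image_eq_zero_of_notMem_tsupport fun h => hw (hgS h)
      rw [this, map_zero, enorm_zero]
      exact zero_le
  | succ i ih =>
    have hcs : HasCompactSupport g := hS.of_isClosed_subset (isClosed_tsupport g) hgS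
    rw [derivL2_succ hX]
    have hD : EqOn (fderivWithin ℝ (X.indicator f ⋆[L, volume] g) X)
        (X.indicator f ⋆[L.precompR E, volume] fderiv ℝ g) X := fun x hx =>
      (hcs.hasFDerivAt_convolution_right L hfi (hg.of_le (mod_cast le_top))
        x).hasFDerivWithinAt.fderivWithin (hX.uniqueDiffOn x hx)
    rw [derivL2_congr hX hD]
    refine (ih (L.precompR E) (hg.fderiv_right (by simp))
      ((tsupport_fderiv_subset ℝ).trans hgS) ?_).trans ?_
    · intro x
      rw [norm_iteratedFDeriv_fderiv]
      exact hgc x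
    · exact mul_le_mul_left (mul_le_mul_left (ENNReal.ofReal_le_ofReal
        (mul_le_mul_of_nonneg_right (L.norm_precompR_le E) hc)) _) _

/-- A smooth bump of total mass one, compactly supported in the interior of the cone `X`. -/
structure IsMollifier (X : Set E) (k : E → ℝ) : Prop where
  contDiff : ContDiff ℝ ∞ k
  hasCompactSupport : HasCompactSupport k
  tsupport_subset : tsupport k ⊆ interior X
  integral_eq_one : ∫ y, k y = 1

lemma exists_isMollifier (hX : IsSolidCone X) : ∃ k : E → ℝ, IsMollifier X k := by
  obtain ⟨y, hy⟩ := hX.interior_nonempty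
  obtain ⟨r, hr, hball⟩ := Metric.nhds_basis_closedBall.mem_iff.1 (isOpen_interior.mem_nhds hy)
  let b : ContDiffBump y := ⟨r / 2, r, by positivity, by linarith⟩
  refine ⟨b.normed volume, b.contDiff_normed, b.hasCompactSupport_normed, ?_, b.integral_normed⟩
  rw [b.tsupport_normed_eq]
  exact hball

/-- The average `x ↦ ∫ k(y) f(x + ε y) dy` of `f` with respect to a kernel `k` supported in `X`. -/
noncomputable def mollify (X : Set E) (k : E → ℝ) (ε : ℝ) (f : E → F) : E → F :=
  X.indicator f ⋆[(ContinuousLinearMap.lsmul ℝ ℝ).flip, volume]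
    fun w => (ε ^ Module.finrank ℝ E)⁻¹ * k (-(ε⁻¹ • w))

lemma mollify_congr {k : E → ℝ} {ε : ℝ} {f g : E → F} (h : EqOn f g X) :
    mollify X k ε f = mollify X k ε g := by
  unfold mollify
  rw [indicator_congr h]

section

variable {k : E → ℝ} {ε : ℝ}

/-- The point `x` itself may lie outside `X`: differentiating at a boundary point requires the
formula in a full neighbourhood. -/
lemma mollify_apply_of_forall_mem (hε : 0 < ε) (f : E → F) {x : E}
    (hx : ∀ y ∈ tsupport k, x + ε • y ∈ X) :
    mollify X k ε f x = ∫ y, k y • f (x + ε • y) := by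
  rw [mollify, convolution_def]
  have h1 := Measure.integral_comp_smul (volume : Measure E)
    (fun t => ((ε ^ Module.finrank ℝ E)⁻¹ * k (ε⁻¹ • t)) • X.indicator f (x + t)) ε
  have h2 := integral_add_left_eq_self (μ := (volume : Measure E))
    (fun t => ((ε ^ Module.finrank ℝ E)⁻¹ * k (ε⁻¹ • (t - x))) • X.indicator f t) x
  simp only [add_sub_cancel_left] at h2
  rw [h2] at h1
  have e1 : (fun t => (ContinuousLinearMap.lsmul ℝ ℝ).flip (X.indicator f t)
      ((ε ^ Module.finrank ℝ E)⁻¹ * k (-(ε⁻¹ • (x - t))))) =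
      fun t => ((ε ^ Module.finrank ℝ E)⁻¹ * k (ε⁻¹ • (t - x))) • X.indicator f t := by
    ext t
    rw [ContinuousLinearMap.flip_apply, ContinuousLinearMap.lsmul_apply, ← smul_neg, neg_sub]
  rw [e1]
  have hp : (ε ^ Module.finrank ℝ E)⁻¹ ≠ 0 := by positivity
  rw [abs_of_pos (by positivity)] at h1
  have h3 := congrArg (fun z => ((ε ^ Module.finrank ℝ E)⁻¹)⁻¹ • z) h1
  simp only [inv_smul_smul₀ hp] at h3
  rw [← h3, ← integral_smul]
  refine integral_congr_ae (ae_of_all _ fun y => ?_)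
  simp only [inv_smul_smul₀ hε.ne', mul_smul, inv_smul_smul₀ hp]
  by_cases hy : y ∈ tsupport k
  · rw [indicator_of_mem (hx y hy)]
  · simp [image_eq_zero_of_notMem_tsupport hy]

lemma IsMollifier.add_smul_mem_interior (hX : IsSolidCone X) (hk : IsMollifier X k) {x : E}
    (hx : x ∈ X) (hε : 0 < ε) {y : E} (hy : y ∈ tsupport k) : x + ε • y ∈ interior X :=
  hX.add_mem_interior hx (hX.smul_mem_interior hε (hk.tsupport_subset hy))

lemma mollify_apply (hX : IsSolidCone X) (hk : IsMollifier X k) (hε : 0 < ε) (f : E → F) {x : E}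
    (hx : x ∈ X) : mollify X k ε f x = ∫ y, k y • f (x + ε • y) :=
  mollify_apply_of_forall_mem hε f fun _ hy =>
    interior_subset (hk.add_smul_mem_interior hX hx hε hy)

lemma IsMollifier.integrable_smul (hk : IsMollifier X k) {g : E → F}
    (hg : ContinuousOn g (tsupport k)) : Integrable (fun y => k y • g y) := by
  have e : (fun y => k y • g y) = (tsupport k).indicator fun y => k y • g y := by
    ext y
    by_cases hy : y ∈ tsupport k
    · simp [hy]
    · simp [hy, image_eq_zero_of_notMem_tsupport hy]
  rw [e, integrable_indicator_iff (isClosed_tsupport k).measurableSet]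
  exact (hk.contDiff.continuous.continuousOn.smul hg).integrableOn_compact hk.hasCompactSupport

lemma mollify_kernel_tsupport_subset (hε : 0 < ε) :
    tsupport (fun w => (ε ^ Module.finrank ℝ E)⁻¹ * k (-(ε⁻¹ • w))) ⊆ (-ε) • tsupport k := by
  have hε' : -ε ≠ 0 := by simpa using hε.ne'
  refine closure_minimal ?_ ((isClosed_tsupport k).smul₀ _)
  intro w hw
  rw [mem_smul_set_iff_inv_smul_mem₀ hε']
  apply subset_closure
  have : k (-(ε⁻¹ • w)) ≠ 0 := right_ne_zero_of_mul hw
  simpa [inv_neg] using this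

lemma contDiff_mollify_kernel (hk : IsMollifier X k) :
    ContDiff ℝ ∞ (fun w => (ε ^ Module.finrank ℝ E)⁻¹ * k (-(ε⁻¹ • w))) :=
  contDiff_const.mul (hk.contDiff.comp ((contDiff_const.smul contDiff_id).neg))

lemma contDiff_mollify (hX : IsSolidCone X) (hk : IsMollifier X k) (hε : 0 < ε) {f : E → F}
    (hf : ContinuousOn f X) : ContDiff ℝ ∞ (mollify X k ε f) := by
  refine HasCompactSupport.contDiff_convolution_right _ ?_ (locallyIntegrable_indicator hX hf)
    (contDiff_mollify_kernel hk)
  exact (hk.hasCompactSupport.isCompact.smul (-ε)).of_isClosed_subset (isClosed_tsupport _)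
    (mollify_kernel_tsupport_subset hε)

/-- All derivatives fall on the rescaled kernel, each costing a factor `ε⁻¹`; the volume of the
rescaled support cancels the normalization of the kernel. -/
lemma exists_derivL2_mollify_le (hX : IsSolidCone X) (hk : IsMollifier X k) (i : ℕ) :
    ∃ C : ℝ, 0 ≤ C ∧ ∀ (F : Type*) [NormedAddCommGroup F] [NormedSpace ℝ F] (ε : ℝ), 0 < ε →
      ∀ f : E → F, ContinuousOn f X →
      derivL2 X i (mollify X k ε f) ≤
        ENNReal.ofReal (C * ε⁻¹ ^ i) * eLpNorm f 2 (volume.restrict X) := by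
  obtain ⟨B, hB⟩ := (hk.hasCompactSupport.iteratedFDeriv (𝕜 := ℝ) i).exists_bound_of_continuous
    (hk.contDiff.continuous_iteratedFDeriv (m := i) (mod_cast le_top))
  have hB0 : 0 ≤ B := (norm_nonneg _).trans (hB 0)
  have hfin : volume (tsupport k) ≠ ⊤ := hk.hasCompactSupport.isCompact.measure_ne_top
  refine ⟨B * (volume (tsupport k)).toReal, by positivity, ?_⟩
  intro F _ _ ε hε f hf
  have hn : 0 < ε ^ Module.finrank ℝ E := by positivity
  have key := derivL2_convolution_le hX (hk.hasCompactSupport.isCompact.smul (-ε)) ?_ hf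
    (c := (ε ^ Module.finrank ℝ E)⁻¹ * (B * ε⁻¹ ^ i)) (by positivity) i
    (ContinuousLinearMap.lsmul ℝ ℝ).flip (contDiff_mollify_kernel (ε := ε) hk)
    (mollify_kernel_tsupport_subset hε) ?_
  · refine key.trans ?_
    gcongr
    rw [Measure.addHaar_smul, ← ENNReal.ofReal_toReal hfin, ← ENNReal.ofReal_mul (by positivity),
      ← ENNReal.ofReal_mul (by positivity)]
    refine ENNReal.ofReal_le_ofReal ?_
    rw [ENNReal.toReal_ofReal ENNReal.toReal_nonneg]
    have h1 : ‖(ContinuousLinearMap.lsmul ℝ ℝ : ℝ →L[ℝ] F →L[ℝ] F).flip‖ ≤ 1 := by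
      rw [ContinuousLinearMap.opNorm_flip]
      exact ContinuousLinearMap.opNorm_lsmul_le
    have h2 : |(-ε) ^ Module.finrank ℝ E| = ε ^ Module.finrank ℝ E := by
      rw [abs_pow, abs_neg, abs_of_pos hε]
    rw [h2]
    calc _ ≤ 1 * ((ε ^ Module.finrank ℝ E)⁻¹ * (B * ε⁻¹ ^ i)) *
          (ε ^ Module.finrank ℝ E * (volume (tsupport k)).toReal) := by gcongr
      _ = _ := by field_simp
  · rintro _ ⟨y, hy, rfl⟩
    simpa using hX.smul_mem hε.le (interior_subset (hk.tsupport_subset hy))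
  · intro x
    have e : (fun w => (ε ^ Module.finrank ℝ E)⁻¹ * k (-(ε⁻¹ • w))) =
        (ε ^ Module.finrank ℝ E)⁻¹ • (k ∘ ((-ε⁻¹) • ContinuousLinearMap.id ℝ E)) := by
      ext w; simp
    have hkc : ContDiff ℝ i k := hk.contDiff.of_le (mod_cast le_top)
    rw [e, iteratedFDeriv_const_smul_apply, norm_smul, Real.norm_of_nonneg (by positivity),
      ContinuousLinearMap.iteratedFDeriv_comp_right _ hkc _ le_rfl]
    · gcongr
      refine (ContinuousMultilinearMap.norm_compContinuousLinearMap_le _ _).trans ?_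
      rw [Finset.prod_const, Finset.card_univ, Fintype.card_fin]
      gcongr
      · exact hB _
      · rw [norm_smul]
        calc _ ≤ ‖-ε⁻¹‖ * 1 := by gcongr; exact ContinuousLinearMap.norm_id_le
          _ = _ := by rw [mul_one, norm_neg, Real.norm_of_nonneg (by positivity)]
    · exact (hkc.comp (ContinuousLinearMap.contDiff _)).contDiffAt

end
end Euclidean

/-! ### Mollification commutes with differentiation; the first-order error. -/

section Euclidean

open MeasureTheory
open scoped ENNReal NNReal Convolution Pointwise

variable {E : Type} [NormedAddCommGroup E] [NormedSpace ℝ E] [FiniteDimensional ℝ E]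
  [MeasureSpace E] [BorelSpace E] [(volume : Measure E).IsAddHaarMeasure]
  {F : Type u} [NormedAddCommGroup F] [NormedSpace ℝ F]
  {X : Set E} {k : E → ℝ} {ε : ℝ}
lemma hasFDerivAt_of_mem_interior {f : E → F} (hf : ContDiffOn ℝ ∞ f X) {x : E}
    (hx : x ∈ interior X) : HasFDerivAt f (fderivWithin ℝ f X x) x :=
  ((hf.differentiableOn (by simp) x (interior_subset hx)).hasFDerivWithinAt).hasFDerivAt
    (mem_interior_iff_mem_nhds.1 hx)

/-- The averaging points `x + ε • y` form a compact subset of the open interior, even for `x` on the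
boundary. A closed thickening of it stays in the interior, which gives uniform bounds for
differentiating under the integral. -/
lemma hasFDerivAt_mollify (hX : IsSolidCone X) (hk : IsMollifier X k) (hε : 0 < ε) {f : E → F}
    (hf : ContDiffOn ℝ ∞ f X) {x : E} (hx : x ∈ X) :
    HasFDerivAt (mollify X k ε f) (mollify X k ε (fderivWithin ℝ f X) x) x := by
  set f' := fderivWithin ℝ f X with hf'
  have hf'c : ContinuousOn f' X := (hf.fderivWithin_isSolidCone hX).continuousOn
  set Q : Set E := (fun y => x + ε • y) '' tsupport k with hQ
  have hQc : IsCompact Q := IsCompact.image hk.hasCompactSupport (by fun_prop)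
  have hQX : Q ⊆ interior X := by
    rintro _ ⟨y, hy, rfl⟩
    exact hk.add_smul_mem_interior hX hx hε hy
  obtain ⟨r, hr, hrX⟩ := hQc.exists_cthickening_subset_open isOpen_interior hQX
  have hmem : ∀ x' ∈ Metric.ball x r, ∀ y ∈ tsupport k, x' + ε • y ∈ Metric.cthickening r Q := by
    intro x' hx' y hy
    refine Metric.mem_cthickening_of_dist_le _ (x + ε • y) _ _ ⟨y, hy, rfl⟩ ?_
    rw [dist_add_right]
    exact (Metric.mem_ball.1 hx').le
  obtain ⟨B, hB⟩ := hQc.cthickening.exists_bound_of_continuousOn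
    (hf'c.mono (hrX.trans interior_subset))
  have hev : mollify X k ε f =ᶠ[𝓝 x] fun x' => ∫ y, k y • f (x' + ε • y) := by
    filter_upwards [Metric.ball_mem_nhds x hr] with x' hx'
    exact mollify_apply_of_forall_mem hε f fun y hy => interior_subset (hrX (hmem x' hx' y hy))
  have hcont : ∀ {G : Type u} [NormedAddCommGroup G] [NormedSpace ℝ G] {g : E → G},
      ContinuousOn g X → ∀ x' ∈ Metric.ball x r, ContinuousOn (fun y => g (x' + ε • y))
        (tsupport k) := by
    intro G _ _ g hg x' hx'
    exact hg.comp (by fun_prop) fun y hy => interior_subset (hrX (hmem x' hx' y hy))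
  have hxr := Metric.mem_ball_self (x := x) hr
  rw [mollify_apply hX hk hε f' hx]
  refine HasFDerivAt.congr_of_eventuallyEq ?_ hev
  refine hasFDerivAt_integral_of_dominated_of_fderiv_le (Metric.ball_mem_nhds x hr)
    (F' := fun x' y => k y • f' (x' + ε • y)) (bound := fun y => k y • (B : ℝ) |> norm)
    ?_ ?_ ?_ ?_ ?_ ?_
  · filter_upwards [Metric.ball_mem_nhds x hr] with x' hx'
    exact (hk.integrable_smul (hcont hf.continuousOn x' hx')).aestronglyMeasurable
  · exact hk.integrable_smul (hcont hf.continuousOn x hxr)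
  · exact (hk.integrable_smul (hcont hf'c x hxr)).aestronglyMeasurable
  · refine ae_of_all _ fun y x' hx' => ?_
    rw [norm_smul, norm_smul]
    by_cases hy : y ∈ tsupport k
    · gcongr
      exact (hB _ (hmem x' hx' y hy)).trans (le_abs_self B)
    · simp [image_eq_zero_of_notMem_tsupport hy]
  · exact (hk.integrable_smul (g := fun _ => B) continuousOn_const).norm
  · refine ae_of_all _ fun y x' hx' => ?_
    by_cases hy : y ∈ tsupport k
    · have := hasFDerivAt_of_mem_interior hf (hrX (hmem x' hx' y hy))
      exact ((hasFDerivAt_comp_add_right (ε • y)).2 this).const_smul (k y)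
    · simp only [image_eq_zero_of_notMem_tsupport hy, zero_smul]
      exact hasFDerivAt_const _ _

lemma fderivWithin_mollify (hX : IsSolidCone X) (hk : IsMollifier X k) (hε : 0 < ε) {f : E → F}
    (hf : ContDiffOn ℝ ∞ f X) :
    EqOn (fderivWithin ℝ (mollify X k ε f) X) (mollify X k ε (fderivWithin ℝ f X)) X :=
  fun x hx => (hasFDerivAt_mollify hX hk hε hf hx).hasFDerivWithinAt.fderivWithin
    (hX.uniqueDiffOn x hx)

/-- Of the derivatives, `b` are left on `f` and `a` are moved to the kernel. The constant is chosen
before `F` since the induction replaces `f` by its derivative, which has another target. -/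
lemma exists_derivL2_add_mollify_le (hX : IsSolidCone X) (hk : IsMollifier X k) (a b : ℕ) :
    ∃ C : ℝ, 0 ≤ C ∧ ∀ (F : Type u) [NormedAddCommGroup F] [NormedSpace ℝ F] (ε : ℝ), 0 < ε →
      ∀ f : E → F, ContDiffOn ℝ ∞ f X →
      derivL2 X (a + b) (mollify X k ε f) ≤ ENNReal.ofReal (C * ε⁻¹ ^ a) * derivL2 X b f := by
  obtain ⟨C, hC, H⟩ := exists_derivL2_mollify_le.{u} hX hk a
  refine ⟨C, hC, ?_⟩
  induction b with
  | zero =>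
    intro F _ _ ε hε f hf
    rw [derivL2_zero hX, add_zero]
    exact H F ε hε f hf.continuousOn
  | succ b ih =>
    intro F _ _ ε hε f hf
    rw [← add_assoc, derivL2_succ hX, derivL2_congr hX (fderivWithin_mollify hX hk hε hf),
      derivL2_succ hX]
    exact ih (E →L[ℝ] F) ε hε _ (hf.fderivWithin_isSolidCone hX)

/-- The fundamental theorem of calculus along the segment: its open part lies in the interior of the
cone because `y` does, even when `t = 0` and `x` is a boundary point. -/
lemma enorm_sub_le_lintegral_fderivWithin [CompleteSpace F] (hX : IsSolidCone X) {f : E → F}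
    (hf : ContDiffOn ℝ ∞ f X) {x y : E} (hx : x ∈ X) (hy : y ∈ interior X) {t : ℝ} (ht0 : 0 ≤ t)
    (ht1 : t ≤ 1) : ‖f (x + y) - f (x + t • y)‖ₑ ≤
      ‖y‖ₑ * ∫⁻ s in Ioc t 1, ‖fderivWithin ℝ f X (x + s • y)‖ₑ := by
  have hmem : ∀ s ∈ Icc t 1, x + s • y ∈ X := fun s hs =>
    hX.add_mem hx (hX.smul_mem (ht0.trans hs.1) (interior_subset hy))
  have hc : ContinuousOn (fun s : ℝ => x + s • y) (Icc t 1) := by fun_prop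
  have hcf : ContinuousOn (fun s : ℝ => fderivWithin ℝ f X (x + s • y) y) (Icc t 1) :=
    (((hf.fderivWithin_isSolidCone hX).continuousOn.comp hc hmem)).clm_apply continuousOn_const
  have h := intervalIntegral.integral_eq_sub_of_hasDerivAt_of_le ht1
    (f := fun s : ℝ => f (x + s • y)) (f' := fun s => fderivWithin ℝ f X (x + s • y) y)
    (hf.continuousOn.comp hc hmem) ?_ ?_
  · simp only [one_smul] at h
    rw [← h, intervalIntegral.integral_of_le ht1,
      ← lintegral_const_mul' _ _ enorm_ne_top]
    refine (enorm_integral_le_lintegral_enorm _).trans (lintegral_mono fun s => ?_)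
    rw [mul_comm]
    exact ContinuousLinearMap.le_opENorm _ _
  · intro s hs
    have h1 := hasFDerivAt_of_mem_interior hf
      (hX.add_mem_interior hx (hX.smul_mem_interior (ht0.trans_lt hs.1) hy))
    have h2 : HasDerivAt (fun s : ℝ => x + s • y) y s := by
      simpa using ((hasDerivAt_id s).smul_const y).const_add x
    exact h1.comp_hasDerivAt s h2
  · exact hcf.intervalIntegrable_of_Icc ht1

/-- The mollification error, `f - mollify f`. -/
noncomputable def mollifyRem (X : Set E) (k : E → ℝ) (ε : ℝ) (f : E → F) : E → F :=
  fun x => f x - mollify X k ε f x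

lemma mollifyRem_congr {f g : E → F} (h : EqOn f g X) :
    EqOn (mollifyRem X k ε f) (mollifyRem X k ε g) X := fun x hx => by
  rw [mollifyRem, mollifyRem, h hx, mollify_congr h]

lemma contDiffOn_mollifyRem (hX : IsSolidCone X) (hk : IsMollifier X k) (hε : 0 < ε) {f : E → F}
    (hf : ContDiffOn ℝ ∞ f X) : ContDiffOn ℝ ∞ (mollifyRem X k ε f) X :=
  hf.sub (contDiff_mollify hX hk hε hf.continuousOn).contDiffOn

lemma contDiffOn_mollifyRem_iterate (hX : IsSolidCone X) (hk : IsMollifier X k) (hε : 0 < ε)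
    {f : E → F} (hf : ContDiffOn ℝ ∞ f X) (m : ℕ) :
    ContDiffOn ℝ ∞ ((mollifyRem X k ε)^[m] f) X := by
  induction m with
  | zero => exact hf
  | succ m ih =>
    rw [Function.iterate_succ_apply']
    exact contDiffOn_mollifyRem hX hk hε ih

lemma fderivWithin_mollifyRem (hX : IsSolidCone X) (hk : IsMollifier X k) (hε : 0 < ε) {f : E → F}
    (hf : ContDiffOn ℝ ∞ f X) :
    EqOn (fderivWithin ℝ (mollifyRem X k ε f) X) (mollifyRem X k ε (fderivWithin ℝ f X)) X := by
  intro x hx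
  rw [mollifyRem, ← fderivWithin_mollify hX hk hε hf hx]
  exact fderivWithin_sub (hX.uniqueDiffOn x hx) (hf.differentiableOn (by simp) x hx)
    ((contDiff_mollify hX hk hε hf.continuousOn).differentiable (by simp)
      x).differentiableWithinAt

lemma fderivWithin_mollifyRem_iterate (hX : IsSolidCone X) (hk : IsMollifier X k) (hε : 0 < ε)
    {f : E → F} (hf : ContDiffOn ℝ ∞ f X) (m : ℕ) :
    EqOn (fderivWithin ℝ ((mollifyRem X k ε)^[m] f) X)
      ((mollifyRem X k ε)^[m] (fderivWithin ℝ f X)) X := by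
  induction m with
  | zero => exact fun _ _ => rfl
  | succ m ih =>
    rw [Function.iterate_succ_apply', Function.iterate_succ_apply']
    exact (fderivWithin_mollifyRem hX hk hε (contDiffOn_mollifyRem_iterate hX hk hε hf m)).trans
      (mollifyRem_congr ih)

lemma exists_eLpNorm_mollifyRem_le (hX : IsSolidCone X) (hk : IsMollifier X k) :
    ∃ C : ℝ, 0 ≤ C ∧ ∀ (F : Type u) [NormedAddCommGroup F] [NormedSpace ℝ F] (ε : ℝ), 0 < ε →
      ∀ f : E → F, ContDiffOn ℝ ∞ f X →
      eLpNorm (mollifyRem X k ε f) 2 (volume.restrict X) ≤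
        ENNReal.ofReal C * eLpNorm f 2 (volume.restrict X) := by
  obtain ⟨C, hC, H⟩ := exists_derivL2_mollify_le.{u} hX hk 0
  refine ⟨1 + C, by positivity, ?_⟩
  intro F _ _ ε hε f hf
  have h := derivL2_sub_le hX hf
    (contDiff_mollify hX hk hε hf.continuousOn).contDiffOn 0
  rw [derivL2_zero hX, derivL2_zero hX f] at h
  refine h.trans ?_
  rw [ENNReal.ofReal_add zero_le_one hC, add_mul, ENNReal.ofReal_one, one_mul]
  gcongr
  simpa using H F ε hε f hf.continuousOn

/-- As the kernel has mass one, the error is an average of the differences `f x - f (x + ε • y)`.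
Written as integrals along segments, these are an average of translates of the derivative, of length
at most a multiple of `ε`. -/
lemma exists_eLpNorm_mollifyRem_le_fderivWithin (hX : IsSolidCone X) (hk : IsMollifier X k) :
    ∃ C : ℝ, 0 ≤ C ∧ ∀ (F : Type u) [NormedAddCommGroup F] [NormedSpace ℝ F] [CompleteSpace F]
      (ε : ℝ), 0 < ε → ∀ f : E → F, ContDiffOn ℝ ∞ f X →
      eLpNorm (mollifyRem X k ε f) 2 (volume.restrict X) ≤
        ENNReal.ofReal (C * ε) * eLpNorm (fderivWithin ℝ f X) 2 (volume.restrict X) := by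
  obtain ⟨B, hB⟩ := hk.hasCompactSupport.exists_bound_of_continuous hk.contDiff.continuous
  have hB0 : 0 ≤ B := (norm_nonneg _).trans (hB 0)
  have hScomp : IsCompact (tsupport k) := hk.hasCompactSupport
  obtain ⟨R, hR0, hR⟩ : ∃ R : ℝ, 0 ≤ R ∧ ∀ y ∈ tsupport k, ‖y‖ ≤ R := by
    obtain ⟨R, hR⟩ := hScomp.exists_bound_of_continuousOn continuousOn_id
    exact ⟨max R 0, le_max_right _ _, fun y hy => (hR y hy).trans (le_max_left _ _)⟩
  have hfin : volume (tsupport k) ≠ ⊤ := hScomp.measure_ne_top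
  have : IsFiniteMeasure (volume.restrict (tsupport k)) := ⟨by simpa using hfin.lt_top⟩
  -- The average runs over the kernel variable and the position on the segment.
  set ν := (volume.restrict (tsupport k)).prod (volume.restrict (Ioc (0 : ℝ) 1)) with hν
  have hνu : ν univ = volume (tsupport k) := by
    rw [hν, ← univ_prod_univ, Measure.prod_prod]
    simp
  refine ⟨B * R * (volume (tsupport k)).toReal, by positivity, ?_⟩
  intro F _ _ _ ε hε f hf
  have hf'c := (hf.fderivWithin_isSolidCone hX).continuousOn
  have hνS : ∀ᵐ p ∂ν, p ∈ tsupport k ×ˢ Ioc (0 : ℝ) 1 := by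
    rw [hν, Measure.prod_restrict]
    exact ae_restrict_mem ((isClosed_tsupport k).measurableSet.prod measurableSet_Ioc)
  have hτX : ∀ p ∈ tsupport k ×ˢ Ioc (0 : ℝ) 1, p.2 • ε • p.1 ∈ X := fun p hp =>
    hX.smul_mem hp.2.1.le (hX.smul_mem hε.le (interior_subset (hk.tsupport_subset hp.1)))
  have key := eLpNorm_le_of_translate_avg hX ν (τ := fun p => p.2 • ε • p.1)
    (G := mollifyRem X k ε f)
    (Continuous.measurable (by fun_prop)) (by filter_upwards [hνS] with p hp using hτX p hp) hf'c
    (C := ENNReal.ofReal (B * (ε * R))) ENNReal.ofReal_ne_top ?_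
  · refine key.trans ?_
    rw [hνu]
    gcongr
    rw [← ENNReal.ofReal_toReal hfin, ← ENNReal.ofReal_mul (by positivity)]
    refine ENNReal.ofReal_le_ofReal (le_of_eq ?_)
    rw [ENNReal.toReal_ofReal ENNReal.toReal_nonneg]
    ring
  · intro x hx
    have e : mollifyRem X k ε f x = -∫ y, k y • (f (x + ε • y) - f x) := by
      have h1 : ContinuousOn (fun y => f (x + ε • y)) (tsupport k) :=
        hf.continuousOn.comp (by fun_prop) fun y hy =>
          interior_subset (hk.add_smul_mem_interior hX hx hε hy)
      simp only [smul_sub]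
      rw [integral_sub (hk.integrable_smul h1) (hk.integrable_smul continuousOn_const),
        integral_smul_const, hk.integral_eq_one, mollifyRem, mollify_apply hX hk hε f hx]
      simp
    have hmeas : AEMeasurable (fun p : E × ℝ => ‖fderivWithin ℝ f X (x + p.2 • ε • p.1)‖ₑ) ν := by
      rw [hν, Measure.prod_restrict]
      refine ContinuousOn.aemeasurable ?_
        ((isClosed_tsupport k).measurableSet.prod measurableSet_Ioc)
      exact continuous_enorm.comp_continuousOn (hf'c.comp (by fun_prop)
        fun p hp => hX.add_mem hx (hτX p hp))
    rw [hν, lintegral_prod _ hmeas, e, enorm_neg, ← lintegral_const_mul' _ _ ENNReal.ofReal_ne_top,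
      ← lintegral_indicator (isClosed_tsupport k).measurableSet]
    refine (enorm_integral_le_lintegral_enorm _).trans (lintegral_mono fun y => ?_)
    by_cases hy : y ∈ tsupport k
    · rw [indicator_of_mem hy, enorm_smul, ENNReal.ofReal_mul hB0, mul_assoc]
      have h1 := enorm_sub_le_lintegral_fderivWithin hX hf hx
        (hX.smul_mem_interior hε (hk.tsupport_subset hy)) le_rfl zero_le_one
      rw [zero_smul, add_zero] at h1
      refine mul_le_mul' ?_ (h1.trans (mul_le_mul' ?_ le_rfl))
      · rw [← ofReal_norm]
        exact ENNReal.ofReal_le_ofReal (hB y)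
      · rw [← ofReal_norm, norm_smul, Real.norm_of_nonneg hε.le]
        exact ENNReal.ofReal_le_ofReal (by gcongr; exact hR y hy)
    · simp [image_eq_zero_of_notMem_tsupport hy]
end Euclidean

/-! ### Iterated mollification errors: smoothing of finite order. -/

section Euclidean

open MeasureTheory
open scoped ENNReal NNReal Convolution Pointwise

variable {E : Type} [NormedAddCommGroup E] [NormedSpace ℝ E] [FiniteDimensional ℝ E]
  [MeasureSpace E] [BorelSpace E] [(volume : Measure E).IsAddHaarMeasure]
  {F : Type u} [NormedAddCommGroup F] [NormedSpace ℝ F]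
  {X : Set E} {k : E → ℝ} {ε : ℝ}
lemma exists_derivL2_mollifyRem_iterate_le (hX : IsSolidCone X) (hk : IsMollifier X k) (m j : ℕ) :
    ∃ C : ℝ, 0 ≤ C ∧ ∀ (F : Type u) [NormedAddCommGroup F] [NormedSpace ℝ F] (ε : ℝ), 0 < ε →
      ∀ f : E → F, ContDiffOn ℝ ∞ f X →
      derivL2 X j ((mollifyRem X k ε)^[m] f) ≤ ENNReal.ofReal C * derivL2 X j f := by
  obtain ⟨C, hC, H⟩ := exists_eLpNorm_mollifyRem_le.{u} hX hk
  refine ⟨C ^ m, by positivity, ?_⟩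
  induction j with
  | zero =>
    intro F _ _ ε hε f hf
    rw [derivL2_zero hX, derivL2_zero hX]
    induction m with
    | zero => simp
    | succ m ih =>
      rw [Function.iterate_succ_apply', pow_succ', ENNReal.ofReal_mul hC, mul_assoc]
      exact (H F ε hε _ (contDiffOn_mollifyRem_iterate hX hk hε hf m)).trans (by gcongr)
  | succ j ih =>
    intro F _ _ ε hε f hf
    rw [derivL2_succ hX, derivL2_succ hX,
      derivL2_congr hX (fderivWithin_mollifyRem_iterate hX hk hε hf m)]
    exact ih (E →L[ℝ] F) ε hε _ (hf.fderivWithin_isSolidCone hX)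

/-- Each application of the remainder trades one derivative of `f` for a factor `ε`. A kernel with
vanishing moments is thereby avoided. -/
lemma exists_derivL2_mollifyRem_iterate_le_pow (hX : IsSolidCone X) (hk : IsMollifier X k)
    (m j : ℕ) : ∃ C : ℝ, 0 ≤ C ∧ ∀ (F : Type u) [NormedAddCommGroup F] [NormedSpace ℝ F]
      [CompleteSpace F] (ε : ℝ), 0 < ε → ∀ f : E → F, ContDiffOn ℝ ∞ f X →
      derivL2 X j ((mollifyRem X k ε)^[m] f) ≤
        ENNReal.ofReal (C * ε ^ m) * derivL2 X (j + m) f := by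
  obtain ⟨C, hC, H⟩ := exists_eLpNorm_mollifyRem_le_fderivWithin.{u} hX hk
  refine ⟨C ^ m, by positivity, ?_⟩
  induction j with
  | zero =>
    induction m with
    | zero => simp
    | succ m ih =>
      intro F _ _ _ ε hε f hf
      rw [Function.iterate_succ_apply', ← add_assoc, derivL2_succ hX]
      have h1 := H F ε hε _ (contDiffOn_mollifyRem_iterate hX hk hε hf m)
      rw [← derivL2_zero hX, ← derivL2_zero hX,
        derivL2_congr hX (fderivWithin_mollifyRem_iterate hX hk hε hf m)] at h1
      have h2 := ih (E →L[ℝ] F) ε hε _ (hf.fderivWithin_isSolidCone hX)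
      refine h1.trans ((mul_le_mul_right h2 _).trans ?_)
      rw [← mul_assoc, ← ENNReal.ofReal_mul (by positivity)]
      exact mul_le_mul_left (le_of_eq (congrArg ENNReal.ofReal (by ring))) _
  | succ j ih =>
    intro F _ _ _ ε hε f hf
    rw [derivL2_succ hX, derivL2_congr hX (fderivWithin_mollifyRem_iterate hX hk hε hf m),
      add_right_comm, derivL2_succ hX]
    exact ih (E →L[ℝ] F) ε hε _ (hf.fderivWithin_isSolidCone hX)

/-- Jackson-type estimate for the error of the `L`-fold iterated mollifier. -/
lemma exists_derivL2_mollifyRem_iterate_le_pow_of_le (hX : IsSolidCone X) (hk : IsMollifier X k)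
    {L m : ℕ} (hm : m ≤ L) (j : ℕ) :
    ∃ C : ℝ, 0 ≤ C ∧ ∀ (F : Type u) [NormedAddCommGroup F] [NormedSpace ℝ F]
      [CompleteSpace F] (ε : ℝ), 0 < ε → ∀ f : E → F, ContDiffOn ℝ ∞ f X →
      derivL2 X j ((mollifyRem X k ε)^[L] f) ≤
        ENNReal.ofReal (C * ε ^ m) * derivL2 X (j + m) f := by
  obtain ⟨C, hC, H⟩ := exists_derivL2_mollifyRem_iterate_le.{u} hX hk (L - m) j
  obtain ⟨C', hC', H'⟩ := exists_derivL2_mollifyRem_iterate_le_pow.{u} hX hk m j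
  refine ⟨C * C', by positivity, ?_⟩
  intro F _ _ _ ε hε f hf
  -- `m` of the remainders provide the gain; the other `L - m` are merely bounded.
  rw [← Nat.sub_add_cancel hm, Function.iterate_add_apply]
  refine (H F ε hε _ (contDiffOn_mollifyRem_iterate hX hk hε hf m)).trans
    ((mul_le_mul_right (H' F ε hε f hf) _).trans ?_)
  rw [← mul_assoc, ← ENNReal.ofReal_mul hC, mul_assoc]

/-- Bernstein-type estimate for the `L`-fold iterated mollifier. -/
lemma exists_derivL2_sub_mollifyRem_iterate_le (hX : IsSolidCone X) (hk : IsMollifier X k)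
    (L a b : ℕ) :
    ∃ C : ℝ, 0 ≤ C ∧ ∀ (F : Type u) [NormedAddCommGroup F] [NormedSpace ℝ F]
      (ε : ℝ), 0 < ε → ∀ f : E → F, ContDiffOn ℝ ∞ f X →
      derivL2 X (a + b) (fun x => f x - (mollifyRem X k ε)^[L] f x) ≤
        ENNReal.ofReal (C * ε⁻¹ ^ a) * derivL2 X b f := by
  induction L with
  | zero =>
    refine ⟨0, le_rfl, fun F _ _ ε hε f hf => ?_⟩
    have : derivL2 X (a + b) (fun _ : E => (0 : F)) = 0 := by
      unfold derivL2
      simp only [show (fun _ : E => (0 : F)) = 0 from rfl, iteratedFDerivWithin_zero]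
      simp
    simp [this]
  | succ L ih =>
    obtain ⟨C, hC, H⟩ := ih
    obtain ⟨C₁, hC₁, H₁⟩ := exists_derivL2_add_mollify_le.{u} hX hk a b
    obtain ⟨C₂, hC₂, H₂⟩ := exists_derivL2_mollifyRem_iterate_le.{u} hX hk L b
    refine ⟨C + C₁ * C₂, by positivity, fun F _ _ ε hε f hf => ?_⟩
    have hR := contDiffOn_mollifyRem_iterate hX hk hε hf L
    -- With `R` the remainder and `T` the mollification, `1 - R^(L+1) = (1 - R^L) + T R^L`.
    have e : (fun x => f x - (mollifyRem X k ε)^[L + 1] f x) = fun x =>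
        (fun x => f x - (mollifyRem X k ε)^[L] f x) x +
          mollify X k ε ((mollifyRem X k ε)^[L] f) x := by
      ext x
      rw [Function.iterate_succ_apply', mollifyRem]
      exact (sub_add _ _ _).symm
    rw [e]
    refine (derivL2_add_le hX (hf.sub hR)
      (contDiff_mollify hX hk hε hR.continuousOn).contDiffOn _).trans ?_
    rw [add_mul, ENNReal.ofReal_add (by positivity) (by positivity), add_mul]
    refine add_le_add (H F ε hε f hf) ((H₁ F ε hε _ hR).trans
      ((mul_le_mul_right (H₂ F ε hε f hf) _).trans ?_))
    rw [← mul_assoc, ← ENNReal.ofReal_mul (by positivity)]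
    exact mul_le_mul_left (le_of_eq (congrArg ENNReal.ofReal (by ring))) _
end Euclidean

/-! ### A Sobolev inequality on cones. -/

section Euclidean

open MeasureTheory
open scoped ENNReal NNReal Convolution Pointwise

variable {E : Type} [NormedAddCommGroup E] [NormedSpace ℝ E] [FiniteDimensional ℝ E]
  [MeasureSpace E] [BorelSpace E] [(volume : Measure E).IsAddHaarMeasure]
  {F : Type u} [NormedAddCommGroup F] [NormedSpace ℝ F]
  {X : Set E}
/-- The integral of `‖f‖` over the cone segments `x + t y`, `y ∈ B`, `0 < t ≤ 1`, weighted
by `t ^ m`. -/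
noncomputable def segmentIntegral (B : Set E) (m : ℕ) (f : E → F) (x : E) : ℝ≥0∞ :=
  ∫⁻ y in B, ∫⁻ t in Ioc (0 : ℝ) 1, ENNReal.ofReal t ^ m * ‖f (x + t • y)‖ₑ

variable {B : Set E} {x : E}

/-- By Cauchy–Schwarz on `B` it suffices to bound the integral of the square; the substitution `z =
x + t • y` has Jacobian `t ^ finrank`, which the weight supplies. -/
lemma setLIntegral_enorm_translate_smul_le (hX : IsSolidCone X) (hB : IsCompact B)
    (hBX : B ⊆ interior X) {f : E → F} (hf : ContinuousOn f X) (hx : x ∈ X) {t : ℝ} (ht0 : 0 < t)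
    (ht1 : t ≤ 1) :
    ENNReal.ofReal t ^ Module.finrank ℝ E * ∫⁻ y in B, ‖f (x + t • y)‖ₑ ≤
      volume B ^ (1 / 2 : ℝ) * eLpNorm f 2 (volume.restrict X) := by
  have hXm := hX.isClosed.measurableSet
  have hBm := hB.measurableSet
  have hmap : MapsTo (fun y => x + t • y) B X := fun y hy =>
    hX.add_mem hx (hX.smul_mem ht0.le (interior_subset (hBX hy)))
  have hm : AEMeasurable (fun y => ‖f (x + t • y)‖ₑ) (volume.restrict B) :=
    (continuous_enorm.comp_continuousOn (hf.comp (by fun_prop) hmap)).aemeasurable hBm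
  have hCS := ENNReal.lintegral_mul_le_Lp_mul_Lq (volume.restrict B) Real.HolderConjugate.two_two
    hm (aemeasurable_const (b := (1 : ℝ≥0∞)))
  simp only [Pi.mul_apply, mul_one, lintegral_const, ENNReal.rpow_two, one_pow, one_mul,
    Measure.restrict_apply_univ] at hCS
  set N := Module.finrank ℝ E
  have hcv : ENNReal.ofReal t ^ N * ∫⁻ y in B, ‖f (x + t • y)‖ₑ ^ 2 ≤
      ∫⁻ z in X, ‖f z‖ₑ ^ 2 := by
    have h1 := lintegral_image_eq_lintegral_abs_det_fderiv_mul volume hBm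
      (f := fun y => x + t • y) (f' := fun _ => t • ContinuousLinearMap.id ℝ E)
      (fun y _ => (((hasFDerivAt_id y).const_smul t).const_add x).hasFDerivWithinAt)
      (fun y _ z _ h => by simpa [ht0.ne'] using h) (fun z => ‖f z‖ₑ ^ 2)
    have hdet : |(t • ContinuousLinearMap.id ℝ E).det| = t ^ N := by
      rw [ContinuousLinearMap.det, ContinuousLinearMap.toLinearMap_smul, LinearMap.det_smul]
      simp [abs_of_pos ht0, N]
    simp only [hdet] at h1
    rw [lintegral_const_mul' _ _ ENNReal.ofReal_ne_top] at h1
    rw [← ENNReal.ofReal_pow ht0.le, ← h1]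
    exact lintegral_mono_set hmap.image_subset
  rw [eLpNorm_two_eq]
  -- Only half of the weight is needed after the square root; for `t ≤ 1` the rest may be discarded.
  have ht : ENNReal.ofReal t ^ N ≤ (ENNReal.ofReal t ^ N) ^ (1 / 2 : ℝ) := by
    have : ENNReal.ofReal t ^ N ≤ 1 := pow_le_one₀ zero_le (by simpa using ht1)
    simpa using ENNReal.rpow_le_rpow_of_exponent_ge this (by norm_num : (1 / 2 : ℝ) ≤ 1)
  calc _ ≤ (ENNReal.ofReal t ^ N) ^ (1 / 2 : ℝ) *
        ((∫⁻ y in B, ‖f (x + t • y)‖ₑ ^ 2) ^ (1 / 2 : ℝ) * volume B ^ (1 / 2 : ℝ)) := by gcongr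
    _ = (ENNReal.ofReal t ^ N * ∫⁻ y in B, ‖f (x + t • y)‖ₑ ^ 2) ^ (1 / 2 : ℝ) *
        volume B ^ (1 / 2 : ℝ) := by
      rw [ENNReal.mul_rpow_of_nonneg _ _ (by norm_num : (0 : ℝ) ≤ 1 / 2), mul_assoc]
    _ ≤ _ := by
      rw [mul_comm]
      gcongr

lemma segmentIntegral_finrank_le (hX : IsSolidCone X) (hB : IsCompact B)
    (hBX : B ⊆ interior X) {f : E → F} (hf : ContinuousOn f X) (hx : x ∈ X) :
    segmentIntegral B (Module.finrank ℝ E) f x ≤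
      volume B ^ (1 / 2 : ℝ) * eLpNorm f 2 (volume.restrict X) := by
  have hm : AEMeasurable (Function.uncurry fun (y : E) (t : ℝ) =>
      ENNReal.ofReal t ^ Module.finrank ℝ E * ‖f (x + t • y)‖ₑ)
      ((volume.restrict B).prod (volume.restrict (Ioc (0 : ℝ) 1))) := by
    rw [Measure.prod_restrict]
    have h1 : ContinuousOn (fun p : E × ℝ => f (x + p.2 • p.1)) (B ×ˢ Ioc (0 : ℝ) 1) :=
      hf.comp (by fun_prop) fun p hp =>
        hX.add_mem hx (hX.smul_mem hp.2.1.le (interior_subset (hBX hp.1)))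
    refine AEMeasurable.mul (f := fun p : E × ℝ => ENNReal.ofReal p.2 ^ Module.finrank ℝ E)
      (Measurable.aemeasurable (by fun_prop)) ?_
    exact (continuous_enorm.comp_continuousOn h1).aemeasurable
      (hB.measurableSet.prod measurableSet_Ioc)
  rw [segmentIntegral, lintegral_lintegral_swap hm]
  refine (setLIntegral_mono' measurableSet_Ioc (g := fun _ =>
    volume B ^ (1 / 2 : ℝ) * eLpNorm f 2 (volume.restrict X)) fun t ht => ?_).trans (by simp)
  rw [lintegral_const_mul' _ _ (by finiteness)]
  exact setLIntegral_enorm_translate_smul_le hX hB hBX hf hx ht.1 ht.2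

/-- `f (x + t • y)` is `f (x + y)` minus an integral of the derivative over `s` in `(t, 1]`.
Exchanging the order of integration leaves the integral of `t ^ m` over `t < s`, at most `s ^ (m +
1)`: one derivative buys one power of the weight. -/
lemma lintegral_segment_le [CompleteSpace F] (hX : IsSolidCone X) {f : E → F}
    (hf : ContDiffOn ℝ ∞ f X) (hx : x ∈ X) {y : E} (hy : y ∈ interior X) (m : ℕ) :
    ∫⁻ t in Ioc (0 : ℝ) 1, ENNReal.ofReal t ^ m * ‖f (x + t • y)‖ₑ ≤ ‖f (x + y)‖ₑ +
      ‖y‖ₑ * ∫⁻ t in Ioc (0 : ℝ) 1,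
        ENNReal.ofReal t ^ (m + 1) * ‖fderivWithin ℝ f X (x + t • y)‖ₑ := by
  set D : ℝ → ℝ≥0∞ := fun t => ‖fderivWithin ℝ f X (x + t • y)‖ₑ with hD
  have hDm : AEMeasurable D (volume.restrict (Ioc (0 : ℝ) 1)) := by
    refine ContinuousOn.aemeasurable ?_ measurableSet_Ioc
    exact continuous_enorm.comp_continuousOn ((hf.fderivWithin_isSolidCone hX).continuousOn.comp
      (by fun_prop) fun t ht => hX.add_mem hx (hX.smul_mem ht.1.le (interior_subset hy)))
  have h1 : ∀ t ∈ Ioc (0 : ℝ) 1, ENNReal.ofReal t ^ m * ‖f (x + t • y)‖ₑ ≤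
      ‖f (x + y)‖ₑ + ‖y‖ₑ * ∫⁻ s in Ioc (0 : ℝ) 1,
        {p : ℝ × ℝ | p.1 < p.2}.indicator (fun p => ENNReal.ofReal p.1 ^ m) (t, s) * D s := by
    intro t ht
    have ht1 : ENNReal.ofReal t ^ m ≤ 1 := pow_le_one₀ zero_le (by simpa using ht.2)
    have h2 : ‖f (x + t • y)‖ₑ ≤ ‖f (x + y)‖ₑ + ‖y‖ₑ * ∫⁻ s in Ioc t 1, D s := by
      have := enorm_sub_le_lintegral_fderivWithin hX hf hx hy ht.1.le ht.2
      have e : f (x + t • y) = f (x + y) - (f (x + y) - f (x + t • y)) := by simp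
      rw [e]
      exact enorm_sub_le.trans (by gcongr)
    have h3 : ENNReal.ofReal t ^ m * ∫⁻ s in Ioc t 1, D s = ∫⁻ s in Ioc (0 : ℝ) 1,
        {p : ℝ × ℝ | p.1 < p.2}.indicator (fun p => ENNReal.ofReal p.1 ^ m) (t, s) * D s := by
      rw [← lintegral_const_mul' _ _ (by finiteness), ← lintegral_indicator measurableSet_Ioc,
        ← lintegral_indicator measurableSet_Ioc]
      refine lintegral_congr fun s => ?_
      by_cases hs : t < s
      · by_cases hs1 : s ≤ 1
        · simp [hs, hs1, ht.1.trans hs]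
        · simp [hs1]
      · simp [hs, indicator]
    rw [← h3]
    calc _ ≤ ENNReal.ofReal t ^ m * (‖f (x + y)‖ₑ + ‖y‖ₑ * ∫⁻ s in Ioc t 1, D s) := by gcongr
      _ = ENNReal.ofReal t ^ m * ‖f (x + y)‖ₑ +
          ‖y‖ₑ * (ENNReal.ofReal t ^ m * ∫⁻ s in Ioc t 1, D s) := by ring
      _ ≤ 1 * ‖f (x + y)‖ₑ + _ := by gcongr
      _ = _ := by rw [one_mul]
  refine (setLIntegral_mono' measurableSet_Ioc h1).trans ?_
  rw [lintegral_add_left' aemeasurable_const, lintegral_const_mul' _ _ enorm_ne_top]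
  simp only [lintegral_const, Measure.restrict_apply_univ, Real.volume_Ioc, sub_zero,
    ENNReal.ofReal_one, mul_one]
  refine add_le_add_right (mul_le_mul_right ?_ _) _
  have hmeas : AEMeasurable (Function.uncurry fun (t s : ℝ) =>
      {p : ℝ × ℝ | p.1 < p.2}.indicator (fun p => ENNReal.ofReal p.1 ^ m) (t, s) * D s)
      ((volume.restrict (Ioc (0 : ℝ) 1)).prod (volume.restrict (Ioc (0 : ℝ) 1))) := by
    refine AEMeasurable.mul (Measurable.aemeasurable ?_) hDm.comp_snd
    exact Measurable.indicator (by fun_prop) (measurableSet_lt measurable_fst measurable_snd)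
  rw [lintegral_lintegral_swap hmeas]
  refine setLIntegral_mono' measurableSet_Ioc fun s hs => ?_
  rw [lintegral_mul_const' _ _ (by simp [hD])]
  refine mul_le_mul_left ?_ _
  calc _ ≤ ∫⁻ t in Ioc (0 : ℝ) 1, (Ioc 0 s).indicator (fun _ => ENNReal.ofReal s ^ m) t := by
        refine setLIntegral_mono' measurableSet_Ioc fun t ht => ?_
        by_cases hts : t < s
        · simp only [indicator, mem_ofPred_eq, hts, mem_Ioc, ht.1, hts.le, and_self, if_true]
          gcongr
        · simp [hts]
    _ ≤ ∫⁻ t, (Ioc 0 s).indicator (fun _ => ENNReal.ofReal s ^ m) t := setLIntegral_le_lintegral _ _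
    _ = ENNReal.ofReal s ^ (m + 1) := by
      rw [lintegral_indicator measurableSet_Ioc]
      simp [pow_succ]

lemma setLIntegral_enorm_translate_le (hX : IsSolidCone X) (hB : IsCompact B)
    (hBX : B ⊆ interior X) {f : E → F} (hf : ContinuousOn f X) (hx : x ∈ X) :
    ∫⁻ y in B, ‖f (x + y)‖ₑ ≤ volume B ^ (1 / 2 : ℝ) * eLpNorm f 2 (volume.restrict X) := by
  simpa using setLIntegral_enorm_translate_smul_le hX hB hBX hf hx one_pos le_rfl

lemma segmentIntegral_le [CompleteSpace F] (hX : IsSolidCone X) (hB : IsCompact B)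
    (hBX : B ⊆ interior X) {R : ℝ} (hR : ∀ y ∈ B, ‖y‖ ≤ R) {f : E → F} (hf : ContDiffOn ℝ ∞ f X)
    (hx : x ∈ X) (m : ℕ) :
    segmentIntegral B m f x ≤ volume B ^ (1 / 2 : ℝ) * eLpNorm f 2 (volume.restrict X) +
      ENNReal.ofReal R * segmentIntegral B (m + 1) (fderivWithin ℝ f X) x := by
  have hmap : MapsTo (fun y => x + y) B X := fun y hy =>
    hX.add_mem hx (interior_subset (hBX hy))
  have hm : AEMeasurable (fun y => ‖f (x + y)‖ₑ) (volume.restrict B) :=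
    (continuous_enorm.comp_continuousOn (hf.continuousOn.comp (by fun_prop) hmap)).aemeasurable
      hB.measurableSet
  refine le_trans ?_ (add_le_add_left
    (setLIntegral_enorm_translate_le hX hB hBX hf.continuousOn hx) _)
  rw [segmentIntegral, segmentIntegral, ← lintegral_const_mul' _ _ ENNReal.ofReal_ne_top,
    ← lintegral_add_left' hm]
  refine setLIntegral_mono' hB.measurableSet fun y hy => ?_
  refine (lintegral_segment_le hX hf hx (hBX hy) m).trans ?_
  gcongr
  rw [← ofReal_norm]
  exact ENNReal.ofReal_le_ofReal (hR y hy)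

/-- Derivatives are traded for powers of the weight until it reaches `t ^ finrank`, where it
compensates the Jacobian and the `L²` norm bounds the integral. -/
lemma exists_segmentIntegral_le (hX : IsSolidCone X) (hB : IsCompact B) (hBX : B ⊆ interior X)
    (p : ℕ) : ∀ m, m + p = Module.finrank ℝ E → ∃ C : ℝ≥0, ∀ (F : Type u) [NormedAddCommGroup F]
      [NormedSpace ℝ F] [CompleteSpace F] (f : E → F), ContDiffOn ℝ ∞ f X → ∀ x ∈ X,
      segmentIntegral B m f x ≤ C * ∑ j ∈ Finset.range (p + 1), derivL2 X j f := by
  have hfin : volume B ^ (1 / 2 : ℝ) ≠ ⊤ :=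
    ENNReal.rpow_ne_top_of_nonneg (by norm_num) hB.measure_ne_top
  obtain ⟨R, hR⟩ := hB.exists_bound_of_continuousOn continuousOn_id
  induction p with
  | zero =>
    rintro m rfl
    refine ⟨(volume B ^ (1 / 2 : ℝ)).toNNReal, fun F _ _ _ f hf x hx => ?_⟩
    simp only [ENNReal.coe_toNNReal hfin, zero_add, Finset.sum_range_one, derivL2_zero hX]
    exact segmentIntegral_finrank_le hX hB hBX hf.continuousOn hx
  | succ p ih =>
    intro m hm
    obtain ⟨C, H⟩ := ih (m + 1) (by omega)
    refine ⟨(volume B ^ (1 / 2 : ℝ)).toNNReal + R.toNNReal * C, fun F _ _ _ f hf x hx => ?_⟩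
    refine (segmentIntegral_le hX hB hBX hR hf hx m).trans ?_
    have h1 := H (E →L[ℝ] F) _ (hf.fderivWithin_isSolidCone hX) x hx
    simp only [← derivL2_succ hX] at h1
    rw [Finset.sum_range_succ', ENNReal.coe_add, ENNReal.coe_toNNReal hfin, add_mul, derivL2_zero hX,
      ENNReal.coe_mul, mul_assoc]
    gcongr
    · exact le_add_self
    · exact le_rfl
    · exact h1.trans (by gcongr; exact le_self_add)

/-- The Sobolev inequality on a solid cone. -/
lemma exists_enorm_le_sum_derivL2 (hX : IsSolidCone X) :
    ∃ C : ℝ≥0, ∀ (F : Type u) [NormedAddCommGroup F] [NormedSpace ℝ F] [CompleteSpace F]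
      (f : E → F), ContDiffOn ℝ ∞ f X → ∀ x ∈ X,
      ‖f x‖ₑ ≤ C * ∑ j ∈ Finset.range (Module.finrank ℝ E + 2), derivL2 X j f := by
  obtain ⟨y₀, hy₀⟩ := hX.interior_nonempty
  obtain ⟨r, hr, hball⟩ := Metric.nhds_basis_closedBall.mem_iff.1 (isOpen_interior.mem_nhds hy₀)
  set B := Metric.closedBall y₀ r
  have hB : IsCompact B := isCompact_closedBall y₀ r
  have hB0 : volume B ≠ 0 := (Metric.measure_closedBall_pos _ _ hr).ne'
  have hfin : volume B ^ (1 / 2 : ℝ) ≠ ⊤ :=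
    ENNReal.rpow_ne_top_of_nonneg (by norm_num) hB.measure_ne_top
  obtain ⟨R, hR⟩ := hB.exists_bound_of_continuousOn continuousOn_id
  -- Applied to the derivative of `f` without weight; this extra derivative accounts for `finrank +
  -- 2` terms instead of `finrank + 1`.
  obtain ⟨C, H⟩ := exists_segmentIntegral_le.{u} hX hB hball (Module.finrank ℝ E) 0 (by simp)
  refine ⟨(volume B)⁻¹.toNNReal * ((volume B ^ (1 / 2 : ℝ)).toNNReal + R.toNNReal * C),
    fun F _ _ _ f hf x hx => ?_⟩
  have hmap : MapsTo (fun y => x + y) B X := fun y hy =>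
    hX.add_mem hx (interior_subset (hball hy))
  have hm : AEMeasurable (fun y => ‖f (x + y)‖ₑ) (volume.restrict B) :=
    (continuous_enorm.comp_continuousOn (hf.continuousOn.comp (by fun_prop) hmap)).aemeasurable
      hB.measurableSet
  have h1 : volume B * ‖f x‖ₑ ≤ volume B ^ (1 / 2 : ℝ) * eLpNorm f 2 (volume.restrict X) +
      ENNReal.ofReal R * segmentIntegral B 0 (fderivWithin ℝ f X) x := by
    refine le_trans ?_ (add_le_add_left
      (setLIntegral_enorm_translate_le hX hB hball hf.continuousOn hx) _)
    rw [segmentIntegral, ← lintegral_const_mul' _ _ ENNReal.ofReal_ne_top,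
      ← lintegral_add_left' hm, mul_comm, ← setLIntegral_const]
    refine setLIntegral_mono' hB.measurableSet fun y hy => ?_
    have h2 := enorm_sub_le_lintegral_fderivWithin hX hf hx (hball hy) le_rfl zero_le_one
    rw [zero_smul, add_zero] at h2
    have e : f x = f (x + y) - (f (x + y) - f x) := by simp
    rw [e]
    refine enorm_sub_le.trans (add_le_add_right (h2.trans ?_) _)
    simp only [pow_zero, one_mul]
    gcongr
    rw [← ofReal_norm]
    exact ENNReal.ofReal_le_ofReal (hR y hy)
  have h3 := H (E →L[ℝ] F) _ (hf.fderivWithin_isSolidCone hX) x hx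
  simp only [← derivL2_succ hX] at h3
  have h4 : volume B * ‖f x‖ₑ ≤ ((volume B ^ (1 / 2 : ℝ)).toNNReal + R.toNNReal * C : ℝ≥0) *
      ∑ j ∈ Finset.range (Module.finrank ℝ E + 2), derivL2 X j f := by
    refine h1.trans ?_
    rw [Finset.sum_range_succ', ENNReal.coe_add, ENNReal.coe_toNNReal hfin, add_mul,
      derivL2_zero hX, ENNReal.coe_mul, mul_assoc]
    gcongr
    · exact le_add_self
    · exact le_rfl
    · exact h3.trans (by gcongr; exact le_self_add)
  rw [ENNReal.coe_mul, ENNReal.coe_toNNReal (ENNReal.inv_ne_top.2 hB0), mul_assoc]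
  calc ‖f x‖ₑ = (volume B)⁻¹ * (volume B * ‖f x‖ₑ) := by
        rw [← mul_assoc, ENNReal.inv_mul_cancel hB0 hB.measure_ne_top, one_mul]
    _ ≤ _ := by gcongr

lemma exists_enorm_iteratedFDerivWithin_le_sum_derivL2 (hX : IsSolidCone X) (l : ℕ) :
    ∃ C : ℝ≥0, ∀ (F : Type u) [NormedAddCommGroup F] [NormedSpace ℝ F] [CompleteSpace F]
      (f : E → F), ContDiffOn ℝ ∞ f X → ∀ x ∈ X, ‖iteratedFDerivWithin ℝ l f X x‖ₑ ≤
        C * ∑ j ∈ Finset.range (Module.finrank ℝ E + 2), derivL2 X (j + l) f := by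
  obtain ⟨C, H⟩ := exists_enorm_le_sum_derivL2.{u} hX
  refine ⟨C, ?_⟩
  induction l with
  | zero =>
    intro F _ _ _ f hf x hx
    rw [← ofReal_norm, norm_iteratedFDerivWithin_zero, ofReal_norm]
    exact H F f hf x hx
  | succ l ih =>
    intro F _ _ _ f hf x hx
    rw [← ofReal_norm, ← norm_iteratedFDerivWithin_fderivWithin hX.uniqueDiffOn hx, ofReal_norm]
    simp only [← add_assoc, derivL2_succ hX]
    exact ih (E →L[ℝ] F) _ (hf.fderivWithin_isSolidCone hX) x hx
end Euclidean

/-! ### Smooth limits of sequences with uniformly Cauchy derivatives. -/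

section Euclidean

open MeasureTheory
open scoped ENNReal NNReal Convolution Pointwise

variable {E : Type} [NormedAddCommGroup E] [NormedSpace ℝ E] [FiniteDimensional ℝ E]
  [MeasureSpace E] [BorelSpace E] [(volume : Measure E).IsAddHaarMeasure]
  {F : Type u} [NormedAddCommGroup F] [NormedSpace ℝ F]
  {X : Set E}
lemma norm_iteratedFDerivWithin_succ_sub (hX : IsSolidCone X) {f g : E → F}
    (hf : DifferentiableOn ℝ f X) (hg : DifferentiableOn ℝ g X) {x : E} (hx : x ∈ X) (l : ℕ) :
    ‖iteratedFDerivWithin ℝ (l + 1) (fun x => f x - g x) X x‖ =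
      ‖iteratedFDerivWithin ℝ l (fun x => fderivWithin ℝ f X x - fderivWithin ℝ g X x) X x‖ := by
  rw [← norm_iteratedFDerivWithin_fderivWithin hX.uniqueDiffOn hx]
  congr 1
  refine iteratedFDerivWithin_congr (fun z hz => ?_) hx l
  exact fderivWithin_fun_sub (hX.uniqueDiffOn z hz) (hf z hz) (hg z hz)

/-- All derivatives of the sequence `f` are uniformly Cauchy on `X`. -/
def UniformCauchyDerivs (X : Set E) (f : ℕ → E → F) : Prop :=
  ∀ (l : ℕ) (ε : ℝ), 0 < ε → ∃ N, ∀ i ≥ N, ∀ j ≥ N, ∀ x ∈ X,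
    ‖iteratedFDerivWithin ℝ l (fun x => f i x - f j x) X x‖ ≤ ε

lemma UniformCauchyDerivs.fderivWithin (hX : IsSolidCone X) {f : ℕ → E → F}
    (hf : ∀ i, ContDiffOn ℝ ∞ (f i) X) (hC : UniformCauchyDerivs X f) :
    UniformCauchyDerivs X fun i => fderivWithin ℝ (f i) X := by
  intro l ε hε
  obtain ⟨N, hN⟩ := hC (l + 1) ε hε
  refine ⟨N, fun i hi j hj x hx => ?_⟩
  rw [← norm_iteratedFDerivWithin_succ_sub hX ((hf i).differentiableOn (by simp))
    ((hf j).differentiableOn (by simp)) hx]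
  exact hN i hi j hj x hx

lemma UniformCauchyDerivs.exists_tendsto [CompleteSpace F] {f : ℕ → E → F}
    (hC : UniformCauchyDerivs X f) :
    ∃ g : E → F, ∀ x ∈ X, Tendsto (fun i => f i x) atTop (𝓝 (g x)) := by
  have : ∀ x, ∃ y, x ∈ X → Tendsto (fun i => f i x) atTop (𝓝 y) := by
    intro x
    by_cases hx : x ∈ X
    · have hc : CauchySeq fun i => f i x := by
        refine Metric.cauchySeq_iff'.2 fun ε hε => ?_
        obtain ⟨N, hN⟩ := hC 0 (ε / 2) (by positivity)
        refine ⟨N, fun i hi => ?_⟩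
        have := hN i hi N le_rfl x hx
        rw [norm_iteratedFDerivWithin_zero] at this
        rw [dist_eq_norm]
        linarith
      obtain ⟨y, hy⟩ := cauchySeq_tendsto_of_complete hc
      exact ⟨y, fun _ => hy⟩
    · exact ⟨0, fun h => absurd h hx⟩
  choose g hg using this
  exact ⟨g, hg⟩

lemma UniformCauchyDerivs.exists_norm_sub_limit_le {f : ℕ → E → F} {g : E → F}
    (hC : UniformCauchyDerivs X f) (hg : ∀ x ∈ X, Tendsto (fun i => f i x) atTop (𝓝 (g x)))
    {ε : ℝ} (hε : 0 < ε) : ∃ N, ∀ i ≥ N, ∀ x ∈ X, ‖f i x - g x‖ ≤ ε := by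
  obtain ⟨N, hN⟩ := hC 0 ε hε
  refine ⟨N, fun i hi x hx => ?_⟩
  refine le_of_tendsto ((tendsto_const_nhds.sub (hg x hx)).norm) ?_
  filter_upwards [eventually_ge_atTop N] with j hj
  simpa [norm_iteratedFDerivWithin_zero] using hN i hi j hj x hx

/-- An `ε/3` argument: the mean value inequality on the convex set `X`, applied to `f j - f i` and
passed to the limit in `j`, controls the difference quotients of `g - f i` uniformly. -/
lemma UniformCauchyDerivs.hasFDerivWithinAt_limit (hX : IsSolidCone X) {f : ℕ → E → F} {g : E → F}
    {G : E → E →L[ℝ] F} (hf : ∀ i, ContDiffOn ℝ ∞ (f i) X) (hC : UniformCauchyDerivs X f)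
    (hg : ∀ x ∈ X, Tendsto (fun i => f i x) atTop (𝓝 (g x)))
    (hG : ∀ x ∈ X, Tendsto (fun i => _root_.fderivWithin ℝ (f i) X x) atTop (𝓝 (G x)))
    {x : E} (hx : x ∈ X) : HasFDerivWithinAt g (G x) X x := by
  have hC' := hC.fderivWithin hX hf
  rw [hasFDerivWithinAt_iff_isLittleO, Asymptotics.isLittleO_iff]
  intro c hc
  obtain ⟨N, hN⟩ := hC' 0 (c / 3) (by positivity)
  obtain ⟨N', hN'⟩ := hC'.exists_norm_sub_limit_le hG (ε := c / 3) (by positivity)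
  set i := max N N'
  have hdi : HasFDerivWithinAt (f i) (_root_.fderivWithin ℝ (f i) X x) X x :=
    ((hf i).differentiableOn (by simp) x hx).hasFDerivWithinAt
  have h1 := (hasFDerivWithinAt_iff_isLittleO.1 hdi).def (c := c / 3) (by positivity)
  filter_upwards [h1, self_mem_nhdsWithin] with y hy hyX
  have h2 : ‖(g y - f i y) - (g x - f i x)‖ ≤ c / 3 * ‖y - x‖ := by
    have ht := (((hg y hyX).sub_const (f i y)).sub ((hg x hx).sub_const (f i x))).norm
    refine le_of_tendsto ht ?_
    filter_upwards [eventually_ge_atTop N] with j hj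
    refine hX.convex.norm_image_sub_le_of_norm_hasFDerivWithin_le
      (f := fun z => f j z - f i z) (C := c / 3) (fun z hz =>
      (((hf j).differentiableOn (by simp) z hz).hasFDerivWithinAt.sub
      ((hf i).differentiableOn (by simp) z hz).hasFDerivWithinAt)) (fun z hz => ?_) hx hyX
    simpa [norm_iteratedFDerivWithin_zero] using hN j hj i (le_max_left _ _) z hz
  have h3 : ‖(_root_.fderivWithin ℝ (f i) X x - G x) (y - x)‖ ≤ c / 3 * ‖y - x‖ :=
    ContinuousLinearMap.le_of_opNorm_le _ (hN' i (le_max_right _ _) x hx) _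
  have e : g y - g x - (G x) (y - x) = ((g y - f i y) - (g x - f i x)) +
      (f i y - f i x - (_root_.fderivWithin ℝ (f i) X x) (y - x)) +
      (_root_.fderivWithin ℝ (f i) X x - G x) (y - x) := by
    rw [sub_apply]
    abel
  rw [e]
  refine (norm_add₃_le).trans ?_
  linarith

lemma UniformCauchyDerivs.contDiffOn_limit (hX : IsSolidCone X) (n : ℕ) :
    ∀ {F : Type u} [NormedAddCommGroup F] [NormedSpace ℝ F] [CompleteSpace F] {f : ℕ → E → F}
    {g : E → F}, (∀ i, ContDiffOn ℝ ∞ (f i) X) → UniformCauchyDerivs X f →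
    (∀ x ∈ X, Tendsto (fun i => f i x) atTop (𝓝 (g x))) → ContDiffOn ℝ n g X := by
  induction n with
  | zero =>
    intro F _ _ _ f g hf hC hg
    obtain ⟨G, hG⟩ := (hC.fderivWithin hX hf).exists_tendsto
    exact contDiffOn_zero.2 fun x hx =>
      (hC.hasFDerivWithinAt_limit hX hf hg hG hx).continuousWithinAt
  | succ n ih =>
    intro F _ _ _ f g hf hC hg
    obtain ⟨G, hG⟩ := (hC.fderivWithin hX hf).exists_tendsto
    rw [Nat.cast_succ, contDiffOn_succ_iff_hasFDerivWithinAt_of_uniqueDiffOn hX.uniqueDiffOn]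
    exact ⟨by simp, G, ih (fun i => (hf i).fderivWithin_isSolidCone hX)
      (hC.fderivWithin hX hf) hG, fun x hx => hC.hasFDerivWithinAt_limit hX hf hg hG hx⟩

lemma UniformCauchyDerivs.exists_norm_iteratedFDerivWithin_sub_limit_le (hX : IsSolidCone X)
    (l : ℕ) : ∀ {F : Type u} [NormedAddCommGroup F] [NormedSpace ℝ F] [CompleteSpace F]
    {f : ℕ → E → F} {g : E → F}, (∀ i, ContDiffOn ℝ ∞ (f i) X) → UniformCauchyDerivs X f →
    (∀ x ∈ X, Tendsto (fun i => f i x) atTop (𝓝 (g x))) → ∀ ε > 0, ∃ N, ∀ i ≥ N, ∀ x ∈ X,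
      ‖iteratedFDerivWithin ℝ l (fun x => f i x - g x) X x‖ ≤ ε := by
  induction l with
  | zero =>
    intro F _ _ _ f g hf hC hg ε hε
    simpa only [norm_iteratedFDerivWithin_zero] using hC.exists_norm_sub_limit_le hg hε
  | succ l ih =>
    intro F _ _ _ f g hf hC hg ε hε
    obtain ⟨G, hG⟩ := (hC.fderivWithin hX hf).exists_tendsto
    have hgG : ∀ x ∈ X, HasFDerivWithinAt g (G x) X x := fun x hx =>
      hC.hasFDerivWithinAt_limit hX hf hg hG hx
    obtain ⟨N, hN⟩ := ih (fun i => (hf i).fderivWithin_isSolidCone hX) (hC.fderivWithin hX hf) hG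
      ε hε
    refine ⟨N, fun i hi x hx => ?_⟩
    rw [norm_iteratedFDerivWithin_succ_sub hX ((hf i).differentiableOn (by simp))
      (fun z hz => (hgG z hz).differentiableWithinAt) hx]
    refine le_trans (le_of_eq ?_) (hN i hi x hx)
    congr 1
    refine iteratedFDerivWithin_congr (fun z hz => ?_) hx l
    rw [(hgG z hz).fderivWithin (hX.uniqueDiffOn z hz)]

/-- A sequence all of whose derivatives are uniformly Cauchy has a smooth limit. -/
lemma UniformCauchyDerivs.exists_limit (hX : IsSolidCone X) [CompleteSpace F] {f : ℕ → E → F}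
    (hf : ∀ i, ContDiffOn ℝ ∞ (f i) X) (hC : UniformCauchyDerivs X f) :
    ∃ g : E → F, ContDiffOn ℝ ∞ g X ∧ (∀ x ∈ X, Tendsto (fun i => f i x) atTop (𝓝 (g x))) ∧
      ∀ (l : ℕ), ∀ ε > 0, ∃ N, ∀ i ≥ N, ∀ x ∈ X,
        ‖iteratedFDerivWithin ℝ l (fun x => f i x - g x) X x‖ ≤ ε := by
  obtain ⟨g, hg⟩ := hC.exists_tendsto
  exact ⟨g, contDiffOn_infty.2 fun n => contDiffOn_limit hX n hf hC hg, hg,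
    fun l => exists_norm_iteratedFDerivWithin_sub_limit_le hX l hf hC hg⟩
end Euclidean

/-! ### Derivative norms under cut-off and change of coordinates. -/

section Euclidean

open MeasureTheory
open scoped ENNReal NNReal Convolution Pointwise

variable {E : Type} [NormedAddCommGroup E] [NormedSpace ℝ E] [FiniteDimensional ℝ E]
  [MeasureSpace E] [BorelSpace E] [(volume : Measure E).IsAddHaarMeasure]
  {F F' : Type*} [NormedAddCommGroup F] [NormedSpace ℝ F] [NormedAddCommGroup F'] [NormedSpace ℝ F']
  {X : Set E}
lemma iteratedFDerivWithin_eq_zero_of_notMem {f : E → F} {K : Set E} (hK : IsClosed K)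
    (hf : ∀ x ∈ X, x ∉ K → f x = 0) {x : E} (hx : x ∈ X) (hxK : x ∉ K) (j : ℕ) :
    iteratedFDerivWithin ℝ j f X x = 0 := by
  have h : f =ᶠ[𝓝[X] x] fun _ => 0 := by
    filter_upwards [self_mem_nhdsWithin, mem_nhdsWithin_of_mem_nhds (hK.isOpen_compl.mem_nhds hxK)]
      with y hy hyK using hf y hy hyK
  rw [h.iteratedFDerivWithin_eq (hf x hx hxK), show (fun _ : E => (0 : F)) = 0 from rfl,
    iteratedFDerivWithin_zero]
  rfl

lemma derivL2_le_of_norm_le (hX : IsSolidCone X) {f : E → F} {K : Set E} (hK : IsCompact K)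
    (hf : ∀ x ∈ X, x ∉ K → f x = 0) {j : ℕ} {c : ℝ}
    (hc : ∀ x ∈ X, ‖iteratedFDerivWithin ℝ j f X x‖ ≤ c) :
    derivL2 X j f ≤ volume K ^ (1 / 2 : ℝ) * ENNReal.ofReal c := by
  have h := eLpNorm_restrict_mono (f := fun x => ‖iteratedFDerivWithin ℝ j f X x‖)
    (g := K.indicator fun _ => c) hX fun x hx => by
      by_cases hxK : x ∈ K
      · rw [indicator_of_mem hxK, enorm_norm, ← ofReal_norm, ← ofReal_norm]
        exact ENNReal.ofReal_le_ofReal ((hc x hx).trans (le_abs_self c))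
      · simp [iteratedFDerivWithin_eq_zero_of_notMem hK.isClosed hf hx hxK j]
  rcases lt_or_ge c 0 with hc0 | hc0
  -- A negative bound on a norm is only possible if `X` is empty.
  · have : X = ∅ := by
      by_contra hne
      obtain ⟨x, hx⟩ := nonempty_iff_ne_empty.2 hne
      exact absurd ((norm_nonneg _).trans (hc x hx)) (not_le.2 hc0)
    subst this
    simp [derivL2]
  refine h.trans ((eLpNorm_mono_measure _ Measure.restrict_le_self).trans ?_)
  rw [eLpNorm_indicator_const hK.measurableSet (by norm_num) (by norm_num), mul_comm]
  simp [← ofReal_norm, abs_of_nonneg hc0]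

lemma derivL2_lt_top (hX : IsSolidCone X) {f : E → F} (hfs : ContDiffOn ℝ ∞ f X) {K : Set E}
    (hK : IsCompact K) (hf : ∀ x ∈ X, x ∉ K → f x = 0) (j : ℕ) : derivL2 X j f < ⊤ := by
  obtain ⟨c, hc⟩ := (hK.inter_left hX.isClosed).exists_bound_of_continuousOn
    ((hfs.continuousOn_iteratedFDerivWithin (m := j) (mod_cast le_top) hX.uniqueDiffOn).mono
      inter_subset_left)
  refine (derivL2_le_of_norm_le hX hK hf (c := max c 0) (j := j) fun x hx => ?_).trans_lt ?_
  · by_cases hxK : x ∈ K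
    · exact (hc x ⟨hx, hxK⟩).trans (le_max_left _ _)
    · simp [iteratedFDerivWithin_eq_zero_of_notMem hK.isClosed hf hx hxK j]
  · exact ENNReal.mul_lt_top (ENNReal.rpow_lt_top_of_nonneg (by norm_num) hK.measure_ne_top)
      ENNReal.ofReal_lt_top

/-- A continuous function vanishing almost everywhere vanishes everywhere on `X`, since `X` lies in
the closure of its interior. -/
lemma eqOn_zero_of_derivL2_zero (hX : IsSolidCone X) {f : E → F} (hf : ContinuousOn f X)
    (h : derivL2 X 0 f = 0) : ∀ x ∈ X, f x = 0 := by
  rw [derivL2_zero hX, eLpNorm_eq_zero_iff (hf.aestronglyMeasurable_of_isSolidCone hX)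
    (by norm_num)] at h
  exact Measure.eqOn_of_ae_eq h hf continuousOn_const hX.subset_closure_interior

lemma norm_iteratedFDerivWithin_comp_clm_le {U : Set E} (hU : UniqueDiffOn ℝ U)
    (hX : IsSolidCone X) {κ : E → E} {M : E → F →L[ℝ] F'} (hκ : ContDiffOn ℝ ∞ κ U)
    (hM : ContDiffOn ℝ ∞ M U) (hκX : MapsTo κ U X) {g : E → F} (hg : ContDiffOn ℝ ∞ g X) (j : ℕ)
    {x : E} (hx : x ∈ U) {b : ℝ} (hb1 : 1 ≤ b)
    (hbκ : ∀ i ≤ j, ‖iteratedFDerivWithin ℝ i κ U x‖ ≤ b)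
    (hbM : ∀ i ≤ j, ‖iteratedFDerivWithin ℝ i M U x‖ ≤ b) :
    ‖iteratedFDerivWithin ℝ j (fun x => M x (g (κ x))) U x‖ ≤
      (∑ i ∈ Finset.range (j + 1), (j.choose i : ℝ) * b * ((j - i).factorial * b ^ (j - i))) *
        ∑ l ∈ Finset.range (j + 1), ‖iteratedFDerivWithin ℝ l g X (κ x)‖ := by
  have hgκ : ContDiffOn ℝ ∞ (g ∘ κ) U := hg.comp hκ hκX
  refine (norm_iteratedFDerivWithin_clm_apply (N := ∞) (n := j) hM hgκ hU hx
    (mod_cast le_top)).trans ?_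
  rw [Finset.sum_mul]
  refine Finset.sum_le_sum fun i hi => ?_
  have hij : i ≤ j := Nat.lt_succ_iff.1 (Finset.mem_range.1 hi)
  have hn (p : ℕ) : (p : ℕ∞ω) ≤ ((⊤ : ℕ∞) : ℕ∞ω) := mod_cast le_top
  have h1 := norm_iteratedFDerivWithin_comp_le hg hκ (hn (j - i))
    hX.uniqueDiffOn hU hκX hx
    (C := ∑ l ∈ Finset.range (j + 1), ‖iteratedFDerivWithin ℝ l g X (κ x)‖) (D := b)
    (fun l hl => Finset.single_le_sum
      (f := fun l => ‖iteratedFDerivWithin ℝ l g X (κ x)‖) (fun _ _ => norm_nonneg _)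
      (Finset.mem_range.2 (by omega)))
    (fun l hl1 hl => (hbκ l (by omega)).trans (le_self_pow₀ hb1 (by omega)))
  calc _ ≤ (j.choose i : ℝ) * b * ((j - i).factorial *
        (∑ l ∈ Finset.range (j + 1), ‖iteratedFDerivWithin ℝ l g X (κ x)‖) * b ^ (j - i)) := by
        refine mul_le_mul (mul_le_mul_of_nonneg_left (hbM i hij) (by positivity)) h1
          (norm_nonneg _) (by positivity)
    _ = _ := by ring

lemma exists_bound_iteratedFDerivWithin {U K : Set E} (hU : UniqueDiffOn ℝ U) (hK : IsCompact K)
    (hKU : K ⊆ U) {f : E → F} (hf : ContDiffOn ℝ ∞ f U) (j : ℕ) :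
    ∃ b : ℝ, 1 ≤ b ∧ ∀ i ≤ j, ∀ x ∈ K, ‖iteratedFDerivWithin ℝ i f U x‖ ≤ b := by
  have h : ∀ i, ∃ b : ℝ, ∀ x ∈ K, ‖iteratedFDerivWithin ℝ i f U x‖ ≤ b := fun i =>
    hK.exists_bound_of_continuousOn
      ((hf.continuousOn_iteratedFDerivWithin (m := i) (mod_cast le_top) hU).mono hKU)
  choose b hb using h
  refine ⟨1 + ∑ i ∈ Finset.range (j + 1), |b i|, ?_, fun i hi x hx => ?_⟩
  · exact le_add_of_nonneg_right (Finset.sum_nonneg fun _ _ => abs_nonneg _)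
  · have := Finset.single_le_sum (f := fun i => |b i|) (fun _ _ => abs_nonneg _)
      (Finset.mem_range.2 (Nat.lt_succ_of_le hi))
    have h2 := (hb i x hx).trans (le_abs_self _)
    linarith

/-- Change of variables: composition with a diffeomorphism is bounded on `L²` over compact sets. -/
lemma exists_eLpNorm_comp_le {U K : Set E} (hU : UniqueDiffOn ℝ U) (hK : IsCompact K)
    (hKU : K ⊆ U) {κ κ' : E → E} {U' : Set E} (hκ : ContDiffOn ℝ ∞ κ U)
    (hκX : MapsTo κ U X) (hκU' : MapsTo κ U U') (hκ' : ContDiffOn ℝ ∞ κ' U')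
    (hinv : ∀ x ∈ U, κ' (κ x) = x) :
    ∃ C : ℝ≥0, ∀ h : E → ℝ, eLpNorm (fun x => h (κ x)) 2 (volume.restrict K) ≤
      C * eLpNorm h 2 (volume.restrict X) := by
  set A := fderivWithin ℝ κ U with hA
  -- The chain rule for `κ' ∘ κ = id` within `U` makes the Jacobian determinant invertible; on the
  -- compact set `K` its inverse is then bounded.
  have hdet : ∀ x ∈ U, (A x).det ≠ 0 := by
    intro x hx
    have h1 : HasFDerivWithinAt κ (A x) U x := (hκ.differentiableOn (by simp) x hx).hasFDerivWithinAt
    have h2 := (hκ'.differentiableOn (by simp) (κ x) (hκU' hx)).hasFDerivWithinAt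
    have h3 := (h2.comp x h1 hκU').congr (fun y hy => (hinv y hy).symm) (hinv x hx).symm
    have h4 := hU.eq hx h3 (hasFDerivWithinAt_id x U)
    have h5 : (fderivWithin ℝ κ' U' (κ x)).det * (A x).det = 1 := by
      rw [ContinuousLinearMap.det, ContinuousLinearMap.det, ← LinearMap.det_comp,
        ← ContinuousLinearMap.toLinearMap_comp, h4]
      simp
    exact right_ne_zero_of_mul_eq_one h5
  have hAc : ContinuousOn (fun x => (A x).det) U :=
    ContinuousLinearMap.continuous_det.comp_continuousOn
      (hκ.continuousOn_fderivWithin hU (by simp))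
  obtain ⟨c, hc⟩ := hK.exists_bound_of_continuousOn ((hAc.inv₀ hdet).mono hKU)
  refine ⟨(c.toNNReal) ^ (1 / 2 : ℝ), fun h => ?_⟩
  have hinj : InjOn κ K := fun x hx y hy hxy => by
    rw [← hinv x (hKU hx), hxy, hinv y (hKU hy)]
  have hcv := lintegral_image_eq_lintegral_abs_det_fderiv_mul volume hK.measurableSet
    (f := κ) (f' := A)
    (fun x hx => ((hκ.differentiableOn (by simp) x (hKU hx)).hasFDerivWithinAt).mono hKU)
    hinj fun z => ‖h z‖ₑ ^ 2
  have key : ∫⁻ x in K, ‖h (κ x)‖ₑ ^ 2 ≤ c.toNNReal * ∫⁻ z in X, ‖h z‖ₑ ^ 2 := by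
    calc _ ≤ ∫⁻ x in K, c.toNNReal * (ENNReal.ofReal |(A x).det| * ‖h (κ x)‖ₑ ^ 2) := by
          refine setLIntegral_mono' hK.measurableSet fun x hx => ?_
          have h1 : (1 : ℝ≥0∞) ≤ c.toNNReal * ENNReal.ofReal |(A x).det| := by
            have h2 := hc x hx
            have h3 : 0 < |(A x).det| := abs_pos.2 (hdet x (hKU hx))
            have h4 : 1 ≤ c * |(A x).det| := by
              rw [Pi.inv_apply, norm_inv, Real.norm_eq_abs, inv_le_iff_one_le_mul₀ h3] at h2
              exact h2
            rw [← ENNReal.ofReal_one]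
            change _ ≤ ENNReal.ofReal c * _
            rw [← ENNReal.ofReal_mul (by
              by_contra hneg
              nlinarith [not_le.1 hneg])]
            exact ENNReal.ofReal_le_ofReal h4
          rw [← mul_assoc]
          exact le_mul_of_one_le_left' h1
      _ = c.toNNReal * ∫⁻ z in κ '' K, ‖h z‖ₑ ^ 2 := by
          rw [lintegral_const_mul' _ _ ENNReal.coe_ne_top, hcv]
      _ ≤ _ := by
          gcongr
          exact (image_mono hKU).trans hκX.image_subset
  rw [eLpNorm_two_eq, eLpNorm_two_eq]
  calc _ ≤ (c.toNNReal * ∫⁻ z in X, ‖h z‖ₑ ^ 2) ^ (1 / 2 : ℝ) := by gcongr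
    _ = _ := by
      rw [ENNReal.mul_rpow_of_nonneg _ _ (by norm_num),
        ENNReal.coe_rpow_of_nonneg _ (by norm_num)]

/-- Sobolev norms are bounded under change of coordinates and multiplication by a compactly
supported smooth matrix. -/
lemma exists_derivL2_comp_clm_le (hX : IsSolidCone X) {O K : Set E} (hO : IsOpen O)
    (hK : IsCompact K) (hKU : K ⊆ X ∩ O) {κ κ' : E → E} {U' : Set E} {M : E → F →L[ℝ] F'}
    (hκ : ContDiffOn ℝ ∞ κ (X ∩ O)) (hκX : MapsTo κ (X ∩ O) X) (hκU' : MapsTo κ (X ∩ O) U')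
    (hκ' : ContDiffOn ℝ ∞ κ' U') (hinv : ∀ x ∈ X ∩ O, κ' (κ x) = x)
    (hM : ContDiffOn ℝ ∞ M (X ∩ O)) (j : ℕ) :
    ∃ C : ℝ≥0, ∀ (g : E → F) (h : E → F'), ContDiffOn ℝ ∞ g X →
      (∀ x ∈ X ∩ O, h x = M x (g (κ x))) → (∀ x ∈ X, x ∉ K → h x = 0) →
      derivL2 X j h ≤ C * ∑ l ∈ Finset.range (j + 1), derivL2 X l g := by
  have hU : UniqueDiffOn ℝ (X ∩ O) := hX.uniqueDiffOn.inter hO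
  obtain ⟨b₁, hb₁, H₁⟩ := exists_bound_iteratedFDerivWithin hU hK hKU hκ j
  obtain ⟨b₂, hb₂, H₂⟩ := exists_bound_iteratedFDerivWithin hU hK hKU hM j
  obtain ⟨C, hC⟩ := exists_eLpNorm_comp_le hU hK hKU hκ hκX hκU' hκ' hinv
  set b := max b₁ b₂
  set B : ℝ := ∑ i ∈ Finset.range (j + 1),
    (j.choose i : ℝ) * b * ((j - i).factorial * b ^ (j - i)) with hB
  have hb : 1 ≤ b := hb₁.trans (le_max_left _ _)
  have hB0 : 0 ≤ B := Finset.sum_nonneg fun i _ => by positivity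
  refine ⟨B.toNNReal * C, fun g h hg hh hhK => ?_⟩
  have hpt : ∀ x ∈ K, ‖iteratedFDerivWithin ℝ j h X x‖ ≤
      B * ∑ l ∈ Finset.range (j + 1), ‖iteratedFDerivWithin ℝ l g X (κ x)‖ := by
    intro x hx
    rw [← iteratedFDerivWithin_inter_open (s := X) hO (hKU hx).2,
      iteratedFDerivWithin_congr hh (hKU hx)]
    exact norm_iteratedFDerivWithin_comp_clm_le hU hX hκ hM hκX hg j (hKU hx) hb
      (fun i hi => (H₁ i hi x hx).trans (le_max_left _ _))
      (fun i hi => (H₂ i hi x hx).trans (le_max_right _ _))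
  have hle : derivL2 X j h ≤
      eLpNorm (fun x => ‖iteratedFDerivWithin ℝ j h X x‖) 2 (volume.restrict K) := by
    have e : derivL2 X j h = eLpNorm (K.indicator fun x => ‖iteratedFDerivWithin ℝ j h X x‖) 2
        (volume.restrict X) := by
      refine eLpNorm_restrict_congr hX fun x hx => ?_
      by_cases hxK : x ∈ K
      · simp [hxK]
      · simp [hxK, iteratedFDerivWithin_eq_zero_of_notMem hK.isClosed hhK hx hxK j]
    rw [e, ← eLpNorm_indicator_eq_eLpNorm_restrict hK.measurableSet]
    exact eLpNorm_mono_measure _ Measure.restrict_le_self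
  refine hle.trans ?_
  have hmono : eLpNorm (fun x => ‖iteratedFDerivWithin ℝ j h X x‖) 2 (volume.restrict K) ≤
      eLpNorm (B • ∑ l ∈ Finset.range (j + 1),
        fun x => ‖iteratedFDerivWithin ℝ l g X (κ x)‖) 2 (volume.restrict K) := by
    refine eLpNorm_mono_ae ((ae_restrict_iff' hK.measurableSet).2 (ae_of_all _ fun x hx => ?_))
    rw [norm_norm, Pi.smul_apply, Finset.sum_apply, smul_eq_mul]
    exact (hpt x hx).trans (le_abs_self _)
  refine hmono.trans ?_
  rw [eLpNorm_const_smul, ENNReal.coe_mul, mul_assoc, Finset.mul_sum,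
    show ‖B‖ₑ = (B.toNNReal : ℝ≥0∞) by rw [← ofReal_norm, Real.norm_of_nonneg hB0]; rfl]
  gcongr
  refine (eLpNorm_sum_le (fun l _ => ?_) (by norm_num)).trans
    (Finset.sum_le_sum fun l _ => hC fun z => ‖iteratedFDerivWithin ℝ l g X z‖)
  refine ContinuousOn.aestronglyMeasurable ?_ hK.measurableSet
  exact (((hg.continuousOn_iteratedFDerivWithin (m := l) (mod_cast le_top)
    hX.uniqueDiffOn).comp hκ.continuousOn hκX).mono hKU).norm
end Euclidean

/-! ### Local representatives of sections and their gluing. -/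

section Sections

open MeasureTheory
open scoped ENNReal NNReal

variable {n : ℕ} {H : Type*} [TopologicalSpace H]
  {I : ModelWithCorners ℝ (EuclideanSpace ℝ (Fin n)) H}
  {Z : Type*} [TopologicalSpace Z] [ChartedSpace H Z] [IsManifold I ∞ Z]
  [CompactSpace Z] [T2Space Z]
  {F : Type*} [NormedAddCommGroup F] [NormedSpace ℝ F]
  {V : Z → Type*} [TopologicalSpace (TotalSpace F V)]
  [∀ x, AddCommGroup (V x)] [∀ x, Module ℝ (V x)] [∀ x, TopologicalSpace (V x)]
  [FiberBundle F V] [VectorBundle ℝ F V] [ContMDiffVectorBundle ∞ F V I]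
lemma IsBoundaryModel.isSolidCone (hI : IsBoundaryModel I) : IsSolidCone (range I) := by
  rcases hI with h | ⟨hn, h⟩
  · rw [h]
    exact ⟨isClosed_univ, convex_univ, by simp, by simp, by simp⟩
  · rw [h]
    refine ⟨isClosed_le continuous_const (by fun_prop), ?_, ?_, ?_, ?_⟩
    · intro x hx y hy a b ha hb _
      simp only [mem_ofPred_eq, PiLp.add_apply, PiLp.smul_apply, smul_eq_mul] at *
      positivity
    · intro x y hx hy
      simp only [mem_ofPred_eq, PiLp.add_apply] at *
      positivity
    · intro t x ht hx
      simp only [mem_ofPred_eq, PiLp.smul_apply, smul_eq_mul] at *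
      positivity
    · have ho : IsOpen {y : EuclideanSpace ℝ (Fin n) | 0 < y ⟨0, hn⟩} :=
        isOpen_lt continuous_const (by fun_prop)
      refine ⟨EuclideanSpace.single ⟨0, hn⟩ 1, interior_maximal (fun y hy => ?_) ho ?_⟩
      · exact le_of_lt (by simpa using hy)
      · simp

namespace Localization

variable (A : Localization I F V)

/-- The common domain of the `i`-th chart and trivialization. -/
def dom (i : Fin A.m) : Set Z :=
  (chartAt H (A.c i)).source ∩ (trivializationAt F V (A.c i)).baseSet

lemma isOpen_dom (i : Fin A.m) : IsOpen (A.dom i) :=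
  (chartAt H (A.c i)).open_source.inter (trivializationAt F V (A.c i)).open_baseSet

variable {A}

lemma mem_extChartAt_source {i : Fin A.m} {z : Z} (hz : z ∈ A.dom i) :
    z ∈ (extChartAt I (A.c i)).source := by
  rw [extChartAt_source]
  exact hz.1

lemma tsupport_subset_dom (i : Fin A.m) : tsupport (A.ρ i) ⊆ A.dom i := A.subordinate i

lemma apply_eq_zero {i : Fin A.m} {z : Z} (hz : z ∉ tsupport (A.ρ i)) : A.ρ i z = 0 :=
  image_eq_zero_of_notMem_tsupport hz

lemma localRep_extChartAt {u : Cₛ^∞⟮I; F, V⟯} {i : Fin A.m} {z : Z} (hz : z ∈ A.dom i) :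
    A.localRep u i (extChartAt I (A.c i) z) =
      A.ρ i z • (trivializationAt F V (A.c i) ⟨z, u z⟩).2 := by
  have hz' := mem_extChartAt_source hz
  rw [localRep, indicator_of_mem ((extChartAt I (A.c i)).map_source hz'),
    (extChartAt I (A.c i)).left_inv hz']

lemma isCompact_image_extChartAt {i : Fin A.m} {T : Set Z} (hT : IsClosed T)
    (hTd : T ⊆ A.dom i) : IsCompact (extChartAt I (A.c i) '' T) :=
  hT.isCompact.image_of_continuousOn
    ((continuousOn_extChartAt (I := I) (A.c i)).mono fun _ hz => mem_extChartAt_source (hTd hz))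

lemma localRep_eq_zero (u : Cₛ^∞⟮I; F, V⟯) (i : Fin A.m) {x : EuclideanSpace ℝ (Fin n)}
    (hx : x ∉ extChartAt I (A.c i) '' tsupport (A.ρ i)) : A.localRep u i x = 0 := by
  by_cases hxt : x ∈ (extChartAt I (A.c i)).target
  · rw [localRep, indicator_of_mem hxt, apply_eq_zero fun hz =>
      hx ⟨_, hz, (extChartAt I (A.c i)).right_inv hxt⟩, zero_smul]
  · rw [localRep, indicator_of_notMem hxt]

lemma snd_trivializationAt_smul {c : Z} {z : Z} (hz : z ∈ (trivializationAt F V c).baseSet)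
    (a : ℝ) (v : V z) : (trivializationAt F V c ⟨z, a • v⟩).2 =
      a • (trivializationAt F V c ⟨z, v⟩).2 :=
  ((trivializationAt F V c).linear ℝ hz).map_smul a v

lemma localRep_sub (u v : Cₛ^∞⟮I; F, V⟯) (i : Fin A.m) (x : EuclideanSpace ℝ (Fin n)) :
    A.localRep (u - v) i x = A.localRep u i x - A.localRep v i x := by
  by_cases hxt : x ∈ (extChartAt I (A.c i)).target
  · simp only [localRep, indicator_of_mem hxt]
    set z := (extChartAt I (A.c i)).symm x
    by_cases hz : z ∈ (trivializationAt F V (A.c i)).baseSet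
    · rw [← smul_sub]
      congr 1
      exact ((trivializationAt F V (A.c i)).linear ℝ hz).map_sub (u z) (v z)
    · have : A.ρ i z = 0 := image_eq_zero_of_notMem_tsupport fun h =>
        hz (tsupport_subset_dom i h).2
      simp [this]
  · simp only [localRep, indicator_of_notMem hxt, sub_zero]

/-- The coordinate domain corresponding to `U ⊆ Z` in the `i`-th chart is relatively open. -/
def chartPreimage (A : Localization I F V) (i : Fin A.m) (U : Set Z) :
    Set (EuclideanSpace ℝ (Fin n)) :=
  I.symm ⁻¹' ((chartAt H (A.c i)).target ∩ (chartAt H (A.c i)).symm ⁻¹' U)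

lemma isOpen_chartPreimage (i : Fin A.m) {U : Set Z} (hU : IsOpen U) :
    IsOpen (A.chartPreimage i U) :=
  ((chartAt H (A.c i)).isOpen_inter_preimage_symm hU).preimage I.continuous_symm

lemma mem_chartPreimage_iff {i : Fin A.m} {U : Set Z} {x : EuclideanSpace ℝ (Fin n)} :
    x ∈ range I ∩ A.chartPreimage i U ↔
      x ∈ (extChartAt I (A.c i)).target ∧ (extChartAt I (A.c i)).symm x ∈ U := by
  rw [extChartAt_target]
  simp only [chartPreimage, mem_inter_iff, mem_preimage, extChartAt_coe_symm, Function.comp_apply]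
  tauto

lemma contMDiffOn_symm_chartPreimage (i : Fin A.m) (U : Set Z) :
    ContMDiffOn 𝓘(ℝ, EuclideanSpace ℝ (Fin n)) I ∞ (extChartAt I (A.c i)).symm
      (range I ∩ A.chartPreimage i U) :=
  (contMDiffOn_extChartAt_symm (A.c i)).mono fun _ hx => (mem_chartPreimage_iff.1 hx).1

lemma contMDiffOn_snd_trivializationAt (u : Cₛ^∞⟮I; F, V⟯) (i : Fin A.m) :
    ContMDiffOn I 𝓘(ℝ, F) ∞ (fun z => (trivializationAt F V (A.c i) ⟨z, u z⟩).2) (A.dom i) :=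
  ((trivializationAt F V (A.c i)).contMDiffOn_section_iff (A.isOpen_dom i) inter_subset_right).1
    u.contMDiff.contMDiffOn

/-- Inside the coordinate domain this is smoothness of the section; elsewhere the representative
vanishes nearby, because the image of the support of `ρᵢ` is compact, hence closed. -/
lemma contDiffOn_localRep (u : Cₛ^∞⟮I; F, V⟯) (i : Fin A.m) :
    ContDiffOn ℝ ∞ (A.localRep u i) (range I) := by
  set K := extChartAt I (A.c i) '' tsupport (A.ρ i) with hK
  have hKc : IsClosed K :=
    (isCompact_image_extChartAt (isClosed_tsupport _) (tsupport_subset_dom i)).isClosed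
  have hU : ContDiffOn ℝ ∞ (A.localRep u i) (range I ∩ A.chartPreimage i (A.dom i)) := by
    rw [← contMDiffOn_iff_contDiffOn]
    have h1 := ((A.ρ i).contMDiff.contMDiffOn (s := A.dom i)).smul
      (contMDiffOn_snd_trivializationAt u i)
    refine (h1.comp (contMDiffOn_symm_chartPreimage i (A.dom i))
      fun x hx => (mem_chartPreimage_iff.1 hx).2).congr fun x hx => ?_
    rw [localRep, indicator_of_mem (mem_chartPreimage_iff.1 hx).1]
    rfl
  intro x hx
  by_cases hxO : x ∈ A.chartPreimage i (A.dom i)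
  · exact (hU x ⟨hx, hxO⟩).mono_of_mem_nhdsWithin (inter_mem self_mem_nhdsWithin
      (mem_nhdsWithin_of_mem_nhds ((isOpen_chartPreimage i (A.isOpen_dom i)).mem_nhds hxO)))
  · have hxK : x ∉ K := by
      rintro ⟨z, hz, rfl⟩
      have hzd := tsupport_subset_dom i hz
      have hz' := mem_extChartAt_source hzd
      refine hxO (mem_chartPreimage_iff.2 ⟨(extChartAt I (A.c i)).map_source hz', ?_⟩).2
      rwa [(extChartAt I (A.c i)).left_inv hz']
    refine (contDiffWithinAt_const (c := (0 : F))).congr_of_eventuallyEq ?_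
      (localRep_eq_zero u i hxK)
    filter_upwards [mem_nhdsWithin_of_mem_nhds (hKc.isOpen_compl.mem_nhds hxK)] with y hy
    exact localRep_eq_zero u i hy

/-- Mollification spreads the support of a local representative, possibly beyond the chart. The
cut-off makes the result a section again and does not alter `ρᵢ u`. -/
lemma exists_cutoff (i : Fin A.m) : ∃ χ : C^∞⟮I, Z; 𝓘(ℝ), ℝ⟯,
    tsupport χ ⊆ A.dom i ∧ ∀ z ∈ tsupport (A.ρ i), χ z = 1 := by
  obtain ⟨W, hW, hsW, hWd⟩ := normal_exists_closure_subset (isClosed_tsupport (A.ρ i))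
    (A.isOpen_dom i) (tsupport_subset_dom i)
  obtain ⟨χ, h0, h1, -⟩ := exists_contMDiffMap_zero_one_of_isClosed I (n := ⊤) hW.isClosed_compl
    (isClosed_tsupport (A.ρ i)) (disjoint_compl_left_iff_subset.2 hsW)
  refine ⟨χ, (closure_mono fun z hz => ?_).trans hWd, h1⟩
  by_contra hzW
  exact hz (h0 hzW)

/-- The section which is `χ g` in the `i`-th chart and trivialization, extended by zero. -/
noncomputable def glue (A : Localization I F V) (i : Fin A.m) (χ : C^∞⟮I, Z; 𝓘(ℝ), ℝ⟯)
    (hχ : tsupport χ ⊆ A.dom i) (g : EuclideanSpace ℝ (Fin n) → F)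
    (hg : ContDiffOn ℝ ∞ g (range I)) : Cₛ^∞⟮I; F, V⟯ where
  toFun z := χ z • (trivializationAt F V (A.c i)).symm z (g (extChartAt I (A.c i) z))
  contMDiff_toFun := by
    refine ContMDiffOn.smul_section_of_tsupport χ.contMDiff.contMDiffOn (A.isOpen_dom i) hχ
      (s := fun z => (trivializationAt F V (A.c i)).symm z (g (extChartAt I (A.c i) z))) ?_
    refine ((trivializationAt F V (A.c i)).contMDiffOn_section_iff (A.isOpen_dom i)
      inter_subset_right).2 ?_
    have h1 : ContMDiffOn I 𝓘(ℝ, F) ∞ (g ∘ extChartAt I (A.c i)) (A.dom i) :=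
      (contMDiffOn_iff_contDiffOn.2 hg).comp ((contMDiffOn_extChartAt (I := I) (n := ∞)
        (x := A.c i)).mono inter_subset_left) fun z _ => by
          rw [extChartAt_coe]
          exact mem_range_self _
    refine h1.congr fun z hz => ?_
    rw [(trivializationAt F V (A.c i)).apply_mk_symm hz.2]
    rfl

lemma glue_apply {i : Fin A.m} {χ : C^∞⟮I, Z; 𝓘(ℝ), ℝ⟯} {hχ : tsupport χ ⊆ A.dom i}
    {g : EuclideanSpace ℝ (Fin n) → F} {hg : ContDiffOn ℝ ∞ g (range I)} (z : Z) :
    A.glue i χ hχ g hg z =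
      χ z • (trivializationAt F V (A.c i)).symm z (g (extChartAt I (A.c i) z)) := rfl

lemma glue_sub {i : Fin A.m} {χ : C^∞⟮I, Z; 𝓘(ℝ), ℝ⟯} {hχ : tsupport χ ⊆ A.dom i}
    {g g' : EuclideanSpace ℝ (Fin n) → F} {hg : ContDiffOn ℝ ∞ g (range I)}
    {hg' : ContDiffOn ℝ ∞ g' (range I)} :
    A.glue i χ hχ g hg - A.glue i χ hχ g' hg' = A.glue i χ hχ (fun x => g x - g' x) (hg.sub hg') := by
  ext z
  rw [ContMDiffSection.coe_sub, Pi.sub_apply, glue_apply, glue_apply, glue_apply, ← smul_sub]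
  by_cases hz : z ∈ (trivializationAt F V (A.c i)).baseSet
  · rw [← Trivialization.symmL_apply (R := ℝ) _ hz, ← Trivialization.symmL_apply (R := ℝ) _ hz,
      ← Trivialization.symmL_apply (R := ℝ) _ hz, map_sub]
  · have : χ z = 0 := image_eq_zero_of_notMem_tsupport fun h => hz (hχ h).2
    simp [this]

/-- Holds because `χᵢ ρᵢ = ρᵢ` and the `ρᵢ` sum to one. Operations on functions in the cone are
transferred to sections through this decomposition. -/
lemma eq_sum_glue_localRep (χ : Fin A.m → C^∞⟮I, Z; 𝓘(ℝ), ℝ⟯)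
    (hχ : ∀ i, tsupport (χ i) ⊆ A.dom i) (hχ1 : ∀ i, ∀ z ∈ tsupport (A.ρ i), χ i z = 1)
    (u : Cₛ^∞⟮I; F, V⟯) :
    u = ∑ i, A.glue i (χ i) (hχ i) (A.localRep u i) (contDiffOn_localRep u i) := by
  have key : ∀ i z, A.glue i (χ i) (hχ i) (A.localRep u i) (contDiffOn_localRep u i) z =
      A.ρ i z • u z := by
    intro i z
    rw [glue_apply]
    by_cases hz : z ∈ tsupport (A.ρ i)
    · have hzd := tsupport_subset_dom i hz
      rw [hχ1 i z hz, one_smul, localRep_extChartAt hzd, ← snd_trivializationAt_smul hzd.2,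
        Trivialization.symm_apply_apply_mk _ hzd.2]
    · rw [image_eq_zero_of_notMem_tsupport hz, zero_smul]
      by_cases hzd : z ∈ A.dom i
      · rw [localRep_extChartAt hzd, image_eq_zero_of_notMem_tsupport hz, zero_smul,
          ← Trivialization.symmL_apply (R := ℝ) _ hzd.2, map_zero, smul_zero]
      · rw [image_eq_zero_of_notMem_tsupport fun h => hzd (hχ i h), zero_smul]
  ext z
  have h1 : (∑ i, A.glue i (χ i) (hχ i) (A.localRep u i) (contDiffOn_localRep u i)) z =
      ∑ i, A.glue i (χ i) (hχ i) (A.localRep u i) (contDiffOn_localRep u i) z := by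
    have := congrFun (map_sum (ContMDiffSection.coeAddHom I F ∞ V) (fun i =>
      A.glue i (χ i) (hχ i) (A.localRep u i) (contDiffOn_localRep u i)) Finset.univ) z
    rw [Finset.sum_apply] at this
    exact this
  rw [h1]
  simp only [key]
  rw [← Finset.sum_smul, ← finsum_eq_sum_of_fintype, A.ρ.sum_eq_one (mem_univ z), one_smul]

/-- In the `k`-th chart the glued section is `g` composed with the transition map and multiplied by
`ρₖ χ` times the bundle's coordinate change, a matrix supported over the compact set `T`. -/
lemma exists_derivL2_localRep_glue_le (hI : IsSolidCone (range I)) (i k : Fin A.m)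
    (χ : C^∞⟮I, Z; 𝓘(ℝ), ℝ⟯) (hχ : tsupport χ ⊆ A.dom i) (j : ℕ) :
    ∃ C : ℝ≥0, ∀ (g : EuclideanSpace ℝ (Fin n) → F) (hg : ContDiffOn ℝ ∞ g (range I)),
      derivL2 (range I) j (A.localRep (A.glue i χ hχ g hg) k) ≤
        C * ∑ l ∈ Finset.range (j + 1), derivL2 (range I) l g := by
  set U := A.dom i ∩ A.dom k with hU
  set T := tsupport χ ∩ tsupport (A.ρ k) with hT
  set φi := extChartAt I (A.c i)
  set φk := extChartAt I (A.c k)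
  set ei := trivializationAt F V (A.c i)
  set ek := trivializationAt F V (A.c k)
  have hTU : T ⊆ U := fun z hz => ⟨hχ hz.1, tsupport_subset_dom k hz.2⟩
  have hκ : ContDiffOn ℝ ∞ (φi ∘ φk.symm) (range I ∩ A.chartPreimage k U) := by
    refine (contDiffOn_ext_coord_change (A.c i) (A.c k)).mono fun x hx => ?_
    obtain ⟨h1, h2⟩ := mem_chartPreimage_iff.1 hx
    rw [PartialEquiv.trans_source]
    exact ⟨h1, mem_extChartAt_source h2.1⟩
  have hM : ContDiffOn ℝ ∞ (fun x => (A.ρ k (φk.symm x) * χ (φk.symm x)) •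
      (ei.coordChangeL ℝ ek (φk.symm x) : F →L[ℝ] F)) (range I ∩ A.chartPreimage k U) := by
    rw [← contMDiffOn_iff_contDiffOn]
    have h1 : ContMDiffOn I 𝓘(ℝ, F →L[ℝ] F) ∞ (fun z => (A.ρ k z * χ z) •
        (ei.coordChangeL ℝ ek z : F →L[ℝ] F)) U := by
      refine ContMDiffOn.smul ((A.ρ k).contMDiff.mul χ.contMDiff).contMDiffOn ?_
      exact (contMDiffOn_coordChangeL (IB := I) (n := ∞) ei ek).mono fun z hz => ⟨hz.1.2, hz.2.2⟩
    exact h1.comp (contMDiffOn_symm_chartPreimage k U) fun x hx => (mem_chartPreimage_iff.1 hx).2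
  have hTk : φk '' T ⊆ range I ∩ A.chartPreimage k U := by
    rintro _ ⟨z, hz, rfl⟩
    have hz' : z ∈ φk.source := mem_extChartAt_source (hTU hz).2
    refine mem_chartPreimage_iff.2 ⟨φk.map_source hz', ?_⟩
    rw [φk.left_inv hz']
    exact hTU hz
  have hκX : MapsTo (φi ∘ φk.symm) (range I ∩ A.chartPreimage k U) (range I) := by
    intro x _
    rw [Function.comp_apply, extChartAt_coe]
    exact mem_range_self _
  have hκU : MapsTo (φi ∘ φk.symm) (range I ∩ A.chartPreimage k U) (φi.symm ≫ φk).source := by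
    intro x hx
    obtain ⟨h1, h2⟩ := mem_chartPreimage_iff.1 hx
    have h3 : φk.symm x ∈ φi.source := mem_extChartAt_source h2.1
    rw [PartialEquiv.trans_source]
    refine ⟨φi.map_source h3, ?_⟩
    rw [mem_preimage, Function.comp_apply, φi.left_inv h3]
    exact φk.map_target h1
  have hinv : ∀ x ∈ range I ∩ A.chartPreimage k U,
      (φk ∘ φi.symm) ((φi ∘ φk.symm) x) = x := by
    intro x hx
    obtain ⟨h1, h2⟩ := mem_chartPreimage_iff.1 hx
    have h3 : φk.symm x ∈ φi.source := mem_extChartAt_source h2.1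
    rw [Function.comp_apply, Function.comp_apply, φi.left_inv h3, φk.right_inv h1]
  obtain ⟨C, hC⟩ := exists_derivL2_comp_clm_le (F := F) (F' := F) hI
    (isOpen_chartPreimage k ((A.isOpen_dom i).inter (A.isOpen_dom k)))
    (isCompact_image_extChartAt ((isClosed_tsupport _).inter (isClosed_tsupport _))
      fun z hz => (hTU hz).2) hTk hκ hκX hκU
    (contDiffOn_ext_coord_change (A.c k) (A.c i)) hinv hM j
  refine ⟨C, fun g hg => hC g _ hg (fun x hx => ?_) fun x hx hxK => ?_⟩
  · obtain ⟨h1, h2⟩ := mem_chartPreimage_iff.1 hx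
    rw [localRep, indicator_of_mem h1, glue_apply, snd_trivializationAt_smul h2.2.2, smul_smul,
      _root_.smul_apply, ContinuousLinearEquiv.coe_coe,
      Trivialization.coordChangeL_apply _ _ ⟨h2.1.2, h2.2.2⟩]
    rfl
  · by_cases hxt : x ∈ φk.target
    · rw [localRep, indicator_of_mem hxt]
      by_cases hz : φk.symm x ∈ tsupport (A.ρ k)
      · have hzχ : φk.symm x ∉ tsupport χ := fun h =>
          hxK ⟨_, ⟨h, hz⟩, φk.right_inv hxt⟩
        rw [glue_apply, snd_trivializationAt_smul (tsupport_subset_dom k hz).2,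
          image_eq_zero_of_notMem_tsupport hzχ, zero_smul, smul_zero]
      · rw [apply_eq_zero hz, zero_smul]
    · rw [localRep, indicator_of_notMem hxt]

end Localization
end Sections

/-! ### Sobolev norms form a tame scale. -/

section Sections

open MeasureTheory
open scoped ENNReal NNReal

variable {n : ℕ} {H : Type*} [TopologicalSpace H]
  {I : ModelWithCorners ℝ (EuclideanSpace ℝ (Fin n)) H}
  {Z : Type*} [TopologicalSpace Z] [ChartedSpace H Z] [IsManifold I ∞ Z]
  [CompactSpace Z] [T2Space Z]
  {F : Type*} [NormedAddCommGroup F] [NormedSpace ℝ F] [FiniteDimensional ℝ F]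
  {V : Z → Type*} [TopologicalSpace (TotalSpace F V)]
  [∀ x, AddCommGroup (V x)] [∀ x, Module ℝ (V x)] [∀ x, TopologicalSpace (V x)]
  [FiberBundle F V] [VectorBundle ℝ F V] [ContMDiffVectorBundle ∞ F V I]
/-- Families of seminorms with the properties of Sobolev norms on smooth sections over a compact
manifold: they increase up to constants, define a complete Hausdorff topology, and admit
smoothing operators of every finite order `L`. -/
structure IsTameScale {X : Type*} [AddCommGroup X] [Module ℝ X] (N : ℕ → Seminorm ℝ X) :
    Prop where
  mono : ∀ s t, s ≤ t → ∃ C : ℝ, 0 ≤ C ∧ ∀ u, N s u ≤ C * N t u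
  smoothing : ∀ L : ℕ, ∃ S : ℝ → X → X,
    (∀ s t, t ≤ s → ∃ C : ℝ, 0 ≤ C ∧ ∀ θ, 1 ≤ θ → ∀ u, N s (S θ u) ≤ C * θ ^ (s - t) * N t u) ∧
    ∀ s t, t ≤ s → s ≤ t + L → ∃ C : ℝ, 0 ≤ C ∧ ∀ θ, 1 ≤ θ → ∀ u,
      θ ^ (s - t) * N t (u - S θ u) ≤ C * N s u
  complete : ∀ u : ℕ → X, (∀ s, ∀ ε > 0, ∃ K, ∀ i ≥ K, ∀ j ≥ K, N s (u i - u j) ≤ ε) →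
    ∃ v, ∀ s, Tendsto (fun i => N s (u i - v)) atTop (𝓝 0)
  separated : ∀ s u, N s u = 0 → u = 0

lemma exists_sum_le_mul {ι α : Type*} (T : Finset ι) {P : α → Prop} {a : ι → α → ℝ≥0∞}
    {b : α → ℝ≥0∞} (h : ∀ i ∈ T, ∃ C : ℝ≥0, ∀ x, P x → a i x ≤ C * b x) :
    ∃ C : ℝ≥0, ∀ x, P x → ∑ i ∈ T, a i x ≤ C * b x := by
  choose! C hC using h
  refine ⟨∑ i ∈ T, C i, fun x hx => ?_⟩
  rw [ENNReal.ofNNReal_finsetSum, Finset.sum_mul]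
  exact Finset.sum_le_sum fun i hi => hC i hi x hx

namespace Localization

variable {A : Localization I F V}

lemma derivL2_localRep_lt_top (hI : IsSolidCone (range I)) (u : Cₛ^∞⟮I; F, V⟯) (i : Fin A.m)
    (j : ℕ) : derivL2 (range I) j (A.localRep u i) < ⊤ :=
  derivL2_lt_top hI (contDiffOn_localRep u i)
    (isCompact_image_extChartAt (isClosed_tsupport _) (tsupport_subset_dom i))
    (fun _ _ hx => localRep_eq_zero u i hx) j

lemma sobolevNorm_eq (hI : IsSolidCone (range I)) (s : ℕ) (u : Cₛ^∞⟮I; F, V⟯) :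
    A.sobolevNorm s u = Real.sqrt (∑ i : Fin A.m, ∑ j ∈ Finset.range (s + 1),
      (derivL2 (range I) j (A.localRep u i)).toReal ^ 2) := by
  rw [sobolevNorm]
  refine congrArg _ (Finset.sum_congr rfl fun i _ => Finset.sum_congr rfl fun j _ => ?_)
  have hm := aestronglyMeasurable_iteratedFDerivWithin hI (contDiffOn_localRep u i) j
  rw [integral_eq_lintegral_of_nonneg_ae (ae_of_all _ fun _ => by positivity) (by simpa only [Pi.pow_def] using hm.pow 2),
    derivL2,
    eLpNorm_two_eq, ← ENNReal.toReal_rpow, ← Real.sqrt_eq_rpow, Real.sq_sqrt ENNReal.toReal_nonneg]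
  congr 1
  refine lintegral_congr fun x => ?_
  rw [enorm_norm, ← ofReal_norm, ENNReal.ofReal_pow (norm_nonneg _)]

lemma ofReal_sobolevNorm_le (hI : IsSolidCone (range I)) (s : ℕ) (u : Cₛ^∞⟮I; F, V⟯) :
    ENNReal.ofReal (A.sobolevNorm s u) ≤
      ∑ i : Fin A.m, ∑ j ∈ Finset.range (s + 1), derivL2 (range I) j (A.localRep u i) := by
  have h : A.sobolevNorm s u ≤ ∑ i : Fin A.m, ∑ j ∈ Finset.range (s + 1),
      (derivL2 (range I) j (A.localRep u i)).toReal := by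
    rw [sobolevNorm_eq hI]
    refine Real.sqrt_le_iff.2 ⟨Finset.sum_nonneg fun i _ => Finset.sum_nonneg fun j _ =>
      ENNReal.toReal_nonneg, le_trans (Finset.sum_le_sum fun i _ =>
        Finset.sum_sq_le_sq_sum_of_nonneg fun j _ => ENNReal.toReal_nonneg)
      (Finset.sum_sq_le_sq_sum_of_nonneg fun i _ => Finset.sum_nonneg fun j _ =>
        ENNReal.toReal_nonneg)⟩
  refine (ENNReal.ofReal_le_ofReal h).trans (le_of_eq ?_)
  rw [ENNReal.ofReal_sum_of_nonneg fun i _ => Finset.sum_nonneg fun j _ => ENNReal.toReal_nonneg]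
  refine Finset.sum_congr rfl fun i _ => ?_
  rw [ENNReal.ofReal_sum_of_nonneg fun j _ => ENNReal.toReal_nonneg]
  exact Finset.sum_congr rfl fun j _ =>
    ENNReal.ofReal_toReal (derivL2_localRep_lt_top hI u i j).ne

lemma derivL2_localRep_le (hI : IsSolidCone (range I)) {s j : ℕ} (hj : j < s + 1)
    (u : Cₛ^∞⟮I; F, V⟯) (i : Fin A.m) :
    derivL2 (range I) j (A.localRep u i) ≤ ENNReal.ofReal (A.sobolevNorm s u) := by
  rw [← ENNReal.ofReal_toReal (derivL2_localRep_lt_top hI u i j).ne, sobolevNorm_eq hI]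
  refine ENNReal.ofReal_le_ofReal (Real.le_sqrt_of_sq_le ?_)
  refine le_trans (Finset.single_le_sum (f := fun j =>
    (derivL2 (range I) j (A.localRep u i)).toReal ^ 2) (fun j _ => by positivity)
    (Finset.mem_range.2 hj)) ?_
  exact Finset.single_le_sum (f := fun i => ∑ j ∈ Finset.range (s + 1),
    (derivL2 (range I) j (A.localRep u i)).toReal ^ 2)
    (fun i _ => Finset.sum_nonneg fun j _ => by positivity) (Finset.mem_univ i)

end Localization

namespace IsSobolevNorms

variable {N : ℕ → Seminorm ℝ Cₛ^∞⟮I; F, V⟯}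

/-- Replaces the square root of a sum of squares by a plain sum in `ℝ≥0∞`, so that later estimates
need no finiteness side conditions. -/
lemma exists_localization (hI : IsSolidCone (range I)) (hN : IsSobolevNorms N) :
    ∃ A : Localization I F V, ∀ s, ∃ C : ℝ≥0,
      (∀ u, ENNReal.ofReal (N s u) ≤ C * ∑ i : Fin A.m, ∑ j ∈ Finset.range (s + 1),
        derivL2 (range I) j (A.localRep u i)) ∧
      ∀ u i j, j < s + 1 → derivL2 (range I) j (A.localRep u i) ≤ C * ENNReal.ofReal (N s u) := by
  obtain ⟨A, hA⟩ := hN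
  refine ⟨A, fun s => ?_⟩
  obtain ⟨a, b, ha, hb, h⟩ := hA s
  refine ⟨Real.toNNReal (max a⁻¹ b), fun u => ?_, fun u i j hj => ?_⟩
  · refine (ENNReal.ofReal_le_ofReal (h u).2).trans ?_
    rw [ENNReal.ofReal_mul hb.le]
    exact mul_le_mul' (ENNReal.ofReal_le_ofReal (le_max_right _ _))
      (A.ofReal_sobolevNorm_le hI s u)
  · refine (A.derivL2_localRep_le hI hj u i).trans ?_
    have h1 : A.sobolevNorm s u ≤ a⁻¹ * N s u := by
      rw [inv_mul_eq_div, le_div_iff₀ ha, mul_comm]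
      exact (h u).1
    refine (ENNReal.ofReal_le_ofReal h1).trans ?_
    rw [ENNReal.ofReal_mul (by positivity)]
    exact mul_le_mul' (ENNReal.ofReal_le_ofReal (le_max_left _ _)) le_rfl

lemma exists_le_of_ofReal_le {α : Type*} {P : α → Prop} {a b : α → ℝ} {C : ℝ≥0}
    (hb : ∀ x, P x → 0 ≤ b x)
    (h : ∀ x, P x → ENNReal.ofReal (a x) ≤ C * ENNReal.ofReal (b x)) :
    ∀ x, P x → a x ≤ C * b x := by
  intro x hx
  have := h x hx
  rw [← ENNReal.ofReal_coe_nnreal, ← ENNReal.ofReal_mul (NNReal.coe_nonneg C)] at this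
  exact (ENNReal.ofReal_le_ofReal_iff (mul_nonneg (NNReal.coe_nonneg C) (hb x hx))).1 this

lemma exists_mono (hI : IsSolidCone (range I)) (hN : IsSobolevNorms N) {s t : ℕ} (hst : s ≤ t) :
    ∃ C : ℝ, 0 ≤ C ∧ ∀ u, N s u ≤ C * N t u := by
  obtain ⟨A, hA⟩ := hN.exists_localization hI
  obtain ⟨C, hC, -⟩ := hA s
  obtain ⟨C', -, hC'⟩ := hA t
  obtain ⟨B, hB⟩ := exists_sum_le_mul (P := fun _ => True) (Finset.univ : Finset (Fin A.m))
    (a := fun i u => ∑ j ∈ Finset.range (s + 1), derivL2 (range I) j (A.localRep u i))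
    (b := fun u => ENNReal.ofReal (N t u)) fun i _ => exists_sum_le_mul _ fun j hj =>
      ⟨C', fun u _ => hC' u i j (by have := Finset.mem_range.1 hj; omega)⟩
  refine ⟨(C * B : ℝ≥0), NNReal.coe_nonneg _, fun u => exists_le_of_ofReal_le (P := fun _ => True)
    (fun u _ => apply_nonneg (N t) u) (fun u _ => ?_) u trivial⟩
  rw [ENNReal.coe_mul, mul_assoc]
  exact (hC u).trans (mul_le_mul' le_rfl (hB u trivial))

lemma map_sum_le {ι : Type*} (T : Finset ι) (p : Seminorm ℝ Cₛ^∞⟮I; F, V⟯)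
    (g : ι → Cₛ^∞⟮I; F, V⟯) :
    ENNReal.ofReal (p (∑ i ∈ T, g i)) ≤ ∑ i ∈ T, ENNReal.ofReal (p (g i)) := by
  rw [← ENNReal.ofReal_sum_of_nonneg fun i _ => apply_nonneg p _]
  exact ENNReal.ofReal_le_ofReal
    (Finset.le_sum_of_subadditive p (map_zero p).le (map_add_le_add p) T g)

lemma exists_ofReal_glue_le (hI : IsSolidCone (range I)) {A : Localization I F V} {s : ℕ}
    {C : ℝ≥0} (hC : ∀ u, ENNReal.ofReal (N s u) ≤ C * ∑ i : Fin A.m, ∑ j ∈ Finset.range (s + 1),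
      derivL2 (range I) j (A.localRep u i)) (i : Fin A.m) (χ : C^∞⟮I, Z; 𝓘(ℝ), ℝ⟯)
    (hχ : tsupport χ ⊆ A.dom i) : ∃ C : ℝ≥0, ∀ (g : EuclideanSpace ℝ (Fin n) → F)
      (hg : ContDiffOn ℝ ∞ g (range I)), ENNReal.ofReal (N s (A.glue i χ hχ g hg)) ≤
        C * ∑ l ∈ Finset.range (s + 1), derivL2 (range I) l g := by
  obtain ⟨B, hB⟩ := exists_sum_le_mul (P := fun _ => True) (Finset.univ : Finset (Fin A.m))
    (α := {g : EuclideanSpace ℝ (Fin n) → F // ContDiffOn ℝ ∞ g (range I)})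
    (a := fun k g => ∑ j ∈ Finset.range (s + 1), derivL2 (range I) j
      (A.localRep (A.glue i χ hχ g.1 g.2) k))
    (b := fun g => ∑ l ∈ Finset.range (s + 1), derivL2 (range I) l g.1)
    fun k _ => exists_sum_le_mul _ fun j hj => by
      obtain ⟨B, hB⟩ := A.exists_derivL2_localRep_glue_le hI i k χ hχ j
      refine ⟨B, fun g _ => (hB g.1 g.2).trans (mul_le_mul' le_rfl ?_)⟩
      exact Finset.sum_le_sum_of_subset (Finset.range_mono (Finset.mem_range.1 hj))
  refine ⟨C * B, fun g hg => (hC _).trans ?_⟩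
  rw [ENNReal.coe_mul, mul_assoc]
  exact mul_le_mul' le_rfl (hB ⟨g, hg⟩ trivial)

/-- The smoothing operator subtracts from `u` the glued `L`-fold mollification errors of its local
representatives at scale `ε = θ⁻¹`. The Bernstein and Jackson estimates in the cone give the two
families of bounds. -/
lemma exists_smoothing (hI : IsSolidCone (range I)) (hN : IsSobolevNorms N) (L : ℕ) :
    ∃ S : ℝ → Cₛ^∞⟮I; F, V⟯ → Cₛ^∞⟮I; F, V⟯,
    (∀ s t, t ≤ s → ∃ C : ℝ, 0 ≤ C ∧ ∀ θ, 1 ≤ θ → ∀ u, N s (S θ u) ≤ C * θ ^ (s - t) * N t u) ∧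
    ∀ s t, t ≤ s → s ≤ t + L → ∃ C : ℝ, 0 ≤ C ∧ ∀ θ, 1 ≤ θ → ∀ u,
      θ ^ (s - t) * N t (u - S θ u) ≤ C * N s u := by
  obtain ⟨A, hA⟩ := hN.exists_localization hI
  obtain ⟨k, hk⟩ := exists_isMollifier hI
  choose χ hχ hχ1 using A.exists_cutoff
  have : CompleteSpace F := FiniteDimensional.complete ℝ F
  let r (θ : {θ : ℝ // 0 < θ}) (u : Cₛ^∞⟮I; F, V⟯) (i : Fin A.m) : EuclideanSpace ℝ (Fin n) → F :=
    (mollifyRem (range I) k θ.1⁻¹)^[L] (A.localRep u i)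
  have hr : ∀ θ u i, ContDiffOn ℝ ∞ (r θ u i) (range I) := fun θ u i =>
    contDiffOn_mollifyRem_iterate hI hk (inv_pos.2 θ.2) (A.contDiffOn_localRep u i) L
  let S' (θ : {θ : ℝ // 0 < θ}) (u : Cₛ^∞⟮I; F, V⟯) : Cₛ^∞⟮I; F, V⟯ :=
    u - ∑ i, A.glue i (χ i) (hχ i) (r θ u i) (hr θ u i)
  -- By definition `u - S' θ u` is the sum of glued remainders, as the error bound requires; this
  -- second form serves the growth bound.
  have hS' : ∀ θ u, S' θ u = ∑ i, A.glue i (χ i) (hχ i) (fun x => A.localRep u i x - r θ u i x)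
      ((A.contDiffOn_localRep u i).sub (hr θ u i)) := by
    intro θ u
    simp only [S']
    nth_rewrite 1 [A.eq_sum_glue_localRep χ hχ hχ1 u]
    rw [← Finset.sum_sub_distrib]
    exact Finset.sum_congr rfl fun i _ => Localization.glue_sub
  have hpos : ∀ θ : ℝ, 1 ≤ θ → 0 < θ := fun θ h => by linarith
  -- The value for `θ ≤ 0` is arbitrary, as only `θ ≥ 1` is estimated.
  refine ⟨fun θ u => if h : 0 < θ then S' ⟨θ, h⟩ u else 0, fun s t hts => ?_, fun s t hts hsL => ?_⟩
  · obtain ⟨C, hC, -⟩ := hA s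
    obtain ⟨C', -, hC'⟩ := hA t
    obtain ⟨B, hB⟩ := exists_sum_le_mul (Finset.univ : Finset (Fin A.m))
      (P := fun x : {θ : ℝ // 0 < θ} × Cₛ^∞⟮I; F, V⟯ => 1 ≤ x.1.1)
      (a := fun i x => ENNReal.ofReal (N s (A.glue i (χ i) (hχ i)
        (fun y => A.localRep x.2 i y - r x.1 x.2 i y)
        ((A.contDiffOn_localRep x.2 i).sub (hr x.1 x.2 i)))))
      (b := fun x => ENNReal.ofReal (x.1.1 ^ (s - t) * N t x.2)) fun i _ => by
        obtain ⟨B, hB⟩ := exists_ofReal_glue_le hI hC i (χ i) (hχ i)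
        obtain ⟨B', hB'⟩ := exists_sum_le_mul (Finset.range (s + 1))
          (P := fun x : {θ : ℝ // 0 < θ} × Cₛ^∞⟮I; F, V⟯ => 1 ≤ x.1.1)
          (a := fun l x => derivL2 (range I) l (fun y => A.localRep x.2 i y - r x.1 x.2 i y))
          (b := fun x => ENNReal.ofReal (x.1.1 ^ (s - t) * N t x.2)) fun l hl => by
            -- Of `l` derivatives at most `t` stay on `u`; the excess goes to the kernel and costs
            -- `θ ^ (l - t)`.
            obtain ⟨D, hD, H⟩ := exists_derivL2_sub_mollifyRem_iterate_le hI hk L (l - t) (min l t)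
            refine ⟨Real.toNNReal D * C', fun x hx => ?_⟩
            have h1 := H F x.1.1⁻¹ (inv_pos.2 x.1.2) _ (A.contDiffOn_localRep x.2 i)
            rw [show l - t + min l t = l by omega] at h1
            refine h1.trans ((mul_le_mul' le_rfl (hC' x.2 i (min l t) (by omega))).trans ?_)
            rw [inv_inv, ENNReal.ofReal_mul hD, ENNReal.ofReal_mul (by positivity), ENNReal.coe_mul,
              ENNReal.ofReal]
            have h2 : ENNReal.ofReal (x.1.1 ^ (l - t)) ≤ ENNReal.ofReal (x.1.1 ^ (s - t)) :=
              ENNReal.ofReal_le_ofReal (pow_le_pow_right₀ hx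
                (by have := Finset.mem_range.1 hl; omega))
            calc (D.toNNReal : ℝ≥0∞) * ENNReal.ofReal (x.1.1 ^ (l - t)) *
                  (C' * ENNReal.ofReal (N t x.2))
                = D.toNNReal * C' * (ENNReal.ofReal (x.1.1 ^ (l - t)) *
                  ENNReal.ofReal (N t x.2)) := by ring
              _ ≤ _ := mul_le_mul' le_rfl (mul_le_mul' h2 le_rfl)
        refine ⟨B * B', fun x hx => (hB _ _).trans ?_⟩
        rw [ENNReal.coe_mul, mul_assoc]
        exact mul_le_mul' le_rfl (hB' x hx)
    refine ⟨B, B.2, fun θ hθ u => ?_⟩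
    beta_reduce
    rw [dif_pos (hpos θ hθ), mul_assoc]
    refine exists_le_of_ofReal_le (P := fun x : {θ : ℝ // 0 < θ} × Cₛ^∞⟮I; F, V⟯ => 1 ≤ x.1.1)
      (a := fun x => N s (S' x.1 x.2)) (b := fun x => x.1.1 ^ (s - t) * N t x.2) (C := B)
      (fun x hx => mul_nonneg (pow_nonneg x.1.2.le _) (apply_nonneg _ _)) (fun x hx => ?_)
      (⟨θ, hpos θ hθ⟩, u) hθ
    rw [hS']
    exact (map_sum_le _ _ _).trans (hB x hx)
  · obtain ⟨C, hC, -⟩ := hA t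
    obtain ⟨C', -, hC'⟩ := hA s
    obtain ⟨B, hB⟩ := exists_sum_le_mul (Finset.univ : Finset (Fin A.m))
      (P := fun x : {θ : ℝ // 0 < θ} × Cₛ^∞⟮I; F, V⟯ => 1 ≤ x.1.1)
      (a := fun i x => ENNReal.ofReal (N t (A.glue i (χ i) (hχ i) (r x.1 x.2 i) (hr x.1 x.2 i))))
      (b := fun x => ENNReal.ofReal (x.1.1⁻¹ ^ (s - t) * N s x.2)) fun i _ => by
        obtain ⟨B, hB⟩ := exists_ofReal_glue_le hI hC i (χ i) (hχ i)
        obtain ⟨B', hB'⟩ := exists_sum_le_mul (Finset.range (t + 1))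
          (P := fun x : {θ : ℝ // 0 < θ} × Cₛ^∞⟮I; F, V⟯ => 1 ≤ x.1.1)
          (a := fun l x => derivL2 (range I) l (r x.1 x.2 i))
          (b := fun x => ENNReal.ofReal (x.1.1⁻¹ ^ (s - t) * N s x.2)) fun l hl => by
            obtain ⟨D, hD, H⟩ := exists_derivL2_mollifyRem_iterate_le_pow_of_le hI hk
              (show s - t ≤ L by omega) l
            refine ⟨Real.toNNReal D * C', fun x hx => ?_⟩
            have h1 := H F x.1.1⁻¹ (inv_pos.2 x.1.2) _ (A.contDiffOn_localRep x.2 i)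
            refine h1.trans ((mul_le_mul' le_rfl (hC' x.2 i (l + (s - t))
              (by have := Finset.mem_range.1 hl; omega))).trans (le_of_eq ?_))
            have h0 := inv_pos.2 x.1.2
            rw [ENNReal.ofReal_mul hD, ENNReal.ofReal_mul (by positivity), ENNReal.coe_mul,
              ENNReal.ofReal]
            ring
        refine ⟨B * B', fun x hx => (hB _ _).trans ?_⟩
        rw [ENNReal.coe_mul, mul_assoc]
        exact mul_le_mul' le_rfl (hB' x hx)
    refine ⟨B, B.2, fun θ hθ u => ?_⟩
    have h0 := hpos θ hθ
    have h1 := exists_le_of_ofReal_le (P := fun x : {θ : ℝ // 0 < θ} × Cₛ^∞⟮I; F, V⟯ => 1 ≤ x.1.1)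
      (a := fun x => N t (x.2 - S' x.1 x.2)) (b := fun x => x.1.1⁻¹ ^ (s - t) * N s x.2) (C := B)
      (fun x hx => mul_nonneg (pow_nonneg (inv_pos.2 x.1.2).le _) (apply_nonneg _ _))
      (fun x hx => by
        simp only [S', sub_sub_cancel]
        exact (map_sum_le _ _ _).trans (hB x hx)) (⟨θ, h0⟩, u) hθ
    beta_reduce
    rw [dif_pos h0]
    refine (mul_le_mul_of_nonneg_left h1 (by positivity)).trans (le_of_eq ?_)
    have h2 : θ ^ (s - t) * θ⁻¹ ^ (s - t) = 1 := by rw [← mul_pow, mul_inv_cancel₀ h0.ne', one_pow]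
    linear_combination (B * N s u) * h2

/-- By the Sobolev inequality all derivatives of the local representatives are uniformly Cauchy.
Their smooth limits are glued; since the representatives share a compact support, uniform
convergence of derivatives gives convergence in `L²`, and the gluing estimate returns to the norms
`N s`. -/
lemma exists_limit (hI : IsSolidCone (range I)) (hN : IsSobolevNorms N) (u : ℕ → Cₛ^∞⟮I; F, V⟯)
    (hu : ∀ s, ∀ ε > 0, ∃ K, ∀ i ≥ K, ∀ j ≥ K, N s (u i - u j) ≤ ε) :
    ∃ v, ∀ s, Tendsto (fun i => N s (u i - v)) atTop (𝓝 0) := by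
  obtain ⟨A, hA⟩ := hN.exists_localization hI
  choose χ hχ hχ1 using A.exists_cutoff
  have : CompleteSpace F := FiniteDimensional.complete ℝ F
  have hcauchy : ∀ k, UniformCauchyDerivs (range I) fun i => A.localRep (u i) k := by
    intro k l ε hε
    obtain ⟨C, hC⟩ := exists_enorm_iteratedFDerivWithin_le_sum_derivL2 hI l
    set m := Module.finrank ℝ (EuclideanSpace ℝ (Fin n)) + 2
    obtain ⟨C', -, hC'⟩ := hA (m + l)
    obtain ⟨B, hB⟩ := exists_sum_le_mul (P := fun _ => True) (Finset.range m)
      (a := fun p u => derivL2 (range I) (p + l) (A.localRep u k))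
      (b := fun u => ENNReal.ofReal (N (m + l) u)) fun p hp =>
        ⟨C', fun u _ => hC' u k (p + l) (by have := Finset.mem_range.1 hp; omega)⟩
    have hc : (0 : ℝ) < (C * B : ℝ≥0) + 1 := by positivity
    obtain ⟨K, hK⟩ := hu (m + l) (ε / ((C * B : ℝ≥0) + 1)) (by positivity)
    refine ⟨K, fun i hi j hj x hx => ?_⟩
    have h1 := hC F _ (A.contDiffOn_localRep (u i - u j) k) x hx
    have h2 : ENNReal.ofReal ‖iteratedFDerivWithin ℝ l (A.localRep (u i - u j) k) (range I) x‖ ≤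
        (C * B : ℝ≥0) * ENNReal.ofReal (N (m + l) (u i - u j)) := by
      rw [ofReal_norm, ENNReal.coe_mul, mul_assoc]
      exact h1.trans (mul_le_mul' le_rfl (hB _ trivial))
    have h3 := exists_le_of_ofReal_le (P := fun _ : Unit => True) (a := fun _ =>
      ‖iteratedFDerivWithin ℝ l (A.localRep (u i - u j) k) (range I) x‖)
      (b := fun _ => N (m + l) (u i - u j)) (fun _ _ => apply_nonneg _ _) (fun _ _ => h2) () trivial
    rw [show (fun x => A.localRep (u i) k x - A.localRep (u j) k x) = A.localRep (u i - u j) k from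
      funext fun x => (A.localRep_sub _ _ _ _).symm]
    refine h3.trans ?_
    calc ((C * B : ℝ≥0) : ℝ) * N (m + l) (u i - u j)
        ≤ ((C * B : ℝ≥0) + 1) * (ε / ((C * B : ℝ≥0) + 1)) :=
          mul_le_mul (by linarith) (hK i hi j hj) (apply_nonneg _ _) hc.le
      _ = ε := mul_div_cancel₀ _ hc.ne'
  choose g hg hlim hunif using fun k => (hcauchy k).exists_limit hI
    fun i => A.contDiffOn_localRep (u i) k
  refine ⟨∑ k, A.glue k (χ k) (hχ k) (g k) (hg k), fun s => ?_⟩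
  obtain ⟨C, hC, -⟩ := hA s
  choose B hB using fun k => exists_ofReal_glue_le hI hC k (χ k) (hχ k)
  have hd : ∀ k l, Tendsto (fun i => derivL2 (range I) l
      (fun x => A.localRep (u i) k x - g k x)) atTop (𝓝 0) := by
    intro k l
    have hcpt := A.isCompact_image_extChartAt (isClosed_tsupport _) (A.tsupport_subset_dom k)
    set T := extChartAt I (A.c k) '' tsupport (A.ρ k)
    -- The pointwise limit inherits the vanishing outside the compact set `T`.
    have hgz : ∀ x ∈ range I, x ∉ T → g k x = 0 := fun x hx hxT =>
      tendsto_nhds_unique (hlim k x hx) (by simp [A.localRep_eq_zero _ _ hxT])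
    have hvol : volume T ^ (1 / 2 : ℝ) ≠ ⊤ :=
      (ENNReal.rpow_lt_top_of_nonneg (by norm_num) hcpt.measure_ne_top).ne
    rw [ENNReal.tendsto_atTop_zero]
    intro ε hε
    obtain ⟨c, hc, hcε⟩ : ∃ c : ℝ, 0 < c ∧ volume T ^ (1 / 2 : ℝ) * ENNReal.ofReal c ≤ ε := by
      have h1 : Tendsto (fun c : ℝ => volume T ^ (1 / 2 : ℝ) * ENNReal.ofReal c) (𝓝[>] 0)
          (𝓝 (volume T ^ (1 / 2 : ℝ) * ENNReal.ofReal 0)) :=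
        (ENNReal.Tendsto.const_mul (ENNReal.tendsto_ofReal (tendsto_id.mono_left
          nhdsWithin_le_nhds)) (Or.inr hvol))
      rw [ENNReal.ofReal_zero, mul_zero] at h1
      obtain ⟨c, h2, h3⟩ := ((h1.eventually_le_const hε).and self_mem_nhdsWithin).exists
      exact ⟨c, h3, h2⟩
    obtain ⟨K, hK⟩ := hunif k l c hc
    exact ⟨K, fun i hi => (derivL2_le_of_norm_le hI hcpt (fun x hx hxT => by
      rw [A.localRep_eq_zero _ _ hxT, hgz x hx hxT, sub_zero]) (hK i hi)).trans hcε⟩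
  have hsum : Tendsto (fun i => ∑ k, B k * ∑ l ∈ Finset.range (s + 1), derivL2 (range I) l
      (fun x => A.localRep (u i) k x - g k x)) atTop (𝓝 0) := by
    have := tendsto_finsetSum Finset.univ fun k (_ : k ∈ Finset.univ) =>
      ENNReal.Tendsto.const_mul (a := (B k : ℝ≥0∞)) (tendsto_finsetSum (Finset.range (s + 1))
        fun l (_ : l ∈ Finset.range (s + 1)) => hd k l) (Or.inr ENNReal.coe_ne_top)
    simpa using this
  have hN0 : Tendsto (fun i => ENNReal.ofReal (N s (u i -
      ∑ k, A.glue k (χ k) (hχ k) (g k) (hg k)))) atTop (𝓝 0) := by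
    refine tendsto_of_tendsto_of_tendsto_of_le_of_le tendsto_const_nhds hsum
      (fun _ => zero_le) fun i => ?_
    have h1 : u i - ∑ k, A.glue k (χ k) (hχ k) (g k) (hg k) = ∑ k, A.glue k (χ k) (hχ k)
        (fun x => A.localRep (u i) k x - g k x) ((A.contDiffOn_localRep (u i) k).sub (hg k)) := by
      nth_rewrite 1 [A.eq_sum_glue_localRep χ hχ hχ1 (u i)]
      rw [← Finset.sum_sub_distrib]
      exact Finset.sum_congr rfl fun i _ => Localization.glue_sub
    simp only [h1]
    exact (map_sum_le _ _ _).trans (Finset.sum_le_sum fun k _ => hB k _ _)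
  have := (ENNReal.tendsto_toReal ENNReal.zero_ne_top).comp hN0
  simpa [Function.comp_def, ENNReal.toReal_ofReal, apply_nonneg] using this

lemma eq_zero_of_eq_zero (hI : IsSolidCone (range I)) (hN : IsSobolevNorms N) {s : ℕ}
    {u : Cₛ^∞⟮I; F, V⟯} (hu : N s u = 0) : u = 0 := by
  obtain ⟨A, hA⟩ := hN.exists_localization hI
  choose χ hχ hχ1 using A.exists_cutoff
  obtain ⟨C, -, hC⟩ := hA s
  rw [A.eq_sum_glue_localRep χ hχ hχ1 u]
  refine Finset.sum_eq_zero fun i _ => ?_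
  have h0 := eqOn_zero_of_derivL2_zero hI (A.contDiffOn_localRep u i).continuousOn
    (by simpa [hu] using hC u i 0 (by omega))
  rw [← sub_self (A.glue i (χ i) (hχ i) (A.localRep u i) (A.contDiffOn_localRep u i)),
    Localization.glue_sub]
  ext z
  rw [Localization.glue_apply, Localization.glue_apply, sub_self, h0 _ (by
    rw [extChartAt_coe]; exact mem_range_self _)]

lemma isTameScale (hI : IsSolidCone (range I)) (hN : IsSobolevNorms N) : IsTameScale N :=
  ⟨fun _ _ h => hN.exists_mono hI h, hN.exists_smoothing hI, hN.exists_limit hI,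
    fun _ _ h => hN.eq_zero_of_eq_zero hI h⟩

end IsSobolevNorms
end Sections

/-! ### Abstract tame scales: mean value inequality, Taylor estimate, interpolation. -/

section Iteration

variable {X Y : Type*} [AddCommGroup X] [Module ℝ X] [AddCommGroup Y] [Module ℝ Y]
  {NX : ℕ → Seminorm ℝ X} {NY : ℕ → Seminorm ℝ Y}
-- Hahn–Banach for a seminorm, from the line through `w`. Such a functional reduces the mean value
-- inequality in `Y` to the scalar mean value theorem.
lemma exists_linear_le_seminorm (p : Seminorm ℝ Y) (w : Y) :
    ∃ l : Y →ₗ[ℝ] ℝ, l w = p w ∧ ∀ y, l y ≤ p y := by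
  by_cases hw : w = 0
  · exact ⟨0, by simp [hw], fun y => by simp⟩
  let m : Y →ₗ.[ℝ] ℝ := LinearPMap.mkSpanSingleton w (p w) hw
  have hle : ∀ x : m.domain, m x ≤ p x := by
    rintro ⟨x, hx⟩
    obtain ⟨c, rfl⟩ := Submodule.mem_span_singleton.1 hx
    simp only [m, LinearPMap.mkSpanSingleton, LinearPMap.mkSpanSingleton'_apply, map_smul_eq_mul, smul_eq_mul, Real.norm_eq_abs]
    exact mul_le_mul_of_nonneg_right (le_abs_self c) (apply_nonneg _ _)
  obtain ⟨g, hg, hgp⟩ := exists_extension_of_le_sublinear m p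
    (fun c hc x => by rw [map_smul_eq_mul, Real.norm_of_nonneg hc.le]) (map_add_le_add p) hle
  refine ⟨g, ?_, hgp⟩
  have := hg ⟨w, Submodule.mem_span_singleton_self w⟩
  simp only [m, LinearPMap.mkSpanSingleton_apply] at this
  exact this

/-- The mean value inequality for Gateaux derivatives, in a seminorm. -/
lemma HasDerivativeAt.map_sub_sub_le {f : X → Y} {f' : X → X →ₗ[ℝ] Y} {u v : X} {s : ℕ} {c : Y}
    {B : ℝ} (hf : ∀ t ∈ Icc (0 : ℝ) 1, HasDerivativeAt NY f (f' (u + t • v)) (u + t • v))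
    (hB : ∀ t ∈ Icc (0 : ℝ) 1, NY s (f' (u + t • v) v - c) ≤ B) :
    NY s (f (u + v) - f u - c) ≤ B := by
  obtain ⟨l, hl, hle⟩ := exists_linear_le_seminorm (NY s) (f (u + v) - f u - c)
  have habs : ∀ y, |l y| ≤ NY s y := fun y => abs_le'.2 ⟨hle y, by
    rw [← map_neg l, ← map_neg_eq_map (NY s)]
    exact hle _⟩
  have hd : ∀ t ∈ Icc (0 : ℝ) 1, HasDerivAt (fun t : ℝ => l (f (u + t • v)))
      (l (f' (u + t • v) v)) t := by
    intro t ht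
    rw [hasDerivAt_iff_tendsto_slope_zero, tendsto_iff_norm_sub_tendsto_zero]
    -- Since `l` is dominated by the seminorm, Gateaux convergence along the segment becomes
    -- ordinary differentiability of a real function.
    refine squeeze_zero (fun _ => norm_nonneg _) (fun r => ?_) (hf t ht v s)
    refine le_trans (le_of_eq ?_) (habs _)
    rw [Real.norm_eq_abs, map_sub, map_smul, map_sub, add_smul, add_assoc]
  obtain ⟨r, hr, hrl⟩ := exists_hasDerivAt_eq_slope _ _ zero_lt_one
    (fun t ht => (hd t ht).continuousAt.continuousWithinAt) fun t ht => hd t (Ioo_subset_Icc_self ht)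
  simp only [one_smul, zero_smul, add_zero, sub_zero, div_one] at hrl
  rw [← hl, map_sub, map_sub, ← hrl, ← map_sub]
  exact (hle _).trans (hB r (Ioo_subset_Icc_self hr))

/-- The hypotheses of the Nash-Moser theorem, for a map `φ` between spaces with families of
seminorms. -/
structure IsTamelyInvertible (NX : ℕ → Seminorm ℝ X) (NY : ℕ → Seminorm ℝ Y) (d : ℕ) (M : ℝ)
    (C : ℕ → ℝ) (δ : ℝ) (u₀ : X) (φ : X → Y) (φ' : X → X →ₗ[ℝ] Y) (φ'' : X → X →ₗ[ℝ] X →ₗ[ℝ] Y)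
    (ψ : X → Y → X) (ℰ : X → Y → Y → Y) : Prop where
  hasDeriv : ∀ u, NX (3 * d) (u - u₀) < δ → HasDerivativeAt NY φ (φ' u) u
  hasDeriv₂ : ∀ u, NX (3 * d) (u - u₀) < δ → ∀ v,
    HasDerivativeAt NY (fun u' => φ' u' v) (φ'' u v) u
  map_le : ∀ u, NX (3 * d) (u - u₀) < δ → ∀ s, d ≤ s → NY s (φ u) ≤ C s * (1 + NX (s + d) u)
  deriv_le : ∀ u, NX (3 * d) (u - u₀) < δ → ∀ v, NY (2 * d) (φ' u v) ≤ M * NX (3 * d) v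
  deriv₂_le : ∀ u, NX (3 * d) (u - u₀) < δ → ∀ v w,
    NY (2 * d) (φ'' u v w) ≤ M * NX (3 * d) v * NX (3 * d) w
  deriv_inverse : ∀ u, NX (3 * d) (u - u₀) < δ → ∀ f, φ' u (ψ u f) = f + ℰ u (φ u) f
  error_le : ∀ u, NX (3 * d) (u - u₀) < δ → ∀ f g,
    NY (2 * d) (ℰ u f g) ≤ M * NY (3 * d) f * NY (3 * d) g
  inverse_le : ∀ u, NX (3 * d) (u - u₀) < δ → ∀ f, ∀ s, d ≤ s →
    NX s (ψ u f) ≤ C s * (NY (s + d) f + NX (s + d) u * NY (2 * d) f)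

namespace IsTamelyInvertible

variable {d : ℕ} {M : ℝ} {C : ℕ → ℝ} {δ : ℝ} {u₀ : X} {φ : X → Y} {φ' : X → X →ₗ[ℝ] Y}
  {φ'' : X → X →ₗ[ℝ] X →ₗ[ℝ] Y} {ψ : X → Y → X} {ℰ : X → Y → Y → Y}

lemma segment_mem {p : Seminorm ℝ X} {u v : X} (hu : p (u - u₀) < δ) (hv : p (u + v - u₀) < δ)
    {t : ℝ} (ht : t ∈ Icc (0 : ℝ) 1) : p (u + t • v - u₀) < δ := by
  have := (p.convex_ball u₀ δ).add_smul_sub_mem (p.mem_ball.2 hu) (p.mem_ball.2 hv) ht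
  rwa [add_sub_cancel_left] at this

lemma map_sub_le (h : IsTamelyInvertible NX NY d M C δ u₀ φ φ' φ'' ψ ℰ) {u v : X}
    (hu : NX (3 * d) (u - u₀) < δ) (hv : NX (3 * d) (u + v - u₀) < δ) :
    NY (2 * d) (φ (u + v) - φ u) ≤ M * NX (3 * d) v := by
  have := HasDerivativeAt.map_sub_sub_le (NY := NY) (s := 2 * d) (c := 0) (u := u) (v := v)
    (fun t ht => h.hasDeriv _ (segment_mem hu hv ht))
    (fun t ht => (sub_zero (φ' (u + t • v) v)).symm ▸ h.deriv_le _ (segment_mem hu hv ht) v)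
  rwa [sub_zero] at this

/-- The mean value inequality is used twice: for `φ` with `φ' u v` subtracted, and then for `u' ↦ φ'
u' v` on the shorter segment to bound the variation of the derivative. Convexity of the ball keeps
both segments in the domain. -/
lemma taylor_le (h : IsTamelyInvertible NX NY d M C δ u₀ φ φ' φ'' ψ ℰ) {u v : X}
    (hu : NX (3 * d) (u - u₀) < δ) (hv : NX (3 * d) (u + v - u₀) < δ) :
    NY (2 * d) (φ (u + v) - φ u - φ' u v) ≤ M * NX (3 * d) v ^ 2 := by
  refine HasDerivativeAt.map_sub_sub_le (fun t ht => h.hasDeriv _ (segment_mem hu hv ht))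
    fun t ht => ?_
  have hseg : ∀ r ∈ Icc (0 : ℝ) 1, NX (3 * d) (u + r • t • v - u₀) < δ := fun r hr =>
    segment_mem hu (segment_mem hu hv ht) hr
  have := HasDerivativeAt.map_sub_sub_le (NY := NY) (s := 2 * d) (c := 0) (u := u) (v := t • v)
    (f := fun u' => φ' u' v) (f' := fun u' => φ'' u' v) (B := M * NX (3 * d) v ^ 2)
    (fun r hr => h.hasDeriv₂ _ (hseg r hr) v) (fun r hr => ?_)
  · rwa [sub_zero] at this
  · rw [sub_zero, map_smul, map_smul_eq_mul, Real.norm_of_nonneg ht.1]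
    calc t * NY (2 * d) (φ'' (u + r • t • v) v v)
        ≤ 1 * NY (2 * d) (φ'' (u + r • t • v) v v) :=
          mul_le_mul_of_nonneg_right ht.2 (apply_nonneg _ _)
      _ ≤ M * NX (3 * d) v ^ 2 := by
          rw [one_mul, sq, ← mul_assoc]
          exact h.deriv₂_le _ (hseg r hr) v v

/-- The quadratic estimate of a Newton step with `ψ(u) φ(u)` replaced by `v`. -/
lemma map_newton_le (h : IsTamelyInvertible NX NY d M C δ u₀ φ φ' φ'' ψ ℰ) {u v : X}
    (hu : NX (3 * d) (u - u₀) < δ) (hv : NX (3 * d) (u - v - u₀) < δ) :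
    NY (2 * d) (φ (u - v)) ≤ M * NY (3 * d) (φ u) ^ 2 + M * NX (3 * d) (ψ u (φ u) - v) +
      M * NX (3 * d) v ^ 2 := by
  have h1 := h.taylor_le (v := -v) hu (by rwa [← sub_eq_add_neg])
  rw [← sub_eq_add_neg, map_neg_eq_map (NX (3 * d))] at h1
  have h2 := h.deriv_le u hu (ψ u (φ u) - v)
  have h3 := h.error_le u hu (φ u) (φ u)
  -- The three summands are the Taylor remainder, the effect of replacing the exact Newton step by
  -- `v`, and the defect of the approximate inverse.
  have h4 : φ (u - v) = (φ (u - v) - φ u - φ' u (-v)) + (φ' u (ψ u (φ u) - v) +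
      -ℰ u (φ u) (φ u)) := by
    rw [map_sub, h.deriv_inverse u hu, map_neg]
    abel
  rw [h4]
  refine (map_add_le_add _ _ _).trans ?_
  have h5 := map_add_le_add (NY (2 * d)) (φ' u (ψ u (φ u) - v)) (-ℰ u (φ u) (φ u))
  rw [map_neg_eq_map] at h5
  rw [sq (NY (3 * d) (φ u)), ← mul_assoc]
  linarith

end IsTamelyInvertible

/-- Split `u` into `S θ u`, controlled by the low norm, and `u - S θ u`, controlled by the high
norm. The free parameter `θ` replaces the usual product form of the inequality. -/
lemma IsTameScale.exists_interpolation (hN : IsTameScale NX) {t r s : ℕ} (htr : t ≤ r)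
    (hrs : r ≤ s) : ∃ C : ℝ, 0 ≤ C ∧ ∀ θ, 1 ≤ θ → ∀ u,
      θ ^ (s - r) * NX r u ≤ C * (θ ^ (s - t) * NX t u + NX s u) := by
  obtain ⟨S, hS, hS'⟩ := hN.smoothing (s - r)
  obtain ⟨C, hC, h⟩ := hS r t htr
  obtain ⟨C', hC', h'⟩ := hS' s r hrs (by omega)
  refine ⟨max C C', le_max_of_le_left hC, fun θ hθ u => ?_⟩
  have h1 := map_add_le_add (NX r) (S θ u) (u - S θ u)
  rw [add_sub_cancel] at h1
  have h2 := h θ hθ u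
  have h3 := h' θ hθ u
  have h0 : 0 ≤ NX t u := apply_nonneg _ _
  have h0' : 0 ≤ NX s u := apply_nonneg _ _
  have hθ' : 0 ≤ θ ^ (s - r) := by positivity
  calc θ ^ (s - r) * NX r u ≤ θ ^ (s - r) * (C * θ ^ (r - t) * NX t u) +
        θ ^ (s - r) * NX r (u - S θ u) := by
        rw [← mul_add]
        exact mul_le_mul_of_nonneg_left (by linarith) hθ'
    _ ≤ C * (θ ^ (s - t) * NX t u) + C' * NX s u := by
        rw [show s - t = s - r + (r - t) by omega, pow_add]
        linarith
    _ ≤ max C C' * (θ ^ (s - t) * NX t u) + max C C' * NX s u := by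
        gcongr
        · exact le_max_left _ _
        · exact le_max_right _ _
    _ = _ := by ring
end Iteration

/-! ### Quantitative control of the Newton iteration. -/

section Iteration

variable {X Y : Type*} [AddCommGroup X] [Module ℝ X] [AddCommGroup Y] [Module ℝ Y]
  {NX : ℕ → Seminorm ℝ X} {NY : ℕ → Seminorm ℝ Y}
-- Bookkeeping in powers of `q`, the cost of `d` derivatives. For `f = φ(u)` and `p = ψ(u) φ(u)`,
-- interpolation gives `f` the sizes q⁻⁹ and q⁻⁸ at orders `3d` and `4d`; the tame bounds give `p`
-- the sizes q⁶ and q⁻⁸ at orders `25d` and `3d`. Smoothing then yields q⁸ at `27d`, q⁻⁸ at `3d`,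
-- q⁻⁷ at `4d`, and an error q⁶ · q⁻²² = q⁻¹⁶ at `3d`, which is why smoothing of order `22d` is
-- used.
lemma exists_newton_step_bounds (hX : IsTameScale NX) (hY : IsTameScale NY) {S : ℝ → X → X}
    {d : ℕ} {M K₀ : ℝ} (hM : 1 ≤ M) (hK₀ : 0 ≤ K₀)
    (hS : ∀ s t, t ≤ s → ∃ C : ℝ, 0 ≤ C ∧ ∀ θ, 1 ≤ θ → ∀ u,
      NX s (S θ u) ≤ C * θ ^ (s - t) * NX t u)
    (hS' : ∀ s t, t ≤ s → s ≤ t + 22 * d → ∃ C : ℝ, 0 ≤ C ∧ ∀ θ, 1 ≤ θ → ∀ u,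
      θ ^ (s - t) * NX t (u - S θ u) ≤ C * NX s u) :
    ∃ K : ℝ, 1 ≤ K ∧ ∀ θ q : ℝ, 1 ≤ θ → θ ^ d = q → ∀ (u p : X) (f : Y),
      NX (4 * d) u ≤ K₀ → 1 + NX (27 * d) u ≤ q ^ 6 → NY (2 * d) f * q ^ 10 ≤ 1 →
      NY (26 * d) f ≤ M * (1 + NX (27 * d) u) →
      NX (25 * d) p ≤ M * (NY (26 * d) f + NX (26 * d) u * NY (2 * d) f) →
      NX (3 * d) p ≤ M * (NY (4 * d) f + NX (4 * d) u * NY (2 * d) f) →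
      NY (3 * d) f * q ^ 9 ≤ K ∧ NX (27 * d) (S θ p) ≤ K * q ^ 8 ∧
      NX (3 * d) (S θ p) * q ^ 8 ≤ K ∧ NX (4 * d) (S θ p) * q ^ 7 ≤ K ∧
      NX (3 * d) (p - S θ p) * q ^ 16 ≤ K := by
  obtain ⟨C₁, hC₁, h₁⟩ := hY.exists_interpolation (t := 2 * d) (r := 3 * d) (s := 26 * d)
    (by omega) (by omega)
  obtain ⟨C₂, hC₂, h₂⟩ := hY.exists_interpolation (t := 2 * d) (r := 4 * d) (s := 26 * d)
    (by omega) (by omega)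
  obtain ⟨c, hc, hmono⟩ := hX.mono (26 * d) (27 * d) (by omega)
  obtain ⟨C₃, hC₃, h₃⟩ := hS (27 * d) (25 * d) (by omega)
  obtain ⟨C₄, hC₄, h₄⟩ := hS (3 * d) (3 * d) le_rfl
  obtain ⟨C₅, hC₅, h₅⟩ := hS (4 * d) (3 * d) (by omega)
  obtain ⟨C₆, hC₆, h₆⟩ := hS' (25 * d) (3 * d) (by omega) (by omega)
  have hM0 : 0 ≤ M := by linarith
  set A := M * (M + c) with hA
  set B := M * (C₂ * (1 + M) + K₀) with hB
  have hA0 : 0 ≤ A := by positivity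
  have hB0 : 0 ≤ B := by positivity
  have hk1 : 0 ≤ C₁ * (1 + M) := by positivity
  have hk2 : 0 ≤ C₃ * A := by positivity
  have hk3 : 0 ≤ C₄ * B := by positivity
  have hk4 : 0 ≤ C₅ * B := by positivity
  have hk5 : 0 ≤ C₆ * A := by positivity
  refine ⟨1 + C₁ * (1 + M) + C₃ * A + C₄ * B + C₅ * B + C₆ * A, by linarith, ?_⟩
  intro θ q hθ hq u p f hu4 hu27 hf2 hf26 hp25 hp3
  have hq1 : 1 ≤ q := hq ▸ one_le_pow₀ hθ
  have hq0 : 0 < q := by linarith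
  have hpow : ∀ a b : ℕ, θ ^ (a * d - b * d) = q ^ (a - b) := fun a b => by
    rw [← Nat.sub_mul, pow_mul', hq]
  have hf2n : 0 ≤ NY (2 * d) f := apply_nonneg _ _
  have hf2' : NY (2 * d) f ≤ 1 :=
    (le_mul_of_one_le_right hf2n (one_le_pow₀ hq1)).trans hf2
  have hF : NY (26 * d) f ≤ M * q ^ 6 := hf26.trans (mul_le_mul_of_nonneg_left hu27 hM0)
  -- The right-hand side of both interpolations: the low-norm part is q²⁴ · q⁻¹⁰, and the high-norm
  -- part q⁶ is dominated by it.
  have hsum : q ^ 24 * NY (2 * d) f + NY (26 * d) f ≤ (1 + M) * q ^ 14 := by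
    have e1 : q ^ 24 * NY (2 * d) f ≤ q ^ 14 * 1 := by
      rw [show q ^ 24 * NY (2 * d) f = q ^ 14 * (NY (2 * d) f * q ^ 10) by ring]
      exact mul_le_mul_of_nonneg_left hf2 (by positivity)
    have e2 : M * q ^ 6 ≤ M * q ^ 14 :=
      mul_le_mul_of_nonneg_left (pow_le_pow_right₀ hq1 (by norm_num)) hM0
    linarith
  have hn3 : NY (3 * d) f * q ^ 9 ≤ C₁ * (1 + M) := by
    have := h₁ θ hθ f
    simp only [hpow, Nat.reduceSub] at this
    refine le_of_mul_le_mul_right ?_ (pow_pos hq0 14)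
    calc NY (3 * d) f * q ^ 9 * q ^ 14 = q ^ 23 * NY (3 * d) f := by ring
      _ ≤ C₁ * ((1 + M) * q ^ 14) := this.trans (mul_le_mul_of_nonneg_left hsum hC₁)
      _ = _ := by ring
  have hn4 : NY (4 * d) f * q ^ 8 ≤ C₂ * (1 + M) := by
    have := h₂ θ hθ f
    simp only [hpow, Nat.reduceSub] at this
    refine le_of_mul_le_mul_right ?_ (pow_pos hq0 14)
    calc NY (4 * d) f * q ^ 8 * q ^ 14 = q ^ 22 * NY (4 * d) f := by ring
      _ ≤ C₂ * ((1 + M) * q ^ 14) := this.trans (mul_le_mul_of_nonneg_left hsum hC₂)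
      _ = _ := by ring
  have hp25' : NX (25 * d) p ≤ A * q ^ 6 := by
    refine hp25.trans ?_
    rw [hA, mul_assoc]
    refine mul_le_mul_of_nonneg_left ?_ hM0
    have e1 : NX (26 * d) u ≤ c * q ^ 6 :=
      (hmono u).trans (mul_le_mul_of_nonneg_left (by linarith) hc)
    have e2 : NX (26 * d) u * NY (2 * d) f ≤ NX (26 * d) u * 1 :=
      mul_le_mul_of_nonneg_left hf2' (apply_nonneg _ _)
    linarith
  have hp3' : NX (3 * d) p * q ^ 8 ≤ B := by
    have e1 : NY (2 * d) f * q ^ 8 ≤ 1 := (mul_le_mul_of_nonneg_left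
      (pow_le_pow_right₀ hq1 (by norm_num)) hf2n).trans hf2
    have e2 : NX (4 * d) u * (NY (2 * d) f * q ^ 8) ≤ K₀ * 1 :=
      mul_le_mul hu4 e1 (by positivity) hK₀
    calc NX (3 * d) p * q ^ 8 ≤ M * (NY (4 * d) f + NX (4 * d) u * NY (2 * d) f) * q ^ 8 :=
          mul_le_mul_of_nonneg_right hp3 (by positivity)
      _ = M * (NY (4 * d) f * q ^ 8 + NX (4 * d) u * (NY (2 * d) f * q ^ 8)) := by ring
      _ ≤ B := mul_le_mul_of_nonneg_left (by linarith) hM0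
  have hv27 : NX (27 * d) (S θ p) ≤ C₃ * A * q ^ 8 := by
    have := h₃ θ hθ p
    simp only [hpow, Nat.reduceSub] at this
    calc _ ≤ C₃ * q ^ 2 * (A * q ^ 6) :=
          this.trans (mul_le_mul_of_nonneg_left hp25' (by positivity))
      _ = _ := by ring
  have hv3 : NX (3 * d) (S θ p) * q ^ 8 ≤ C₄ * B := by
    have := h₄ θ hθ p
    simp only [Nat.sub_self, pow_zero, mul_one] at this
    calc _ ≤ C₄ * NX (3 * d) p * q ^ 8 := mul_le_mul_of_nonneg_right this (by positivity)
      _ = C₄ * (NX (3 * d) p * q ^ 8) := by ring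
      _ ≤ _ := mul_le_mul_of_nonneg_left hp3' hC₄
  have hv4 : NX (4 * d) (S θ p) * q ^ 7 ≤ C₅ * B := by
    have := h₅ θ hθ p
    simp only [hpow, Nat.reduceSub] at this
    calc _ ≤ C₅ * q ^ 1 * NX (3 * d) p * q ^ 7 := mul_le_mul_of_nonneg_right this (by positivity)
      _ = C₅ * (NX (3 * d) p * q ^ 8) := by ring
      _ ≤ _ := mul_le_mul_of_nonneg_left hp3' hC₅
  have he3 : NX (3 * d) (p - S θ p) * q ^ 16 ≤ C₆ * A := by
    have := h₆ θ hθ p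
    simp only [hpow, Nat.reduceSub] at this
    refine le_of_mul_le_mul_right ?_ (pow_pos hq0 6)
    calc NX (3 * d) (p - S θ p) * q ^ 16 * q ^ 6 = q ^ 22 * NX (3 * d) (p - S θ p) := by ring
      _ ≤ C₆ * (A * q ^ 6) := this.trans (mul_le_mul_of_nonneg_left hp25' hC₆)
      _ = _ := by ring
  refine ⟨by linarith, hv27.trans (mul_le_mul_of_nonneg_right (by linarith) (by positivity)),
    by linarith, by linarith, by linarith⟩

/-- The scales `θ₀, θ₀^{3/2}, θ₀^{9/4}, …` of the Nash-Moser iteration. -/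
noncomputable def newtonScale (θ₀ : ℝ) : ℕ → ℝ
  | 0 => θ₀
  | j + 1 => newtonScale θ₀ j * Real.sqrt (newtonScale θ₀ j)

lemma mul_two_pow_le_newtonScale {θ₀ : ℝ} (h : 4 ≤ θ₀) (j : ℕ) :
    θ₀ * 2 ^ j ≤ newtonScale θ₀ j := by
  induction j with
  | zero => simp [newtonScale]
  | succ j ih =>
    have h1 : (1 : ℝ) ≤ 2 ^ j := one_le_pow₀ (by norm_num)
    have h2 : 4 ≤ newtonScale θ₀ j := by nlinarith
    have h3 : 2 ≤ Real.sqrt (newtonScale θ₀ j) := Real.le_sqrt_of_sq_le (by linarith)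
    rw [newtonScale, pow_succ, ← mul_assoc]
    exact mul_le_mul ih h3 (by norm_num) (by linarith)

/-- The exponent 3/2 in integral form: it turns q⁶ into q⁹ and q¹⁰ into q¹⁵ at the next scale. -/
lemma newtonScale_succ_sq {θ₀ : ℝ} (h : 4 ≤ θ₀) (j : ℕ) :
    newtonScale θ₀ (j + 1) ^ 2 = newtonScale θ₀ j ^ 3 := by
  have h1 : (1 : ℝ) ≤ 2 ^ j := one_le_pow₀ (by norm_num)
  rw [newtonScale, mul_pow, Real.sq_sqrt (by nlinarith [mul_two_pow_le_newtonScale h j])]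
  ring

/-- The smoothed Newton iteration. -/
noncomputable def newtonSeq (S : ℝ → X → X) (φ : X → Y) (ψ : X → Y → X) (θ : ℕ → ℝ) (u₀ : X) :
    ℕ → X
  | 0 => u₀
  | j + 1 => newtonSeq S φ ψ θ u₀ j -
      S (θ j) (ψ (newtonSeq S φ ψ θ u₀ j) (φ (newtonSeq S φ ψ θ u₀ j)))

/-- The invariants close up because q⁶ + K q⁸ ≤ q⁹ for the high norm and K' q⁻¹⁶ ≤ q⁻¹⁵ for `φ`,
once `q` exceeds fixed constants. All of `θ₀`, `K` and `r` are chosen before the map `φ` and its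
data. -/
lemma exists_newtonSeq_bounds (hX : IsTameScale NX) (hY : IsTameScale NY) {S : ℝ → X → X}
    {d : ℕ} (hd : 0 < d) {M : ℝ} (hM : 1 ≤ M)
    (hS : ∀ s t, t ≤ s → ∃ C : ℝ, 0 ≤ C ∧ ∀ θ, 1 ≤ θ → ∀ u,
      NX s (S θ u) ≤ C * θ ^ (s - t) * NX t u)
    (hS' : ∀ s t, t ≤ s → s ≤ t + 22 * d → ∃ C : ℝ, 0 ≤ C ∧ ∀ θ, 1 ≤ θ → ∀ u,
      θ ^ (s - t) * NX t (u - S θ u) ≤ C * NX s u) :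
    ∃ θ₀ K r : ℝ, 4 ≤ θ₀ ∧ ∀ (C : ℕ → ℝ) (δ : ℝ) (u₀ : X) (φ : X → Y) (φ' : X → X →ₗ[ℝ] Y)
      (φ'' : X → X →ₗ[ℝ] X →ₗ[ℝ] Y) (ψ : X → Y → X) (ℰ : X → Y → Y → Y),
      IsTamelyInvertible NX NY d M C δ u₀ φ φ' φ'' ψ ℰ →
      (∀ s, d ≤ s → s ≤ 27 * d → C s ≤ M) → 0 < δ → δ⁻¹ ≤ M → NX (27 * d) u₀ ≤ M →
      NY (2 * d) (φ u₀) * (θ₀ ^ d) ^ 10 ≤ 1 → r < δ ∧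
      ∀ j, NX (3 * d) (newtonSeq S φ ψ (newtonScale θ₀) u₀ j - u₀) ≤ r ∧
        NY (2 * d) (φ (newtonSeq S φ ψ (newtonScale θ₀) u₀ j)) *
          (newtonScale θ₀ j ^ d) ^ 10 ≤ 1 ∧
        NX (3 * d) (newtonSeq S φ ψ (newtonScale θ₀) u₀ (j + 1) -
          newtonSeq S φ ψ (newtonScale θ₀) u₀ j) * (newtonScale θ₀ j ^ d) ^ 8 ≤ K := by
  have hM0 : 0 < M := by linarith
  obtain ⟨c₃, hc₃, hm₃⟩ := hX.mono (3 * d) (4 * d) (by omega)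
  obtain ⟨c₄, hc₄, hm₄⟩ := hX.mono (4 * d) (27 * d) (by omega)
  obtain ⟨K, hK, hstep⟩ := exists_newton_step_bounds hX hY (S := S) (d := d) (M := M)
    (K₀ := c₄ * M + 1) hM (by positivity) hS hS'
  -- Makes `c₃ * ε < M⁻¹ ≤ δ`, so that the `4d`-ball of radius `ε` lies in the domain; also `ε ≤ 1`,
  -- as the bound `c₄ * M + 1` on the `4d`-norm requires.
  set ε := (2 * M * (c₃ + 1))⁻¹ with hε
  have hε0 : 0 < ε := by positivity
  have hε1 : ε ≤ 1 := inv_le_one_of_one_le₀ (by nlinarith)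
  -- The terms ensure, in order: growth of the scales, the initial bound on the `27d`-norm (4 and
  -- `M` together), total displacement at most `ε`, the step from q⁸ to q⁹, and absorption of the
  -- constant in the quadratic estimate.
  set θ₀ := 4 + M + 2 * K / ε + K + M * (2 * K ^ 2 + K) with hθ₀
  have hp1 : 0 ≤ 2 * K / ε := by positivity
  have hp2 : 0 ≤ M * (2 * K ^ 2 + K) := by positivity
  have h4 : 4 ≤ θ₀ := by linarith
  refine ⟨θ₀, K, c₃ * ε, h4, ?_⟩
  intro C δ u₀ φ φ' φ'' ψ ℰ h hC hδ hδM hu₀ hφ₀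
  have hr : c₃ * ε < δ := by
    have h1 : M⁻¹ ≤ δ := inv_le_of_inv_le₀ hδ hδM
    refine lt_of_lt_of_le ?_ h1
    rw [hε, ← div_eq_mul_inv, div_lt_iff₀ (by positivity)]
    have : M⁻¹ * (2 * M * (c₃ + 1)) = 2 * (c₃ + 1) := by field_simp
    linarith
  refine ⟨hr, ?_⟩
  set θ := newtonScale θ₀ with hθ
  set u := newtonSeq S φ ψ θ u₀ with hu
  have hθj : ∀ j, θ₀ * 2 ^ j ≤ θ j := mul_two_pow_le_newtonScale h4
  have hθ0j : ∀ j, θ₀ ≤ θ j := fun j =>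
    (le_mul_of_one_le_right (by linarith) (one_le_pow₀ (by norm_num))).trans (hθj j)
  have hqθ : ∀ j, θ j ≤ θ j ^ d := fun j =>
    le_self_pow₀ (by linarith [hθ0j j]) hd.ne'
  have hq2 : ∀ j, (θ (j + 1) ^ d) ^ 2 = (θ j ^ d) ^ 3 := fun j => by
    rw [← pow_mul, mul_comm, pow_mul, newtonScale_succ_sq h4, ← pow_mul, ← pow_mul, mul_comm]
  have hball : ∀ w : X, NX (4 * d) w ≤ ε → NX (3 * d) w ≤ c₃ * ε := fun w hw =>
    (hm₃ w).trans (mul_le_mul_of_nonneg_left hw hc₃)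
  have bounds : ∀ j, NX (4 * d) (u j - u₀) ≤ ε → 1 + NX (27 * d) (u j) ≤ (θ j ^ d) ^ 6 →
      NY (2 * d) (φ (u j)) * (θ j ^ d) ^ 10 ≤ 1 →
      NY (3 * d) (φ (u j)) * (θ j ^ d) ^ 9 ≤ K ∧
      NX (27 * d) (S (θ j) (ψ (u j) (φ (u j)))) ≤ K * (θ j ^ d) ^ 8 ∧
      NX (3 * d) (S (θ j) (ψ (u j) (φ (u j)))) * (θ j ^ d) ^ 8 ≤ K ∧
      NX (4 * d) (S (θ j) (ψ (u j) (φ (u j)))) * (θ j ^ d) ^ 7 ≤ K ∧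
      NX (3 * d) (ψ (u j) (φ (u j)) - S (θ j) (ψ (u j) (φ (u j)))) * (θ j ^ d) ^ 16 ≤ K := by
    intro j hj4 hj27 hj2
    have hb := (hball _ hj4).trans_lt hr
    refine hstep (θ j) _ (by linarith [hθ0j j]) rfl _ _ _ ?_ hj27 hj2 ?_ ?_ ?_
    · have h1 := map_add_le_add (NX (4 * d)) (u j - u₀) u₀
      rw [sub_add_cancel] at h1
      have h2 := (hm₄ u₀).trans (mul_le_mul_of_nonneg_left hu₀ hc₄)
      linarith
    · have := h.map_le _ hb (26 * d) (by omega)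
      rw [show 26 * d + d = 27 * d by ring] at this
      exact this.trans (mul_le_mul_of_nonneg_right (hC _ (by omega) (by omega))
        (by positivity))
    · have := h.inverse_le _ hb (φ (u j)) (25 * d) (by omega)
      rw [show 25 * d + d = 26 * d by ring] at this
      exact this.trans (mul_le_mul_of_nonneg_right (hC _ (by omega) (by omega))
        (by positivity))
    · have := h.inverse_le _ hb (φ (u j)) (3 * d) (by omega)
      rw [show 3 * d + d = 4 * d by ring] at this
      exact this.trans (mul_le_mul_of_nonneg_right (hC _ (by omega) (by omega))
        (by positivity))
  -- The factor `1 - (1 / 2) ^ j` records the partial sums of displacements `ε / 2 ^ (j + 1)`.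
  have inv : ∀ j, NX (4 * d) (u j - u₀) ≤ ε * (1 - (1 / 2) ^ j) ∧
      1 + NX (27 * d) (u j) ≤ (θ j ^ d) ^ 6 ∧ NY (2 * d) (φ (u j)) * (θ j ^ d) ^ 10 ≤ 1 := by
    intro j
    induction j with
    | zero =>
      refine ⟨by simp [hu, newtonSeq], ?_, hφ₀⟩
      have h1 : 1 + NX (27 * d) u₀ ≤ θ 0 := by linarith [hθ0j 0]
      exact h1.trans ((hqθ 0).trans (le_self_pow₀ (by linarith [hθ0j 0, hqθ 0]) (by norm_num)))
    | succ j ih =>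
      obtain ⟨ih4, ih27, ih2⟩ := ih
      have hhalf : (0 : ℝ) < (1 / 2) ^ j := by positivity
      have hj4 : NX (4 * d) (u j - u₀) ≤ ε := ih4.trans (by nlinarith)
      obtain ⟨hf3, hv27, hv3, hv4, he3⟩ := bounds j hj4 ih27 ih2
      set v := S (θ j) (ψ (u j) (φ (u j))) with hv
      have husucc : u (j + 1) = u j - v := rfl
      have hqj := hqθ j
      have hq2j := hq2 j
      set q := θ j ^ d
      set q' := θ (j + 1) ^ d
      have hqθ₀ : θ₀ ≤ q := (hθ0j j).trans hqj
      have hq1 : 1 ≤ q := by linarith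
      have hq0 : 0 < q := by linarith
      have hv4' : NX (4 * d) v ≤ ε * (1 / 2) ^ (j + 1) := by
        have e1 : NX (4 * d) v * q ≤ K := (mul_le_mul_of_nonneg_left
          (le_self_pow₀ hq1 (by norm_num)) (apply_nonneg _ _)).trans hv4
        have e2 : 2 * K / ε * 2 ^ j ≤ q := le_trans (mul_le_mul_of_nonneg_right (by linarith)
          (by positivity)) ((hθj j).trans hqj)
        have e3 : K ≤ ε * (1 / 2) ^ (j + 1) * q := by
          calc K = ε * (1 / 2) ^ (j + 1) * (2 * K / ε * 2 ^ j) := by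
                rw [pow_succ, div_pow, one_pow]
                field_simp
            _ ≤ _ := mul_le_mul_of_nonneg_left e2 (by positivity)
        exact le_of_mul_le_mul_right (e1.trans e3) hq0
      have hnew4 : NX (4 * d) (u (j + 1) - u₀) ≤ ε * (1 - (1 / 2) ^ (j + 1)) := by
        have e1 := map_sub_le_add (NX (4 * d)) (u j - u₀) v
        rw [husucc, sub_right_comm]
        rw [pow_succ] at hv4' ⊢
        linarith
      have hb := (hball _ hj4).trans_lt hr
      have hb' := (hball _ (hnew4.trans (by
        have : (0 : ℝ) < (1 / 2) ^ (j + 1) := by positivity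
        nlinarith))).trans_lt hr
      have h6 : q' ^ 6 = q ^ 9 := by
        rw [show q' ^ 6 = (q' ^ 2) ^ 3 by ring, hq2j]
        ring
      have h10 : q' ^ 10 = q ^ 15 := by
        rw [show q' ^ 10 = (q' ^ 2) ^ 5 by ring, hq2j]
        ring
      refine ⟨hnew4, ?_, ?_⟩
      · have e1 := map_sub_le_add (NX (27 * d)) (u j) v
        have e2 : q ^ 6 ≤ q ^ 8 := pow_le_pow_right₀ hq1 (by norm_num)
        have e3 : (1 + K) * q ^ 8 ≤ q * q ^ 8 :=
          mul_le_mul_of_nonneg_right (by linarith) (by positivity)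
        rw [h6, husucc, show q ^ 9 = q * q ^ 8 by ring]
        linarith
      · have e1 := h.map_newton_le hb (v := v) (husucc ▸ hb')
        rw [h10, husucc]
        have f0 : 0 ≤ NY (3 * d) (φ (u j)) := apply_nonneg _ _
        have v0 : 0 ≤ NX (3 * d) v := apply_nonneg _ _
        have e2 : NY (3 * d) (φ (u j)) ^ 2 * q ^ 16 ≤ K ^ 2 := by
          calc NY (3 * d) (φ (u j)) ^ 2 * q ^ 16 ≤ NY (3 * d) (φ (u j)) ^ 2 * q ^ 18 :=
                mul_le_mul_of_nonneg_left (pow_le_pow_right₀ hq1 (by norm_num)) (by positivity)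
            _ = (NY (3 * d) (φ (u j)) * q ^ 9) ^ 2 := by ring
            _ ≤ K ^ 2 := pow_le_pow_left₀ (by positivity) hf3 2
        have e3 : NX (3 * d) v ^ 2 * q ^ 16 ≤ K ^ 2 := by
          rw [show NX (3 * d) v ^ 2 * q ^ 16 = (NX (3 * d) v * q ^ 8) ^ 2 by ring]
          exact pow_le_pow_left₀ (by positivity) hv3 2
        refine le_of_mul_le_mul_right ?_ hq0
        calc NY (2 * d) (φ (u j - v)) * q ^ 15 * q = NY (2 * d) (φ (u j - v)) * q ^ 16 := by ring
          _ ≤ (M * NY (3 * d) (φ (u j)) ^ 2 + M * NX (3 * d) (ψ (u j) (φ (u j)) - v) +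
              M * NX (3 * d) v ^ 2) * q ^ 16 := mul_le_mul_of_nonneg_right e1 (by positivity)
          _ = M * (NY (3 * d) (φ (u j)) ^ 2 * q ^ 16 + NX (3 * d) (ψ (u j) (φ (u j)) - v) * q ^ 16 +
              NX (3 * d) v ^ 2 * q ^ 16) := by ring
          _ ≤ M * (2 * K ^ 2 + K) := mul_le_mul_of_nonneg_left (by linarith) hM0.le
          _ ≤ 1 * q := by linarith
  intro j
  obtain ⟨h4j, h27j, h2j⟩ := inv j
  have hhalf : (0 : ℝ) < (1 / 2) ^ j := by positivity
  have hj4 : NX (4 * d) (u j - u₀) ≤ ε := h4j.trans (by nlinarith)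
  refine ⟨hball _ hj4, h2j, ?_⟩
  rw [show u (j + 1) = u j - S (θ j) (ψ (u j) (φ (u j))) from rfl, sub_sub_cancel_left,
    map_neg_eq_map]
  exact (bounds j hj4 h27j h2j).2.2.1
end Iteration

/-! ### Convergence in every norm and the abstract theorem. -/

section Iteration

variable {X Y : Type*} [AddCommGroup X] [Module ℝ X] [AddCommGroup Y] [Module ℝ Y]
  {NX : ℕ → Seminorm ℝ X} {NY : ℕ → Seminorm ℝ Y}
lemma exists_seminorm_sub_le_of_geometric {p : Seminorm ℝ X} {u : ℕ → X} {C : ℝ}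
    (h : ∀ j, p (u (j + 1) - u j) ≤ C * (1 / 2) ^ j) :
    ∀ ε > 0, ∃ K, ∀ i ≥ K, ∀ j ≥ K, p (u i - u j) ≤ ε := by
  have hC : 0 ≤ C := by simpa using (apply_nonneg p _).trans (h 0)
  have key : ∀ k m, p (u (k + m) - u k) ≤ 2 * C * (1 / 2) ^ k * (1 - (1 / 2) ^ m) := by
    intro k m
    induction m with
    | zero => simp
    | succ m ih =>
      have h1 := map_add_le_add p (u (k + m + 1) - u (k + m)) (u (k + m) - u k)
      rw [sub_add_sub_cancel] at h1
      have h2 := h (k + m)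
      rw [pow_add] at h2
      rw [← add_assoc, pow_succ]
      linarith
  have key' : ∀ k, ∀ i ≥ k, p (u i - u k) ≤ 2 * C * (1 / 2) ^ k := by
    intro k i hi
    obtain ⟨m, rfl⟩ := Nat.exists_eq_add_of_le hi
    refine (key k m).trans (mul_le_of_le_one_right (by positivity) ?_)
    have : (0 : ℝ) < (1 / 2) ^ m := by positivity
    linarith
  intro ε hε
  obtain ⟨K, hK⟩ := exists_pow_lt_of_lt_one (show 0 < ε / (4 * C + 1) by positivity)
    (show (1 / 2 : ℝ) < 1 by norm_num)
  rw [lt_div_iff₀ (by positivity)] at hK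
  refine ⟨K, fun i hi j hj => ?_⟩
  have h1 := map_sub_le_add p (u i - u K) (u j - u K)
  rw [sub_sub_sub_cancel_right] at h1
  have h2 := key' K i hi
  have h3 := key' K j hj
  have h4 : (0 : ℝ) < (1 / 2) ^ K := by positivity
  linarith

section Convergence

variable {d : ℕ} {M : ℝ} {C : ℕ → ℝ} {δ : ℝ} {u₀ : X} {φ : X → Y} {φ' : X → X →ₗ[ℝ] Y}
  {φ'' : X → X →ₗ[ℝ] X →ₗ[ℝ] Y} {ψ : X → Y → X} {ℰ : X → Y → Y → Y} {S : ℝ → X → X} {θ₀ K : ℝ}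

/-- One step multiplies one plus the norm by at most `1 + L q²`, which is below q³ as soon as `q ≥ 1
+ L`; meanwhile the bound q⁶ becomes q⁹. Hence growth like q⁶ propagates from some index on. The
constant may depend on `C t` and `C (t + d)`, since no smallness is claimed. -/
lemma exists_newtonSeq_highNorm_le (hX : IsTameScale NX) (hd : 0 < d) (hθ₀ : 4 ≤ θ₀)
    (hS : ∀ s t, t ≤ s → ∃ C : ℝ, 0 ≤ C ∧ ∀ θ, 1 ≤ θ → ∀ u,
      NX s (S θ u) ≤ C * θ ^ (s - t) * NX t u)
    (h : IsTamelyInvertible NX NY d M C δ u₀ φ φ' φ'' ψ ℰ)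
    (hball : ∀ j, NX (3 * d) (newtonSeq S φ ψ (newtonScale θ₀) u₀ j - u₀) < δ)
    (hφ : ∀ j, NY (2 * d) (φ (newtonSeq S φ ψ (newtonScale θ₀) u₀ j)) ≤ 1)
    {t : ℕ} (ht : d ≤ t) : ∃ A : ℝ, 0 ≤ A ∧ ∀ j,
      NX (t + 2 * d) (newtonSeq S φ ψ (newtonScale θ₀) u₀ (j + 1) -
        newtonSeq S φ ψ (newtonScale θ₀) u₀ j) ≤ A * (newtonScale θ₀ j ^ d) ^ 8 := by
  set θ := newtonScale θ₀ with hθ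
  set u := newtonSeq S φ ψ θ u₀ with hu
  obtain ⟨c, hc, hmono⟩ := hX.mono (t + d) (t + 2 * d) (by omega)
  obtain ⟨B, hB, hSB⟩ := hS (t + 2 * d) t (by omega)
  set L := B * (|C t| * (|C (t + d)| + c)) with hL
  have hL0 : 0 ≤ L := by positivity
  have hpow : ∀ j : ℕ, (1 : ℝ) ≤ 2 ^ j := fun j => one_le_pow₀ (by norm_num)
  have hθj : ∀ j, 2 ^ j ≤ θ j := fun j =>
    (le_mul_of_one_le_left (by positivity) (by linarith)).trans (mul_two_pow_le_newtonScale hθ₀ j)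
  have hθ1 : ∀ j, 1 ≤ θ j := fun j => (hpow j).trans (hθj j)
  have hq1 : ∀ j, 1 ≤ θ j ^ d := fun j => one_le_pow₀ (hθ1 j)
  have hqj : ∀ j, 2 ^ j ≤ θ j ^ d := fun j => (hθj j).trans (le_self_pow₀ (hθ1 j) hd.ne')
  have hstep : ∀ j, NX (t + 2 * d) (u (j + 1) - u j) ≤
      L * (θ j ^ d) ^ 2 * (1 + NX (t + 2 * d) (u j)) := by
    intro j
    rw [show u (j + 1) = u j - S (θ j) (ψ (u j) (φ (u j))) from rfl, sub_sub_cancel_left,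
      map_neg_eq_map]
    have h1 := hSB (θ j) (hθ1 j) (ψ (u j) (φ (u j)))
    rw [add_tsub_cancel_left, pow_mul'] at h1
    have h2 := h.inverse_le _ (hball j) (φ (u j)) t ht
    have h3 := h.map_le _ (hball j) (t + d) (by omega)
    rw [add_assoc, ← two_mul] at h3
    have hn : 0 ≤ NX (t + 2 * d) (u j) := apply_nonneg _ _
    have h4 : NY (t + d) (φ (u j)) + NX (t + d) (u j) * NY (2 * d) (φ (u j)) ≤
        (|C (t + d)| + c) * (1 + NX (t + 2 * d) (u j)) := by
      have e1 : NX (t + d) (u j) * NY (2 * d) (φ (u j)) ≤ NX (t + d) (u j) * 1 :=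
        mul_le_mul_of_nonneg_left (hφ j) (apply_nonneg _ _)
      have e2 := hmono (u j)
      have e3 := mul_le_mul_of_nonneg_right (le_abs_self (C (t + d)))
        (show 0 ≤ 1 + NX (t + 2 * d) (u j) by linarith)
      linarith
    have h5 : NX t (ψ (u j) (φ (u j))) ≤
        |C t| * ((|C (t + d)| + c) * (1 + NX (t + 2 * d) (u j))) :=
      h2.trans (mul_le_mul (le_abs_self _) h4 (by positivity) (by positivity))
    calc _ ≤ B * (θ j ^ d) ^ 2 * (|C t| * ((|C (t + d)| + c) * (1 + NX (t + 2 * d) (u j)))) :=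
          h1.trans (mul_le_mul_of_nonneg_left h5 (by positivity))
      _ = _ := by ring
  obtain ⟨J, hJ⟩ := pow_unbounded_of_one_lt (1 + L) (show (1 : ℝ) < 2 by norm_num)
  -- Absorbs the finitely many iterates for which `q` is not yet large.
  set A := ∑ i ∈ Finset.range (J + 1), (1 + NX (t + 2 * d) (u i)) with hA
  have hA0 : 0 ≤ A := Finset.sum_nonneg fun i _ => by positivity
  have hsmall : ∀ j ≤ J, 1 + NX (t + 2 * d) (u j) ≤ A * (θ j ^ d) ^ 6 := fun j hj =>
    (Finset.single_le_sum (f := fun i => 1 + NX (t + 2 * d) (u i)) (fun i _ => by positivity)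
      (Finset.mem_range.2 (by omega))).trans (le_mul_of_one_le_right hA0 (one_le_pow₀ (hq1 j)))
  have hlarge : ∀ j, J ≤ j → 1 + NX (t + 2 * d) (u j) ≤ A * (θ j ^ d) ^ 6 := by
    intro j hj
    induction j, hj using Nat.le_induction with
    | base => exact hsmall J le_rfl
    | succ j hj ih =>
      have h1 := map_add_le_add (NX (t + 2 * d)) (u (j + 1) - u j) (u j)
      rw [sub_add_cancel] at h1
      have h2 := hstep j
      have h3 : (θ (j + 1) ^ d) ^ 6 = (θ j ^ d) ^ 9 := by
        rw [← pow_mul, show d * 6 = 2 * (3 * d) by ring, pow_mul, newtonScale_succ_sq hθ₀,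
          ← pow_mul, ← pow_mul]
        congr 1
        ring
      have h4 : 1 + L ≤ θ j ^ d :=
        hJ.le.trans ((pow_le_pow_right₀ (by norm_num) hj).trans (hqj j))
      have h1j := hq1 j
      rw [h3]
      set q := θ j ^ d
      set b := 1 + NX (t + 2 * d) (u j) with hb
      have hb0 : 0 ≤ b := by positivity
      have h5 : 1 + L * q ^ 2 ≤ q ^ 3 := by
        have e1 : 1 ≤ q ^ 2 := one_le_pow₀ h1j
        calc 1 + L * q ^ 2 ≤ (1 + L) * q ^ 2 := by linarith
          _ ≤ q * q ^ 2 := mul_le_mul_of_nonneg_right h4 (by positivity)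
          _ = q ^ 3 := by ring
      calc 1 + NX (t + 2 * d) (u (j + 1)) ≤ (1 + L * q ^ 2) * b := by linarith
        _ ≤ q ^ 3 * (A * q ^ 6) := mul_le_mul h5 ih hb0 (by positivity)
        _ = A * q ^ 9 := by ring
  refine ⟨L * A, by positivity, fun j => (hstep j).trans ?_⟩
  calc _ ≤ L * (θ j ^ d) ^ 2 * (A * (θ j ^ d) ^ 6) := by
        refine mul_le_mul_of_nonneg_left ?_ (by positivity)
        rcases le_total j J with hj | hj
        exacts [hsmall j hj, hlarge j hj]
    _ = _ := by ring

/-- Interpolation between the decay q⁻⁸ at order `3d` and the growth q⁸ at order `4r`: the latter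
order is so high that decay q⁻⁴ remains at order `r`. -/
lemma exists_newtonSeq_sub_le_geometric (hX : IsTameScale NX) (hd : 0 < d) (hθ₀ : 4 ≤ θ₀)
    (hS : ∀ s t, t ≤ s → ∃ C : ℝ, 0 ≤ C ∧ ∀ θ, 1 ≤ θ → ∀ u,
      NX s (S θ u) ≤ C * θ ^ (s - t) * NX t u)
    (h : IsTamelyInvertible NX NY d M C δ u₀ φ φ' φ'' ψ ℰ)
    (hball : ∀ j, NX (3 * d) (newtonSeq S φ ψ (newtonScale θ₀) u₀ j - u₀) < δ)
    (hφ : ∀ j, NY (2 * d) (φ (newtonSeq S φ ψ (newtonScale θ₀) u₀ j)) ≤ 1)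
    (hK : ∀ j, NX (3 * d) (newtonSeq S φ ψ (newtonScale θ₀) u₀ (j + 1) -
      newtonSeq S φ ψ (newtonScale θ₀) u₀ j) * (newtonScale θ₀ j ^ d) ^ 8 ≤ K)
    {r : ℕ} (hr : 3 * d ≤ r) : ∃ A : ℝ, ∀ j, NX r (newtonSeq S φ ψ (newtonScale θ₀) u₀ (j + 1) -
      newtonSeq S φ ψ (newtonScale θ₀) u₀ j) ≤ A * (1 / 2) ^ j := by
  obtain ⟨A, hA, hv⟩ := exists_newtonSeq_highNorm_le hX hd hθ₀ hS h hball hφ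
    (t := 4 * r - 2 * d) (by omega)
  rw [show 4 * r - 2 * d + 2 * d = 4 * r by omega] at hv
  obtain ⟨B, hB, hint⟩ := hX.exists_interpolation (t := 3 * d) (r := r) (s := 4 * r) hr (by omega)
  refine ⟨B * (K + A), fun j => ?_⟩
  have hvj := hv j
  have hKj := hK j
  have hθj : 2 ^ j ≤ newtonScale θ₀ j :=
    (le_mul_of_one_le_left (by positivity) (by linarith)).trans (mul_two_pow_le_newtonScale hθ₀ j)
  have hθ1 : 1 ≤ newtonScale θ₀ j := le_trans (one_le_pow₀ (by norm_num)) hθj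
  have hqj : 2 ^ j ≤ newtonScale θ₀ j ^ d := hθj.trans (le_self_pow₀ hθ1 hd.ne')
  have hq1 : 1 ≤ newtonScale θ₀ j ^ d := one_le_pow₀ hθ1
  set q := newtonScale θ₀ j ^ d
  set v := newtonSeq S φ ψ (newtonScale θ₀) u₀ (j + 1) - newtonSeq S φ ψ (newtonScale θ₀) u₀ j
  have hq0 : 0 < q := by linarith
  -- With `τ ^ r = q ^ 4` the inequality reads q¹² |v|_r ≤ B (q¹⁶ · K q⁻⁸ + A q⁸).
  set τ := (q ^ 4) ^ ((r : ℝ)⁻¹) with hτ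
  have hτr : τ ^ r = q ^ 4 := Real.rpow_inv_natCast_pow (by positivity) (by omega)
  have hτ1 : 1 ≤ τ := Real.one_le_rpow (one_le_pow₀ hq1) (by positivity)
  have h1 := hint τ hτ1 v
  rw [show 4 * r - r = r * 3 by omega, pow_mul, hτr, ← pow_mul] at h1
  have h2 : τ ^ (4 * r - 3 * d) ≤ q ^ 16 := by
    refine (pow_le_pow_right₀ hτ1 (show 4 * r - 3 * d ≤ r * 4 by omega)).trans (le_of_eq ?_)
    rw [pow_mul, hτr, ← pow_mul]
  have h3 : τ ^ (4 * r - 3 * d) * NX (3 * d) v ≤ K * q ^ 8 := by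
    calc _ ≤ q ^ 16 * NX (3 * d) v := mul_le_mul_of_nonneg_right h2 (apply_nonneg _ _)
      _ = NX (3 * d) v * q ^ 8 * q ^ 8 := by ring
      _ ≤ _ := mul_le_mul_of_nonneg_right hKj (by positivity)
  have h4 : NX r v * q ^ 4 ≤ B * (K + A) := by
    refine le_of_mul_le_mul_right ?_ (pow_pos hq0 8)
    calc NX r v * q ^ 4 * q ^ 8 = q ^ (4 * 3) * NX r v := by ring
      _ ≤ B * (K * q ^ 8 + A * q ^ 8) :=
        h1.trans (mul_le_mul_of_nonneg_left (add_le_add h3 hvj) hB)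
      _ = _ := by ring
  have h5 : NX r v * 2 ^ j ≤ B * (K + A) := (mul_le_mul_of_nonneg_left
    (hqj.trans (le_self_pow₀ hq1 (by norm_num))) (apply_nonneg _ _)).trans h4
  rwa [div_pow, one_pow, mul_one_div, le_div_iff₀ (by positivity)]

end Convergence

/-- The Nash-Moser theorem for maps between spaces with tame scales of seminorms. -/
theorem exists_zero_of_isTamelyInvertible (hX : IsTameScale NX) (hY : IsTameScale NY) {d : ℕ}
    (hd : 0 < d) {M : ℝ} (hM : 1 ≤ M) : ∃ η : ℝ, 0 < η ∧
    ∀ (C : ℕ → ℝ) (δ : ℝ) (u₀ : X) (φ : X → Y) (φ' : X → X →ₗ[ℝ] Y)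
      (φ'' : X → X →ₗ[ℝ] X →ₗ[ℝ] Y) (ψ : X → Y → X) (ℰ : X → Y → Y → Y),
      IsTamelyInvertible NX NY d M C δ u₀ φ φ' φ'' ψ ℰ →
      (∀ s, d ≤ s → s ≤ 27 * d → C s ≤ M) → 0 < δ → δ⁻¹ ≤ M → NX (27 * d) u₀ ≤ M →
      NY (2 * d) (φ u₀) ≤ η → ∃ u, φ u = 0 := by
  obtain ⟨S, hS, hS'⟩ := hX.smoothing (22 * d)
  obtain ⟨θ₀, K, r, hθ₀, H⟩ := exists_newtonSeq_bounds hX hY hd hM hS hS'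
  have hθ0 : 0 < θ₀ := by linarith
  -- The smallness of `φ u₀` is exactly the third invariant at `j = 0`.
  refine ⟨((θ₀ ^ d) ^ 10)⁻¹, by positivity, ?_⟩
  intro C δ u₀ φ φ' φ'' ψ ℰ h hC hδ hδM hu₀ hφ₀
  obtain ⟨hr, hj⟩ := H C δ u₀ φ φ' φ'' ψ ℰ h hC hδ hδM hu₀
    ((le_inv_mul_iff₀' (by positivity)).1 (by simpa using hφ₀))
  have hball : ∀ j, NX (3 * d) (newtonSeq S φ ψ (newtonScale θ₀) u₀ j - u₀) < δ :=
    fun j => (hj j).1.trans_lt hr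
  have hθj : ∀ j, 2 ^ j ≤ newtonScale θ₀ j := fun j =>
    (le_mul_of_one_le_left (by positivity) (by linarith)).trans (mul_two_pow_le_newtonScale hθ₀ j)
  have hθ1 : ∀ j, 1 ≤ newtonScale θ₀ j := fun j => le_trans (one_le_pow₀ (by norm_num)) (hθj j)
  have hqj : ∀ j, 2 ^ j ≤ (newtonScale θ₀ j ^ d) ^ 10 := fun j =>
    (hθj j).trans ((le_self_pow₀ (hθ1 j) hd.ne').trans
      (le_self_pow₀ (one_le_pow₀ (hθ1 j)) (by norm_num)))
  have hφj : ∀ j, NY (2 * d) (φ (newtonSeq S φ ψ (newtonScale θ₀) u₀ j)) ≤ (1 / 2) ^ j := by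
    intro j
    rw [div_pow, one_pow, le_div_iff₀ (by positivity)]
    exact (mul_le_mul_of_nonneg_left (hqj j) (apply_nonneg _ _)).trans (hj j).2.1
  have hφ1 : ∀ j, NY (2 * d) (φ (newtonSeq S φ ψ (newtonScale θ₀) u₀ j)) ≤ 1 := fun j =>
    (hφj j).trans (pow_le_one₀ (by norm_num) (by norm_num))
  set u := newtonSeq S φ ψ (newtonScale θ₀) u₀ with hu
  have hgeom : ∀ s, ∃ A : ℝ, ∀ j, NX s (u (j + 1) - u j) ≤ A * (1 / 2) ^ j := by
    intro s
    obtain ⟨A, hA⟩ := exists_newtonSeq_sub_le_geometric hX hd hθ₀ hS h hball hφ1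
      (fun j => (hj j).2.2) (le_max_right s (3 * d))
    obtain ⟨c, hc, hmono⟩ := hX.mono s (max s (3 * d)) (le_max_left _ _)
    refine ⟨c * A, fun j => (hmono _).trans ?_⟩
    rw [mul_assoc]
    exact mul_le_mul_of_nonneg_left (hA j) hc
  obtain ⟨w, hw⟩ := hX.complete u fun s =>
    exists_seminorm_sub_le_of_geometric (hgeom s).choose_spec
  have hw3 := hw (3 * d)
  have hwball : NX (3 * d) (w - u₀) ≤ r := by
    have h1 : Tendsto (fun j => NX (3 * d) (u j - w) + r) atTop (𝓝 (0 + r)) :=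
      hw3.add tendsto_const_nhds
    rw [zero_add] at h1
    refine ge_of_tendsto' h1 fun j => ?_
    have h2 := map_sub_le_add (NX (3 * d)) (u j - u₀) (u j - w)
    rw [sub_sub_sub_cancel_left] at h2
    linarith [(hj j).1]
  refine ⟨w, hY.separated (2 * d) _ (le_antisymm ?_ (apply_nonneg _ _))⟩
  have hlim : Tendsto (fun j => (1 / 2 : ℝ) ^ j + M * NX (3 * d) (u j - w)) atTop
      (𝓝 (0 + M * 0)) :=
    (tendsto_pow_atTop_nhds_zero_of_lt_one (by norm_num) (by norm_num)).add (hw3.const_mul M)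
  rw [mul_zero, zero_add] at hlim
  refine ge_of_tendsto' hlim fun j => ?_
  -- Lipschitz continuity of `φ` in the ball passes `φ (u j) → 0` to the limit; the strict
  -- inequality `r < δ` keeps `w` inside.
  have h1 := h.map_sub_le (hwball.trans_lt hr) (v := u j - w)
    (by rw [add_sub_cancel]; exact hball j)
  rw [add_sub_cancel] at h1
  have h2 := map_sub_le_add (NY (2 * d)) (φ (u j)) (φ (u j) - φ w)
  rw [sub_sub_cancel] at h2
  linarith [hφj j]
end Iteration
end NashMoser

/-! ### The theorem for sections of vector bundles. -/

theorem mainTheorem9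
    -- the compact manifold `Z`, possibly with boundary
    {n : ℕ} {H : Type*} [TopologicalSpace H]
    (I : ModelWithCorners ℝ (EuclideanSpace ℝ (Fin n)) H) (hI : NashMoser.IsBoundaryModel I)
    {Z : Type*} [TopologicalSpace Z] [ChartedSpace H Z] [IsManifold I ∞ Z]
    [CompactSpace Z] [T2Space Z]
    -- the smooth vector bundles `V` and `W` of finite rank; only the underlying real bundles of
    -- Hermitian bundles enter
    {F : Type*} [NormedAddCommGroup F] [NormedSpace ℝ F] [FiniteDimensional ℝ F]
    {V : Z → Type*} [TopologicalSpace (TotalSpace F V)]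
    [∀ x, AddCommGroup (V x)] [∀ x, Module ℝ (V x)] [∀ x, TopologicalSpace (V x)]
    [FiberBundle F V] [VectorBundle ℝ F V] [ContMDiffVectorBundle ∞ F V I]
    {G : Type*} [NormedAddCommGroup G] [NormedSpace ℝ G] [FiniteDimensional ℝ G]
    {W : Z → Type*} [TopologicalSpace (TotalSpace G W)]
    [∀ x, AddCommGroup (W x)] [∀ x, Module ℝ (W x)] [∀ x, TopologicalSpace (W x)]
    [FiberBundle G W] [VectorBundle ℝ G W] [ContMDiffVectorBundle ∞ G W I]
    -- the `L²_s`-norms on sections of `V` and of `W`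
    (NV : ℕ → Seminorm ℝ Cₛ^∞⟮I; F, V⟯) (hNV : NashMoser.IsSobolevNorms NV)
    (NW : ℕ → Seminorm ℝ Cₛ^∞⟮I; G, W⟯) (hNW : NashMoser.IsSobolevNorms NW)
    (d : ℕ) (hd : 0 < d) :
    -- the threshold `η` for `‖φ(u₀)‖_{2d}` depends only on an upper bound `M` for `1/δ`,
    -- `|u₀|_D`, `C₁`, `C₂`, `C₃` and the finitely many `C_s` with `d ≤ s ≤ D`
    ∃ D : ℕ, ∀ M : ℝ, ∃ η : ℝ, 0 < η ∧
      ∀ (φ : Cₛ^∞⟮I; F, V⟯ → Cₛ^∞⟮I; G, W⟯)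
        (φ' : Cₛ^∞⟮I; F, V⟯ → Cₛ^∞⟮I; F, V⟯ →ₗ[ℝ] Cₛ^∞⟮I; G, W⟯)
        (φ'' : Cₛ^∞⟮I; F, V⟯ → Cₛ^∞⟮I; F, V⟯ →ₗ[ℝ] Cₛ^∞⟮I; F, V⟯ →ₗ[ℝ] Cₛ^∞⟮I; G, W⟯)
        (ψ : Cₛ^∞⟮I; F, V⟯ → Cₛ^∞⟮I; G, W⟯ → Cₛ^∞⟮I; F, V⟯)
        (ℰ : Cₛ^∞⟮I; F, V⟯ → Cₛ^∞⟮I; G, W⟯ → Cₛ^∞⟮I; G, W⟯ → Cₛ^∞⟮I; G, W⟯)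
        (u₀ : Cₛ^∞⟮I; F, V⟯) (δ C₁ C₂ C₃ : ℝ) (C : ℕ → ℝ),
        0 < δ →
        -- `φ'` and `φ''` are the first and second derivatives of `φ`
        (∀ u, NV (3 * d) (u - u₀) < δ → NashMoser.HasDerivativeAt NW φ (φ' u) u) →
        (∀ u, NV (3 * d) (u - u₀) < δ → ∀ v,
          NashMoser.HasDerivativeAt NW (fun u' => φ' u' v) (φ'' u v) u) →
        -- tame bounds
        (∀ u, NV (3 * d) (u - u₀) < δ → ∀ s, d ≤ s →
          NW s (φ u) ≤ C s * (1 + NV (s + d) u)) →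
        (∀ u, NV (3 * d) (u - u₀) < δ → ∀ v,
          NW (2 * d) (φ' u v) ≤ C₁ * NV (3 * d) v) →
        (∀ u, NV (3 * d) (u - u₀) < δ → ∀ v w,
          NW (2 * d) (φ'' u v w) ≤ C₂ * NV (3 * d) v * NV (3 * d) w) →
        -- approximate right inverse
        (∀ u, NV (3 * d) (u - u₀) < δ → ∀ f,
          φ' u (ψ u f) = f + ℰ u (φ u) f) →
        (∀ u, NV (3 * d) (u - u₀) < δ → ∀ f g,
          NW (2 * d) (ℰ u f g) ≤ C₃ * NW (3 * d) f * NW (3 * d) g) →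
        (∀ u, NV (3 * d) (u - u₀) < δ → ∀ f, ∀ s, d ≤ s →
          NV s (ψ u f) ≤ C s * (NW (s + d) f + NV (s + d) u * NW (2 * d) f)) →
        -- bounds on the constants, and smallness
        δ⁻¹ ≤ M → NV D u₀ ≤ M → C₁ ≤ M → C₂ ≤ M → C₃ ≤ M →
        (∀ s, d ≤ s → s ≤ D → C s ≤ M) →
        NW (2 * d) (φ u₀) ≤ η →
        ∃ u, φ u = 0 := by
  have hcone := hI.isSolidCone
  -- The highest order entering the low-norm invariants, and hence `η`.
  refine ⟨27 * d, fun M => ?_⟩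
  -- The abstract theorem asks for a bound at least one; enlarging `M` to `max M 1` weakens all the
  -- hypotheses.
  obtain ⟨η, hη, H⟩ := NashMoser.exists_zero_of_isTamelyInvertible (hNV.isTameScale hcone)
    (hNW.isTameScale hcone) hd (le_max_right M 1)
  refine ⟨η, hη, ?_⟩
  intro φ φ' φ'' ψ ℰ u₀ δ C₁ C₂ C₃ C hδ hd₁ hd₂ hφ hφ' hφ'' hψ hℰ hψs hδM hu₀ hC₁ hC₂ hC₃ hC hη₀
  have hM : M ≤ max M 1 := le_max_left _ _
  refine H C δ u₀ φ φ' φ'' ψ ℰ ⟨hd₁, hd₂, hφ, fun u hu v => ?_, fun u hu v w => ?_, hψ,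
    fun u hu f g => ?_, hψs⟩ (fun s h1 h2 => (hC s h1 h2).trans hM) hδ (hδM.trans hM)
    (hu₀.trans hM) hη₀
  · exact (hφ' u hu v).trans (mul_le_mul_of_nonneg_right (hC₁.trans hM) (apply_nonneg _ _))
  · exact (hφ'' u hu v w).trans (mul_le_mul_of_nonneg_right (mul_le_mul_of_nonneg_right
      (hC₂.trans hM) (apply_nonneg _ _)) (apply_nonneg _ _))
  · exact (hℰ u hu f g).trans (mul_le_mul_of_nonneg_right (mul_le_mul_of_nonneg_right
      (hC₃.trans hM) (apply_nonneg _ _)) (apply_nonneg _ _))
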